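/- **Setting.** Fix $k,p$. For $n=1,2,\dots$ (an index suppressed below) consider linear mixed models $y=X\beta+Zv+\varepsilon$ with $y\in\mathbb R^{N}$, $v\in\mathbb R^{m}$, $\beta\in\mathbb R^p$, known $X$ ($N\times p$) and $Z$ ($N\times m$), where $v$ and $\varepsilon$ are independent with mean zero, $\mathrm{Cov}(v)=R_v(\psi)$, $\mathrm{Cov}(\varepsilon)=R_e(\psi)$ positive definite, $\psi\in\Psi\subset\mathbb R^k$, and $E[\{(R_e^{-1/2}\varepsilon)_i\}^4]=K_e+3$, $E[\{(R_v^{-1/2}v)_i\}^4]=K_v+3$ (symmetric square roots). Put $\Sigma(\psi)=R_e(\psi)+ZR_v(\psi)Z^\top$ and $\Sigma_{(a)}=\partial\Sigma/\partial\psi_a$. Let $\hat\beta=L(\psi)y$ with $L(\psi)X=I$, and $Q=I-XL$. For weight matrices $W_a(\psi)$, $a=1,\dots,k$, the estimator $\hat\psi$ based on $W_a$ is a random vector with values in $\Psi$ that solves $$y^\top Q^\top W_aQy-\mathrm{tr}(Q^\top W_aQ\Sigma)=0,\qquad a=1,\dots,k,$$ whenever these equations have a solution in $\Psi$. The true value of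 $\psi$, at which all distributional quantities and the matrices in the conclusions are evaluated, is a fixed point of $\Psi$. **Assumptions.** $K_e=K_v=0$, and $\Sigma$ is a linear function of $\psi\in\Psi$ (a known constant term is allowed). Regularity: $N\to\infty$; $\Psi$ is open, convex and bounded; the eigenvalues of $\Sigma(\psi)$ lie between two positive constants, uniformly in $\psi\in\Psi$ and all large $n$; the smallest eigenvalue of the $k\times k$ matrix with entries $\mathrm{tr}(\Sigma_{(a)}\Sigma_{(b)})$ is at least a positive constant times $N$ for all large $n$; the coordinates of $R_e^{-1/2}\varepsilon$ are independent, so are those of $R_v^{-1/2}v$, and their eighth moments are uniformly bounded. Order conditions, for the weights $W_a$ of the estimator considered: $(L^\top X^\top W_aXL)_{ij}=O(N^{-1})$ and $(L\Sigma L^\top)_{ij}=O(N^{-1})$ uniformly in $i,j$ at the true $\psi$; the entries of $XL$ are three times continuously differentiable in $\psi\in\Psi$, and they and their derivatives in $\psi$ up to order three are $O(N^{-1})$ uniformly in $i,j$ and $\psi\in\Psi$ (for $L$ not depending on $\psi$, such as ordinary least squares, this only says $(XL)_{ij}=O(N^{-1})$). An estimator $\hat\psi$ has *asymptotic covariance matrix*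 $V$ if $\mathrm{Cov}(\hat\psi)=V+O(N^{-3/2})$, and *second-order bias* $b$ if $E(\hat\psi-\psi)=b+O(N^{-3/2})$; it is *second-order unbiased* if $E(\hat\psi-\psi)=O(N^{-3/2})$. **Proposition 2.** Under these assumptions: (a) The REML-type estimator, $W_a=\Sigma^{-1}\Sigma_{(a)}\Sigma^{-1}$, is second-order unbiased and has asymptotic covariance matrix $2A_{RE}^{-1}$, where $(A_{RE})_{ij}=\mathrm{tr}(\Sigma^{-1}\Sigma_{(i)}\Sigma^{-1}\Sigma_{(j)})$. (b) The FH-type estimator, $W_a=(\Sigma^{-1}\Sigma_{(a)}+\Sigma_{(a)}\Sigma^{-1})/2$, has asymptotic covariance matrix $2A_{FH}^{-1}B_{FH}A_{FH}^{-1}$, where $(A_{FH})_{ij}=\mathrm{tr}(\Sigma^{-1}\Sigma_{(i)}\Sigma_{(j)})$ and $(B_{FH})_{ij}=\{\mathrm{tr}(\Sigma_{(i)}\Sigma_{(j)})+\mathrm{tr}(\Sigma^{-1}\Sigma_{(i)}\Sigma\Sigma_{(j)})\}/2$, and second-order bias $$2A_{FH}^{-1}\,\mathrm{col}_a\big[\mathrm{tr}(K_aA_{FH}^{-1}-H_aA_{FH}^{-1}B_{FH}A_{FH}^{-1})\big],$$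 where $(K_a)_{bc}=-\mathrm{tr}\{\Sigma_{(a)}(\Sigma_{(b)}+\Sigma\Sigma_{(b)}\Sigma^{-1})\Sigma_{(c)}\Sigma^{-1}\}/2$, $(H_a)_{bc}=-\mathrm{tr}\{\Sigma_{(a)}\Sigma_{(b)}\Sigma^{-1}\Sigma_{(c)}\Sigma^{-1}\}$ and $\mathrm{col}_a(x_a)=(x_1,\dots,x_k)^\top$. It is in general not second-order unbiased: there are models with $p\ge 1$ satisfying all the assumptions in which an FH-type estimator is not. (c) The PR-type estimator, $W_a=\Sigma_{(a)}$, is second-order unbiased and has asymptotic covariance matrix $2A_Q^{-1}B_QA_Q^{-1}$, where $(A_Q)_{ij}=\mathrm{tr}(\Sigma_{(i)}\Sigma_{(j)})$ and $(B_Q)_{ij}=\mathrm{tr}(\Sigma_{(i)}\Sigma\Sigma_{(j)}\Sigma)$. In each case the matrix $A$ that is inverted is invertible for all large $n$. -/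

import Mathlib

open MeasureTheory ProbabilityTheory Filter Topology Asymptotics
open scoped Matrix MatrixOrder

noncomputable section

namespace VarComp

/-- The standardized vector `R^{-1/2} x`, where `R^{1/2}` is the symmetric square root of `R`. -/
def whiten {d : ℕ} (R : Matrix (Fin d) (Fin d) ℝ) (x : Fin d → ℝ) : Fin d → ℝ :=
  (CFC.sqrt R)⁻¹ *ᵥ x

/-- The partial derivative `∂_a F` of a matrix-valued function of `ψ`, taken entry by entry. -/
def pderiv {k r s : ℕ} (F : (Fin k → ℝ) → Matrix (Fin r) (Fin s) ℝ) (a : Fin k)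
    (ψ : Fin k → ℝ) : Matrix (Fin r) (Fin s) ℝ :=
  Matrix.of fun i j => lineDeriv ℝ (fun φ => F φ i j) ψ (Pi.single a 1)

/-- A sequence (indexed by `n`) of linear mixed models `y = X β + Z v + ε`, where `y` has
`N n` coordinates and `v` has `m n` coordinates; the numbers `p` of regression coefficients and
`k` of variance parameters are fixed. `Ψ` is the parameter region and `ψ₀` the true parameter. -/
structure Model (k p : ℕ) {Ω : Type*} [MeasurableSpace Ω] (μ : Measure Ω) where
  N : ℕ → ℕ
  m : ℕ → ℕ
  X : ∀ n, Matrix (Fin (N n)) (Fin p) ℝ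
  Z : ∀ n, Matrix (Fin (N n)) (Fin (m n)) ℝ
  Re : ∀ n, (Fin k → ℝ) → Matrix (Fin (N n)) (Fin (N n)) ℝ
  Rv : ∀ n, (Fin k → ℝ) → Matrix (Fin (m n)) (Fin (m n)) ℝ
  Ψ : Set (Fin k → ℝ)
  ψ₀ : Fin k → ℝ
  β : Fin p → ℝ
  Ke : ℝ
  Kv : ℝ
  ε : ∀ n, Ω → Fin (N n) → ℝ
  v : ∀ n, Ω → Fin (m n) → ℝ
  true_mem : ψ₀ ∈ Ψ
  Re_posDef : ∀ n, ∀ ψ ∈ Ψ, (Re n ψ).PosDef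
  Rv_posDef : ∀ n, ∀ ψ ∈ Ψ, (Rv n ψ).PosDef
  measurable_ε : ∀ n, Measurable (ε n)
  measurable_v : ∀ n, Measurable (v n)
  memLp_ε : ∀ n i, MemLp (fun ω => ε n ω i) 4 μ
  memLp_v : ∀ n i, MemLp (fun ω => v n ω i) 4 μ
  indep : ∀ n, IndepFun (v n) (ε n) μ
  mean_ε : ∀ n i, ∫ ω, ε n ω i ∂μ = 0
  mean_v : ∀ n i, ∫ ω, v n ω i ∂μ = 0
  cov_ε : ∀ n i j, ∫ ω, ε n ω i * ε n ω j ∂μ = Re n ψ₀ i j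
  cov_v : ∀ n i j, ∫ ω, v n ω i * v n ω j ∂μ = Rv n ψ₀ i j
  fourth_ε : ∀ n i, ∫ ω, (whiten (Re n ψ₀) (ε n ω) i) ^ 4 ∂μ = Ke + 3
  fourth_v : ∀ n i, ∫ ω, (whiten (Rv n ψ₀) (v n ω) i) ^ 4 ∂μ = Kv + 3

/-- The matrices `L n ψ` of the estimators `L y` of `β`. -/
abbrev LinEst {k p : ℕ} {Ω : Type*} [MeasurableSpace Ω] {μ : Measure Ω} (M : Model k p μ) :=
  ∀ n, (Fin k → ℝ) → Matrix (Fin p) (Fin (M.N n)) ℝ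

/-- The weight matrices `W n a ψ` of the estimating equations. -/
abbrev Weights {k p : ℕ} {Ω : Type*} [MeasurableSpace Ω] {μ : Measure Ω} (M : Model k p μ) :=
  ∀ n, Fin k → (Fin k → ℝ) → Matrix (Fin (M.N n)) (Fin (M.N n)) ℝ

namespace Model

variable {k p : ℕ} {Ω : Type*} [MeasurableSpace Ω] {μ : Measure Ω} (M : Model k p μ)

/-- The observation `y = X β + Z v + ε`. -/
def y (n : ℕ) (ω : Ω) : Fin (M.N n) → ℝ :=
  M.X n *ᵥ M.β + M.Z n *ᵥ M.v n ω + M.ε n ω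

/-- `Σ(ψ) = R_e(ψ) + Z R_v(ψ) Zᵀ`. -/
def Sig (n : ℕ) (ψ : Fin k → ℝ) : Matrix (Fin (M.N n)) (Fin (M.N n)) ℝ :=
  M.Re n ψ + M.Z n * M.Rv n ψ * (M.Z n)ᵀ

/-- `Σ_(a)(ψ) = ∂_a Σ(ψ)`. -/
def dSig (n : ℕ) (a : Fin k) (ψ : Fin k → ℝ) : Matrix (Fin (M.N n)) (Fin (M.N n)) ℝ :=
  pderiv (M.Sig n) a ψ

/-- `Σ` is a linear function of `ψ` on the parameter region (a known constant term, such as the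
matrix of known sampling variances, is allowed). -/
def SigLinear : Prop :=
  ∀ n, ∃ (S₀ : Matrix (Fin (M.N n)) (Fin (M.N n)) ℝ)
    (S : Fin k → Matrix (Fin (M.N n)) (Fin (M.N n)) ℝ),
    ∀ ψ ∈ M.Ψ, M.Sig n ψ = S₀ + ∑ a, ψ a • S a

/-- `Q(ψ) = I - X L(ψ)`. -/
def Q (L : LinEst M) (n : ℕ) (ψ : Fin k → ℝ) : Matrix (Fin (M.N n)) (Fin (M.N n)) ℝ :=
  1 - M.X n * L n ψ

/-- The left-hand side `yᵀ Qᵀ W_a Q y - tr (Qᵀ W_a Q Σ)` of the `a`-th estimating equation. -/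
def ee (L : LinEst M) (W : Weights M) (n : ℕ) (a : Fin k) (ψ : Fin k → ℝ) (ω : Ω) : ℝ :=
  M.y n ω ⬝ᵥ (((M.Q L n ψ)ᵀ * W n a ψ * M.Q L n ψ) *ᵥ M.y n ω)
    - ((M.Q L n ψ)ᵀ * W n a ψ * M.Q L n ψ * M.Sig n ψ).trace

/-- `L y` is an unbiased estimator of `β`: `L X = I`. -/
def Unbiased (L : LinEst M) : Prop := ∀ n, ∀ ψ ∈ M.Ψ, L n ψ * M.X n = 1

/-- `ψhat` is an estimator with values in `Ψ` that solves the estimating equations whenever they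
have a solution in `Ψ`. -/
structure IsEstimator (L : LinEst M) (W : Weights M) (ψhat : ∀ _ : ℕ, Ω → Fin k → ℝ) : Prop where
  measurable : ∀ n, Measurable (ψhat n)
  mem : ∀ n ω, ψhat n ω ∈ M.Ψ
  solves : ∀ n ω, (∃ ψ ∈ M.Ψ, ∀ a, M.ee L W n a ψ ω = 0) → ∀ a, M.ee L W n a (ψhat n ω) ω = 0

/-- Standing regularity: `N → ∞`; the parameter region is open, convex and bounded; the
eigenvalues of `Σ` are bounded and bounded away from zero; the matrix `tr (Σ_(a) Σ_(b))` is at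
least of order `N`; the standardized errors and random effects have independent coordinates with
uniformly bounded eighth moments. -/
structure Regular : Prop where
  tendsto_N : Tendsto M.N atTop atTop
  isOpen : IsOpen M.Ψ
  convex : Convex ℝ M.Ψ
  bounded : Bornology.IsBounded M.Ψ
  eigen : ∃ c C : ℝ, 0 < c ∧ ∀ᶠ n in atTop, ∀ ψ ∈ M.Ψ, ∀ x : Fin (M.N n) → ℝ,
    c * (x ⬝ᵥ x) ≤ x ⬝ᵥ (M.Sig n ψ *ᵥ x) ∧ x ⬝ᵥ (M.Sig n ψ *ᵥ x) ≤ C * (x ⬝ᵥ x)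
  ident : ∃ c : ℝ, 0 < c ∧ ∀ᶠ n in atTop, ∀ t : Fin k → ℝ,
    c * (M.N n : ℝ) * (t ⬝ᵥ t) ≤
      ∑ a, ∑ b, t a * t b * (M.dSig n a M.ψ₀ * M.dSig n b M.ψ₀).trace
  indep_ε : ∀ n, iIndepFun (fun i ω => whiten (M.Re n M.ψ₀) (M.ε n ω) i) μ
  indep_v : ∀ n, iIndepFun (fun i ω => whiten (M.Rv n M.ψ₀) (M.v n ω) i) μ
  eighth_ε : ∃ C : ℝ, ∀ n i, MemLp (fun ω => whiten (M.Re n M.ψ₀) (M.ε n ω) i) 8 μ ∧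
    ∫ ω, (whiten (M.Re n M.ψ₀) (M.ε n ω) i) ^ 8 ∂μ ≤ C
  eighth_v : ∃ C : ℝ, ∀ n i, MemLp (fun ω => whiten (M.Rv n M.ψ₀) (M.v n ω) i) 8 μ ∧
    ∫ ω, (whiten (M.Rv n M.ψ₀) (M.v n ω) i) ^ 8 ∂μ ≤ C

/-- The order conditions on `L` and `W`: `(Lᵀ Xᵀ W_a X L)_{ij} = O(N⁻¹)`, `L Σ Lᵀ = O(N⁻¹)`, and
`(X L)_{ij} = O(N⁻¹)`, the last one together with the partial derivatives in `ψ` up to order three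
(which vanish when `L` does not depend on `ψ`), uniformly in `i`, `j` and `ψ`. -/
structure OrderConditions (L : LinEst M) (W : Weights M) : Prop where
  smooth : ∀ n i j, ContDiffOn ℝ 3 (fun ψ => (M.X n * L n ψ) i j) M.Ψ
  quad : ∃ C : ℝ, ∀ᶠ n in atTop, ∀ a i j,
    |((L n M.ψ₀)ᵀ * (M.X n)ᵀ * W n a M.ψ₀ * M.X n * L n M.ψ₀) i j| ≤ C / (M.N n : ℝ)
  covL : ∃ C : ℝ, ∀ᶠ n in atTop, ∀ i j,
    |(L n M.ψ₀ * M.Sig n M.ψ₀ * (L n M.ψ₀)ᵀ) i j| ≤ C / (M.N n : ℝ)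
  leverage : ∃ C : ℝ, ∀ᶠ n in atTop, ∀ r ≤ 3, ∀ ψ ∈ M.Ψ, ∀ i j,
    ‖iteratedFDeriv ℝ r (fun φ => (M.X n * L n φ) i j) ψ‖ ≤ C / (M.N n : ℝ)

/-- `Cov(ψhat) = V + O(N^{-3/2})`, entry by entry. -/
def HasAsympCov (ψhat : ∀ _ : ℕ, Ω → Fin k → ℝ) (V : ℕ → Matrix (Fin k) (Fin k) ℝ) : Prop :=
  ∀ a b, (fun n => cov[fun ω => ψhat n ω a, fun ω => ψhat n ω b; μ] - V n a b)
    =O[atTop] fun n => (M.N n : ℝ) ^ (-(3 / 2) : ℝ)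

/-- `E(ψhat - ψ) = b + O(N^{-3/2})`, entry by entry. -/
def HasSecondOrderBias (ψhat : ∀ _ : ℕ, Ω → Fin k → ℝ) (b : ℕ → Fin k → ℝ) : Prop :=
  ∀ a, (fun n => (∫ ω, (ψhat n ω a - M.ψ₀ a) ∂μ) - b n a)
    =O[atTop] fun n => (M.N n : ℝ) ^ (-(3 / 2) : ℝ)

/-- Second-order unbiasedness: `E(ψhat - ψ) = O(N^{-3/2})`. -/
def SecondOrderUnbiased (ψhat : ∀ _ : ℕ, Ω → Fin k → ℝ) : Prop :=
  M.HasSecondOrderBias ψhat fun _ _ => 0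

/-- `W_a = Σ⁻¹ Σ_(a) Σ⁻¹`. -/
def WRE : Weights M := fun n a ψ => (M.Sig n ψ)⁻¹ * M.dSig n a ψ * (M.Sig n ψ)⁻¹

/-- `W_a = (Σ⁻¹ Σ_(a) + Σ_(a) Σ⁻¹) / 2`. -/
def WFH : Weights M := fun n a ψ =>
  (1 / 2 : ℝ) • ((M.Sig n ψ)⁻¹ * M.dSig n a ψ + M.dSig n a ψ * (M.Sig n ψ)⁻¹)

/-- `W_a = Σ_(a)`. -/
def WQ : Weights M := fun n a ψ => M.dSig n a ψ

/-- `Σ` at the true parameter. -/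
def S (n : ℕ) : Matrix (Fin (M.N n)) (Fin (M.N n)) ℝ := M.Sig n M.ψ₀

/-- `Σ_(a)` at the true parameter. -/
def D (n : ℕ) (a : Fin k) : Matrix (Fin (M.N n)) (Fin (M.N n)) ℝ := M.dSig n a M.ψ₀

def ARE (n : ℕ) : Matrix (Fin k) (Fin k) ℝ :=
  Matrix.of fun i j => ((M.S n)⁻¹ * M.D n i * (M.S n)⁻¹ * M.D n j).trace

def AFH (n : ℕ) : Matrix (Fin k) (Fin k) ℝ :=
  Matrix.of fun i j => ((M.S n)⁻¹ * M.D n i * M.D n j).trace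

def BFH (n : ℕ) : Matrix (Fin k) (Fin k) ℝ :=
  Matrix.of fun i j =>
    ((M.D n i * M.D n j).trace + ((M.S n)⁻¹ * M.D n i * M.S n * M.D n j).trace) / 2

def KFH (n : ℕ) (a : Fin k) : Matrix (Fin k) (Fin k) ℝ :=
  Matrix.of fun b c =>
    -(M.D n a * (M.D n b + M.S n * M.D n b * (M.S n)⁻¹) * M.D n c * (M.S n)⁻¹).trace / 2

def HFH (n : ℕ) (a : Fin k) : Matrix (Fin k) (Fin k) ℝ :=
  Matrix.of fun b c => -(M.D n a * M.D n b * (M.S n)⁻¹ * M.D n c * (M.S n)⁻¹).trace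

/-- `2 A⁻¹ col_a { tr (K_a A⁻¹ - H_a A⁻¹ B A⁻¹) }` for the FH-type estimator. -/
def biasFH (n : ℕ) : Fin k → ℝ :=
  (2 : ℝ) • ((M.AFH n)⁻¹ *ᵥ fun a =>
    (M.KFH n a * (M.AFH n)⁻¹ - M.HFH n a * (M.AFH n)⁻¹ * M.BFH n * (M.AFH n)⁻¹).trace)

def AQ (n : ℕ) : Matrix (Fin k) (Fin k) ℝ :=
  Matrix.of fun i j => (M.D n i * M.D n j).trace

def BQ (n : ℕ) : Matrix (Fin k) (Fin k) ℝ :=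
  Matrix.of fun i j => (M.D n i * M.S n * M.D n j * M.S n).trace

end Model

end VarComp

end

/-! Put u = y - Xβ = Zv + ε, P = XL, Q = I - P and G_a = QᵀW_aQ. Since LX = I, QX = 0 and β
disappears from the estimating equations. Since Σ is affine on Ψ, Σ(ψ) = Σ + ∑_b (ψ - ψ₀)_b Σ_(b)
there, so after division by N the equations read f_a(ψ) = ∑_b α_ab(ψ) (ψ - ψ₀)_b. Here f_a = (uᵀG_a
u - tr(G_a Σ))/N is random and centered, and α_ab = tr(G_a Σ_(b))/N is deterministic and coercive
uniformly on Ψ.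

Moments. u is a linear image of independent standardized variables. Whittle's inequality
(`StdIndep.sqrt_fourth_quadForm_le`) shows that f at each point of Ψ, and its Taylor coefficients at
ψ₀, have size N^{-1/2} in L⁴. Vanishing excess kurtosis gives the exact covariances 2 tr(GΣHΣ)
(`Model.integral_qf_mul`).

Roots. If f is small at ψ₀ and on a finite net of Ψ, together with its first derivatives at ψ₀, then
a root exists and every root in Ψ is close to ψ₀ (`exists_net_isRoot`). With A = α(ψ₀), a root
satisfies ψ - ψ₀ = h₁ + h₂ + cubic error, where h₁ = A⁻¹f(ψ₀) and h₂ = A⁻¹(∂f[h₁] - ∂α[h₁,h₁])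
(`root_expansion`). The exceptional event has probability O(N⁻²) and Ψ is bounded, so the expansion
may be integrated: the bias is E h₂ and the covariance is E h₁h₁ᵀ, up to O(N^{-3/2})
(`mean_cov_of_isRoot`).

From G to W. P is idempotent with entries O(1/N), so P = P·P is a product of two matrices of bounded
Frobenius norm and has bounded nuclear norm. The same holds for its derivatives at ψ₀. Replacing G_a
by W_a therefore changes each trace by O(1), and the bias and the covariance by O(N⁻²).

The result is the covariance 2A⁻¹BA⁻¹ and the bias 2A⁻¹ col_a tr(K_aA⁻¹ - H_aA⁻¹BA⁻¹)
(`Model.estimator_asymptotics`), now with unnormalized traces A and B. For REML, B = A and K = H, so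
the bias cancels. For PR, the weights are constant and K = H = 0. For FH, the bias is proportional
to N tr Σ⁻² - (tr Σ⁻¹)² when k = 1 and Σ_(1) = I, which is positive as soon as the variances differ;
two groups of observations with variances 1 and 2 give the counterexample. -/

noncomputable section

set_option linter.unusedSectionVars false

namespace VarComp

/-! ### Linear and quadratic forms, built one index at a time -/

section Forms

variable {Ω : Type*} {ι : Type*}

/-- The linear form `∑_{i ∈ s} b_i ξ_i`. -/
def linForm (ξ : ι → Ω → ℝ) (b : ι → ℝ) (s : Finset ι) (ω : Ω) : ℝ := ∑ i ∈ s, b i * ξ i ω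

/-- The centered quadratic form `∑_{i,j ∈ s} b_{ij} ξ_i ξ_j - ∑_{i ∈ s} b_{ii}`. -/
def quadForm (ξ : ι → Ω → ℝ) (b : ι → ι → ℝ) (s : Finset ι) (ω : Ω) : ℝ :=
  ∑ i ∈ s, ∑ j ∈ s, b i j * (ξ i ω * ξ j ω) - ∑ i ∈ s, b i i

/-- The increment of `quadForm` when the index `i` is added to `s`. -/
def quadInc (ξ : ι → Ω → ℝ) (b : ι → ι → ℝ) (s : Finset ι) (i : ι) (ω : Ω) : ℝ :=
  linForm ξ (fun j => b i j + b j i) s ω * ξ i ω + b i i * (ξ i ω ^ 2 - 1)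

variable [DecidableEq ι] {ξ : ι → Ω → ℝ}

/-- For independent standardized variables this is a martingale decomposition: the increment is ξ_i
times a linear form in the earlier variables, plus a multiple of ξ_i² - 1. The moments of quadratic
forms are computed by induction along it. -/
theorem quadForm_insert (b : ι → ι → ℝ) {s : Finset ι} {i : ι} (hi : i ∉ s) (ω : Ω) :
    quadForm ξ b (insert i s) ω = quadForm ξ b s ω + quadInc ξ b s i ω := by
  simp only [quadForm, quadInc, linForm, Finset.sum_insert hi, Finset.sum_add_distrib,
    Finset.sum_mul, add_mul]
  have : ∀ j, b j i * ξ j ω * ξ i ω = b j i * (ξ j ω * ξ i ω) := fun j => by ring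
  have h2 : ∀ j, b i j * ξ j ω * ξ i ω = b i j * (ξ i ω * ξ j ω) := fun j => by ring
  simp only [this, h2]
  ring

theorem linForm_insert (b : ι → ℝ) {s : Finset ι} {i : ι} (hi : i ∉ s) (ω : Ω) :
    linForm ξ b (insert i s) ω = linForm ξ b s ω + b i * ξ i ω := by
  simp only [linForm, Finset.sum_insert hi]; ring

end Forms

/-! ### Moments of forms in independent standardized variables -/

section Moments

variable {Ω : Type*} [MeasurableSpace Ω] {μ : Measure Ω}

theorem MemLp.integrable_pow_four {X : Ω → ℝ} (hX : MemLp X 4 μ) :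
    Integrable (fun ω => X ω ^ 4) μ := by
  have h := hX.integrable_norm_rpow (by norm_num) (by norm_num)
  refine h.congr (ae_of_all _ fun ω => ?_)
  have : (ENNReal.toReal 4) = ((4 : ℕ) : ℝ) := by norm_num
  simp only [this, Real.rpow_natCast, Real.norm_eq_abs]
  exact Even.pow_abs (by decide) _

theorem MemLp.integrable_of_le_four {X Y Z : Ω → ℝ} (hX : MemLp X 4 μ) (hY : MemLp Y 4 μ)
    (hZ : AEStronglyMeasurable Z μ) (h : ∀ ω, |Z ω| ≤ X ω ^ 4 + Y ω ^ 4) : Integrable Z μ :=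
  (MemLp.integrable_pow_four hX |>.add (MemLp.integrable_pow_four hY)).mono' hZ
    (ae_of_all _ fun ω => h ω)

theorem integral_add_add {f g h : Ω → ℝ} (hf : Integrable f μ) (hg : Integrable g μ)
    (hh : Integrable h μ) :
    ∫ ω, (f ω + g ω + h ω) ∂μ = ∫ ω, f ω ∂μ + ∫ ω, g ω ∂μ + ∫ ω, h ω ∂μ := by
  rw [integral_add (f := fun ω => f ω + g ω) (hf.add hg) hh, integral_add hf hg]

theorem abs_cube_mul_le (x y : ℝ) : |x ^ 3 * y| ≤ x ^ 4 + y ^ 4 := by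
  rw [abs_le]
  constructor <;>
  nlinarith [sq_nonneg (x ^ 2 - x * y), sq_nonneg (x ^ 2 + x * y), sq_nonneg (x ^ 2 - y ^ 2),
    sq_nonneg (x * y), sq_nonneg (x ^ 2), sq_nonneg (y ^ 2)]

theorem abs_sq_mul_sq_le (x y : ℝ) : |x ^ 2 * y ^ 2| ≤ x ^ 4 + y ^ 4 := by
  rw [abs_of_nonneg (by positivity)]
  nlinarith [sq_nonneg (x ^ 2 - y ^ 2), sq_nonneg (x ^ 2), sq_nonneg (y ^ 2)]

/-- The Cauchy-Schwarz inequality for squares of `L⁴` functions. -/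
theorem integral_sq_mul_sq_le {X Y : Ω → ℝ} (hX : MemLp X 4 μ) (hY : MemLp Y 4 μ) :
    ∫ ω, X ω ^ 2 * Y ω ^ 2 ∂μ ≤ √(∫ ω, X ω ^ 4 ∂μ) * √(∫ ω, Y ω ^ 4 ∂μ) := by
  have iX := MemLp.integrable_pow_four hX
  have iY := MemLp.integrable_pow_four hY
  have iXY : Integrable (fun ω => X ω ^ 2 * Y ω ^ 2) μ :=
    MemLp.integrable_of_le_four hX hY ((hX.1.pow 2).mul (hY.1.pow 2)) fun ω => abs_sq_mul_sq_le _ _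
  have key : ∀ t : ℝ, 0 ≤ (∫ ω, X ω ^ 4 ∂μ) * (t * t) + (2 * ∫ ω, X ω ^ 2 * Y ω ^ 2 ∂μ) * t
      + ∫ ω, Y ω ^ 4 ∂μ := by
    intro t
    have : ∫ ω, (t * X ω ^ 2 + Y ω ^ 2) ^ 2 ∂μ = (∫ ω, X ω ^ 4 ∂μ) * (t * t)
        + (2 * ∫ ω, X ω ^ 2 * Y ω ^ 2 ∂μ) * t + ∫ ω, Y ω ^ 4 ∂μ := by
      rw [← integral_const_mul, ← integral_mul_const, ← integral_mul_const, ← integral_add,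
        ← integral_add]
      · congr 1; ext ω; ring
      · exact (iX.mul_const _).add ((iXY.const_mul _).mul_const _)
      · exact iY
      · exact iX.mul_const _
      · exact (iXY.const_mul _).mul_const _
    rw [← this]
    exact integral_nonneg fun ω => by positivity
  have hd := discrim_le_zero key
  rw [discrim] at hd
  rw [← Real.sqrt_mul (integral_nonneg fun ω => by positivity)]
  exact Real.le_sqrt_of_sq_le (by nlinarith)

/-- Pointwise (X + Y)⁴ ≤ X⁴ + 4X³Y + 8X²Y² + 3Y⁴, the difference being 2Y²(X - Y)². The cubic term
integrates to zero and the mixed term is bounded by Cauchy-Schwarz, which leaves less than the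
square of the right-hand side. The coefficient 1 in front of the first root is what makes the bound
iterable over many increments. -/
theorem sqrt_fourth_add_le {X Y : Ω → ℝ} (hX : MemLp X 4 μ) (hY : MemLp Y 4 μ)
    (h0 : ∫ ω, X ω ^ 3 * Y ω ∂μ = 0) :
    √(∫ ω, (X ω + Y ω) ^ 4 ∂μ) ≤ √(∫ ω, X ω ^ 4 ∂μ) + 4 * √(∫ ω, Y ω ^ 4 ∂μ) := by
  have iX := MemLp.integrable_pow_four hX
  have iY := MemLp.integrable_pow_four hY
  have iXY : Integrable (fun ω => X ω ^ 2 * Y ω ^ 2) μ :=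
    MemLp.integrable_of_le_four hX hY ((hX.1.pow 2).mul (hY.1.pow 2)) fun ω => abs_sq_mul_sq_le _ _
  have i31 : Integrable (fun ω => X ω ^ 3 * Y ω) μ :=
    MemLp.integrable_of_le_four hX hY ((hX.1.pow 3).mul hY.1) fun ω => abs_cube_mul_le _ _
  have hle : ∫ ω, (X ω + Y ω) ^ 4 ∂μ ≤ ∫ ω, (X ω ^ 4 + 4 * (X ω ^ 3 * Y ω)
      + 8 * (X ω ^ 2 * Y ω ^ 2) + 3 * Y ω ^ 4) ∂μ := by
    refine integral_mono (MemLp.integrable_pow_four (hX.add hY)) ?_ fun ω => ?_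
    · exact ((iX.add (i31.const_mul 4)).add (iXY.const_mul 8)).add (iY.const_mul 3)
    · simp only
      nlinarith [mul_nonneg (sq_nonneg (Y ω)) (sq_nonneg (X ω - Y ω))]
  rw [integral_add, integral_add, integral_add, integral_const_mul, integral_const_mul,
    integral_const_mul, h0] at hle
  rotate_left
  · exact iX
  · exact i31.const_mul 4
  · exact iX.add (i31.const_mul 4)
  · exact iXY.const_mul 8
  · exact (iX.add (i31.const_mul 4)).add (iXY.const_mul 8)
  · exact iY.const_mul 3
  have h2 := integral_sq_mul_sq_le hX hY
  have pX : 0 ≤ ∫ ω, X ω ^ 4 ∂μ := integral_nonneg fun ω => by positivity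
  have pY : 0 ≤ ∫ ω, Y ω ^ 4 ∂μ := integral_nonneg fun ω => by positivity
  refine Real.sqrt_le_iff.2 ⟨by positivity, hle.trans ?_⟩
  nlinarith [Real.sq_sqrt pX, Real.sq_sqrt pY]

/-- Independent standardized variables with the fourth moments of the normal distribution and
bounded eighth moments. -/
structure StdIndep {ι : Type*} (ξ : ι → Ω → ℝ) (K : ℝ) (μ : Measure Ω) : Prop where
  meas : ∀ i, Measurable (ξ i)
  indep : iIndepFun ξ μ
  memLp : ∀ i, MemLp (ξ i) 8 μ
  mean : ∀ i, ∫ ω, ξ i ω ∂μ = 0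
  var : ∀ i, ∫ ω, ξ i ω ^ 2 ∂μ = 1
  fourth : ∀ i, ∫ ω, ξ i ω ^ 4 ∂μ = 3
  eighth : ∀ i, ∫ ω, ξ i ω ^ 8 ∂μ ≤ K

variable [IsProbabilityMeasure μ] {ι : Type*} [DecidableEq ι] {ξ : ι → Ω → ℝ} {K : ℝ}

theorem StdIndep.memLp_four (h : StdIndep ξ K μ) (i : ι) : MemLp (ξ i) 4 μ :=
  (h.memLp i).mono_exponent (by norm_num)

instance holderTriple_eight : ENNReal.HolderTriple 8 8 4 := ⟨by
  rw [← ENNReal.toReal_eq_toReal_iff' (by simp) (by simp), ENNReal.toReal_add (by simp) (by simp)]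
  simp only [ENNReal.toReal_inv, ENNReal.toReal_ofNat]
  norm_num⟩

theorem StdIndep.memLp_mul (h : StdIndep ξ K μ) (i j : ι) :
    MemLp (fun ω => ξ i ω * ξ j ω) 4 μ :=
  (h.memLp j).mul (r := 4) (h.memLp i)

theorem StdIndep.memLp_linForm (h : StdIndep ξ K μ) (b : ι → ℝ) (s : Finset ι) :
    MemLp (linForm ξ b s) 8 μ :=
  memLp_finsetSum s fun i _ => (h.memLp i).const_mul (b i)

theorem StdIndep.memLp_quadForm (h : StdIndep ξ K μ) (b : ι → ι → ℝ) (s : Finset ι) :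
    MemLp (quadForm ξ b s) 4 μ :=
  (memLp_finsetSum s fun i _ => memLp_finsetSum s fun j _ => (h.memLp_mul i j).const_mul (b i j)).sub
    (memLp_const _)

theorem StdIndep.memLp_sq_sub_one (h : StdIndep ξ K μ) (i : ι) :
    MemLp (fun ω => ξ i ω ^ 2 - 1) 4 μ := by
  simp only [pow_two]
  exact (h.memLp_mul i i).sub (memLp_const 1)

theorem StdIndep.memLp_quadInc (h : StdIndep ξ K μ) (b : ι → ι → ℝ) (s : Finset ι) (i : ι) :
    MemLp (quadInc ξ b s i) 4 μ :=
  MemLp.add ((h.memLp i).mul (r := 4) (h.memLp_linForm _ s)) ((h.memLp_sq_sub_one i).const_mul _)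

/-- Every form over s is a measurable function of the variables with index in s, hence independent
of ξ_i. A quadratic form and two linear forms are carried along together so that one statement
serves all later factorizations. -/
theorem StdIndep.integral_mul_of_notMem (h : StdIndep ξ K μ) {s : Finset ι} {i : ι} (hi : i ∉ s)
    (a : ι → ι → ℝ) (b c : ι → ℝ) {g : ℝ × ℝ × ℝ → ℝ} (hg : Measurable g) {f : ℝ → ℝ}
    (hf : Measurable f) :
    IndepFun (fun ω => g (quadForm ξ a s ω, linForm ξ b s ω, linForm ξ c s ω))
      (fun ω => f (ξ i ω)) μ ∧
    ∫ ω, g (quadForm ξ a s ω, linForm ξ b s ω, linForm ξ c s ω) * f (ξ i ω) ∂μ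
      = (∫ ω, g (quadForm ξ a s ω, linForm ξ b s ω, linForm ξ c s ω) ∂μ) * ∫ ω, f (ξ i ω) ∂μ := by
  have h1 := h.indep.indepFun_finset s {i} (by simpa using hi) h.meas
  let G : (s → ℝ) → ℝ := fun x => g (∑ i : s, ∑ j : s, a i j * (x i * x j) - ∑ i : s, a i i,
    ∑ i : s, b i * x i, ∑ i : s, c i * x i)
  have hG : Measurable G := by
    refine hg.comp ?_
    fun_prop
  have eG : (fun ω => g (quadForm ξ a s ω, linForm ξ b s ω, linForm ξ c s ω))
      = fun ω => G fun j => ξ j ω := by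
    funext ω
    simp only [G, quadForm, linForm]
    congr 2
    · rw [← Finset.sum_coe_sort s, ← Finset.sum_coe_sort s]
      congr 1
      refine Finset.sum_congr rfl fun i _ => ?_
      rw [← Finset.sum_coe_sort s]
    · rw [← Finset.sum_coe_sort s, ← Finset.sum_coe_sort s]
  have hF : Measurable fun x : (({i} : Finset ι) → ℝ) => f (x ⟨i, by simp⟩) :=
    hf.comp (measurable_pi_apply _)
  have h2 : IndepFun (fun ω => G (fun j => ξ j ω)) (fun ω => f (ξ i ω)) μ := h1.comp hG hF
  have hs : Measurable fun ω => fun j : s => ξ j ω := measurable_pi_lambda _ fun j => h.meas j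
  have e2 := congrFun eG
  simp only [e2]
  exact ⟨h2, h2.integral_mul_eq_mul_integral (hG.comp hs).aestronglyMeasurable
    (hf.comp (h.meas i)).aestronglyMeasurable⟩

theorem StdIndep.integral_sq_sub_one (h : StdIndep ξ K μ) (i : ι) :
    ∫ ω, (ξ i ω ^ 2 - 1) ∂μ = 0 := by
  rw [integral_sub _ (integrable_const _), h.var]
  · simp
  · exact (by norm_num : (2 : ENNReal) ≤ 8) |> (h.memLp i).mono_exponent |>.integrable_sq

/-- Induction with `sqrt_fourth_add_le`: the new term has mean zero and is independent of the
earlier ones, and it contributes 4·√3·b_i² ≤ 8 b_i². -/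
theorem StdIndep.sqrt_fourth_linForm_le (h : StdIndep ξ K μ) (b : ι → ℝ) (s : Finset ι) :
    √(∫ ω, linForm ξ b s ω ^ 4 ∂μ) ≤ 8 * ∑ i ∈ s, b i ^ 2 := by
  induction s using Finset.induction with
  | empty => simp [linForm]
  | insert i s hi ih =>
    have hm := (h.memLp_linForm b s).mono_exponent (p := 4) (by norm_num)
    have hm' := (h.memLp_four i).const_mul (b i)
    have h0 : ∫ ω, linForm ξ b s ω ^ 3 * (b i * ξ i ω) ∂μ = 0 := by
      have := (h.integral_mul_of_notMem hi (fun _ _ => 0) b b (g := fun x => x.2.1 ^ 3)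
        (by fun_prop) (f := fun x => b i * x) (by fun_prop)).2
      rw [this, integral_const_mul, h.mean]; simp
    have := sqrt_fourth_add_le hm hm' h0
    simp only [linForm_insert b hi]
    refine this.trans ?_
    have e : ∫ ω, (b i * ξ i ω) ^ 4 ∂μ = (b i ^ 2) ^ 2 * 3 := by
      simp only [mul_pow]
      rw [integral_const_mul, h.fourth]; ring
    rw [e, Finset.sum_insert hi, Real.sqrt_mul (by positivity), Real.sqrt_sq (by positivity)]
    have h3 : √3 ≤ 2 := Real.sqrt_le_iff.2 (by norm_num)
    nlinarith [mul_le_mul_of_nonneg_left h3 (sq_nonneg (b i))]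

/-- The two parts of the increment are separated by (x + y)⁴ ≤ 8x⁴ + 8y⁴. The product part factors
by independence; the part with ξ_i² - 1 costs an eighth moment, which is how K enters. -/
theorem StdIndep.fourth_quadInc_le (h : StdIndep ξ K μ) (b : ι → ι → ℝ) {s : Finset ι} {i : ι}
    (hi : i ∉ s) : √(∫ ω, quadInc ξ b s i ω ^ 4 ∂μ) ≤
      40 * (K + 2) * (∑ j ∈ s, (b i j + b j i) ^ 2 + b i i ^ 2) := by
  set β : ι → ℝ := fun j => b i j + b j i
  have hK : 0 ≤ K := (integral_nonneg fun ω => by positivity).trans (h.eighth i)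
  obtain ⟨hind, h1⟩ := h.integral_mul_of_notMem hi (fun _ _ => 0) β β (g := fun x => x.2.1 ^ 4)
    (by fun_prop) (f := fun x => x ^ 4) (by fun_prop)
  have il := MemLp.integrable_pow_four ((h.memLp_linForm β s).mono_exponent (p := 4) (by norm_num))
  have iξ := MemLp.integrable_pow_four (h.memLp_four i)
  have ilξ : Integrable (fun ω => linForm ξ β s ω ^ 4 * ξ i ω ^ 4) μ := hind.integrable_mul il iξ
  have is := MemLp.integrable_pow_four (h.memLp_sq_sub_one i)
  have i8 : Integrable (fun ω => ξ i ω ^ 8) μ := by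
    have := MemLp.integrable_pow_four (h.memLp_mul i i)
    refine this.congr (ae_of_all _ fun ω => ?_)
    simp only; ring
  have hs : ∫ ω, (ξ i ω ^ 2 - 1) ^ 4 ∂μ ≤ 8 * (K + 1) := by
    calc _ ≤ ∫ ω, 8 * (ξ i ω ^ 8 + 1) ∂μ := by
          refine integral_mono is ((i8.add (integrable_const 1)).const_mul 8) fun ω => ?_
          simp only
          have : ∀ x : ℝ, (x - 1) ^ 4 ≤ 8 * (x ^ 4 + 1) := fun x => by
            nlinarith [sq_nonneg (x ^ 2 - 1), sq_nonneg (x + 1), sq_nonneg (x ^ 2 + x),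
              sq_nonneg ((x + 1) ^ 2)]
          have := this (ξ i ω ^ 2)
          rw [← pow_mul] at this
          exact this
      _ ≤ _ := by
          rw [integral_const_mul, integral_add i8 (integrable_const 1)]
          have := h.eighth i
          simp
          linarith
  have hle : ∫ ω, quadInc ξ b s i ω ^ 4 ∂μ ≤
      ∫ ω, (8 * (linForm ξ β s ω ^ 4 * ξ i ω ^ 4) + 8 * b i i ^ 4 * (ξ i ω ^ 2 - 1) ^ 4) ∂μ := by
    refine integral_mono (MemLp.integrable_pow_four (h.memLp_quadInc b s i))
      ((ilξ.const_mul 8).add (is.const_mul _)) fun ω => ?_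
    simp only [quadInc]
    have : ∀ x y : ℝ, (x + y) ^ 4 ≤ 8 * x ^ 4 + 8 * y ^ 4 := fun x y => by
      nlinarith [sq_nonneg (x - y), sq_nonneg (x + y), sq_nonneg (x ^ 2 - y ^ 2),
        sq_nonneg ((x - y) ^ 2), mul_nonneg (sq_nonneg (x - y)) (sq_nonneg (x + y))]
    refine (this _ _).trans (le_of_eq ?_)
    ring
  rw [integral_add (ilξ.const_mul 8) (is.const_mul _), integral_const_mul, integral_const_mul,
    h1, h.fourth] at hle
  have hl := h.sqrt_fourth_linForm_le β s
  set w := ∑ j ∈ s, β j ^ 2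
  have hw : 0 ≤ w := Finset.sum_nonneg fun j _ => sq_nonneg _
  have hl2 : ∫ ω, linForm ξ β s ω ^ 4 ∂μ ≤ 64 * w ^ 2 := by
    have := (Real.sqrt_le_left (by positivity)).1 hl
    nlinarith
  refine Real.sqrt_le_iff.2 ⟨by positivity, hle.trans ?_⟩
  have hb : 0 ≤ b i i ^ 2 := sq_nonneg _
  have hb4 : b i i ^ 4 = (b i i ^ 2) ^ 2 := by ring
  rw [hb4]
  set c := b i i ^ 2
  have e1 : 8 * c ^ 2 * ∫ ω, (ξ i ω ^ 2 - 1) ^ 4 ∂μ ≤ 8 * c ^ 2 * (8 * (K + 1)) := by gcongr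
  have e2 : w ^ 2 + c ^ 2 ≤ (w + c) ^ 2 := by nlinarith [mul_nonneg hw hb]
  -- The product part has the constant 8·64·3 = 1536, from the splitting, the fourth moment of the
  -- linear form and that of ξ_i. The diagonal part has 8·8(K + 1).
  have e3 : (1536 + 64 * (K + 1)) ≤ (40 * (K + 2)) ^ 2 := by nlinarith
  calc _ ≤ 1536 * w ^ 2 + 64 * (K + 1) * c ^ 2 := by linarith
    _ ≤ (1536 + 64 * (K + 1)) * (w ^ 2 + c ^ 2) := by
        nlinarith [mul_nonneg hK (sq_nonneg w), mul_nonneg hK (sq_nonneg c), sq_nonneg w,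
          sq_nonneg c]
    _ ≤ (40 * (K + 2)) ^ 2 * (w + c) ^ 2 := by gcongr
    _ = _ := by ring

/-- Orthogonality of the increments of a quadratic form to functions of the past. -/
theorem StdIndep.integral_mul_quadInc (h : StdIndep ξ K μ) (a b : ι → ι → ℝ) {s : Finset ι} {i : ι}
    (hi : i ∉ s) {r : ℕ}
    (i1 : Integrable (fun ω => quadForm ξ a s ω ^ r * (linForm ξ (fun j => b i j + b j i) s ω
      * ξ i ω)) μ)
    (i2 : Integrable (fun ω => quadForm ξ a s ω ^ r * (ξ i ω ^ 2 - 1)) μ) :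
    ∫ ω, quadForm ξ a s ω ^ r * quadInc ξ b s i ω ∂μ = 0 := by
  set β : ι → ℝ := fun j => b i j + b j i
  have h1 := (h.integral_mul_of_notMem hi a β β (g := fun x => x.1 ^ r * x.2.1)
    (by fun_prop) (f := fun x => x) (by fun_prop)).2
  have h2 := (h.integral_mul_of_notMem hi a β β (g := fun x => x.1 ^ r)
    (by fun_prop) (f := fun x => x ^ 2 - 1) (by fun_prop)).2
  rw [h.mean, mul_zero] at h1
  rw [h.integral_sq_sub_one, mul_zero] at h2
  have e : ∀ ω, quadForm ξ a s ω ^ r * quadInc ξ b s i ω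
      = quadForm ξ a s ω ^ r * linForm ξ β s ω * ξ i ω
        + b i i * (quadForm ξ a s ω ^ r * (ξ i ω ^ 2 - 1)) := fun ω => by
    simp only [quadInc, β]; ring
  simp only [e]
  rw [integral_add _ (i2.const_mul _), integral_const_mul, h2, h1]
  · simp
  · simpa only [mul_assoc] using i1

/-- The fourth moment inequality of Whittle for quadratic forms. -/
theorem StdIndep.sqrt_fourth_quadForm_le (h : StdIndep ξ K μ) (b : ι → ι → ℝ) (s : Finset ι) :
    √(∫ ω, quadForm ξ b s ω ^ 4 ∂μ) ≤ 320 * (K + 2) * ∑ i ∈ s, ∑ j ∈ s, b i j ^ 2 := by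
  induction s using Finset.induction with
  | empty => simp [quadForm]
  | insert i s hi ih =>
    have hK : 0 ≤ K := (integral_nonneg fun ω => by positivity).trans (h.eighth i)
    have hX := h.memLp_quadForm b s
    have hl : MemLp (fun ω => linForm ξ (fun j => b i j + b j i) s ω * ξ i ω) 4 μ :=
      (h.memLp i).mul (r := 4) (h.memLp_linForm _ s)
    have h0 := h.integral_mul_quadInc b b hi (r := 3)
      (MemLp.integrable_of_le_four hX hl ((hX.1.pow 3).mul hl.1) fun ω => abs_cube_mul_le _ _)
      (MemLp.integrable_of_le_four hX (h.memLp_sq_sub_one i)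
        ((hX.1.pow 3).mul (h.memLp_sq_sub_one i).1) fun ω => abs_cube_mul_le _ _)
    simp only [quadForm_insert b hi]
    refine (sqrt_fourth_add_le hX (h.memLp_quadInc b s i) h0).trans ?_
    have h1 := h.fourth_quadInc_le b hi
    -- The constant 320 is 4·40·2: 4 from `sqrt_fourth_add_le`, 40(K + 2) from the increment, and 2
    -- from (x + y)² ≤ 2(x² + y²).
    have h2 : ∑ j ∈ s, (b i j + b j i) ^ 2 ≤ 2 * (∑ j ∈ s, b i j ^ 2 + ∑ j ∈ s, b j i ^ 2) := by
      rw [← Finset.sum_add_distrib, Finset.mul_sum]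
      exact Finset.sum_le_sum fun j _ => by nlinarith [sq_nonneg (b i j - b j i)]
    have h3 : ∑ j ∈ s, (b i j + b j i) ^ 2 + b i i ^ 2 ≤
        2 * (∑ j ∈ s, b i j ^ 2 + ∑ j ∈ s, b j i ^ 2 + b i i ^ 2) := by
      nlinarith [sq_nonneg (b i i)]
    simp only [Finset.sum_insert hi, Finset.sum_add_distrib]
    have h4 : 40 * (K + 2) * (∑ j ∈ s, (b i j + b j i) ^ 2 + b i i ^ 2) ≤ 40 * (K + 2) *
        (2 * (∑ j ∈ s, b i j ^ 2 + ∑ j ∈ s, b j i ^ 2 + b i i ^ 2)) := by gcongr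
    linarith

theorem StdIndep.integrable_sq_quadForm (h : StdIndep ξ K μ) (b : ι → ι → ℝ) (s : Finset ι) :
    Integrable (fun ω => quadForm ξ b s ω ^ 2) μ :=
  ((h.memLp_quadForm b s).mono_exponent (p := 2) (by norm_num)).integrable_sq

theorem StdIndep.integrable (h : StdIndep ξ K μ) (i : ι) : Integrable (ξ i) μ :=
  (h.memLp i).integrable (by norm_num)

theorem StdIndep.integral_linForm (h : StdIndep ξ K μ) (b : ι → ℝ) (s : Finset ι) :
    ∫ ω, linForm ξ b s ω ∂μ = 0 := by
  simp only [linForm]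
  rw [integral_finsetSum _ fun i _ => (h.integrable i).const_mul _]
  simp [integral_const_mul, h.mean]

theorem StdIndep.integral_sq_linForm (h : StdIndep ξ K μ) (b : ι → ℝ) (s : Finset ι) :
    ∫ ω, linForm ξ b s ω ^ 2 ∂μ = ∑ i ∈ s, b i ^ 2 := by
  induction s using Finset.induction with
  | empty => simp [linForm]
  | insert i s hi ih =>
    have hl := h.memLp_linForm b s
    have i1 : Integrable (fun ω => linForm ξ b s ω ^ 2) μ :=
      (hl.mono_exponent (p := 2) (by norm_num)).integrable_sq
    have i2 : Integrable (fun ω => ξ i ω ^ 2) μ :=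
      ((h.memLp i).mono_exponent (p := 2) (by norm_num)).integrable_sq
    have i3 : Integrable (fun ω => linForm ξ b s ω * ξ i ω) μ :=
      MemLp.integrable (q := 4) (by norm_num) ((h.memLp i).mul (r := 4) hl)
    have h3 := (h.integral_mul_of_notMem hi (fun _ _ => 0) b b (g := fun x => x.2.1)
      (by fun_prop) (f := fun x => x) (by fun_prop)).2
    rw [h.mean, mul_zero] at h3
    have e : ∀ ω, linForm ξ b (insert i s) ω ^ 2
        = linForm ξ b s ω ^ 2 + 2 * b i * (linForm ξ b s ω * ξ i ω) + b i ^ 2 * ξ i ω ^ 2 :=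
      fun ω => by rw [linForm_insert b hi]; ring
    simp only [e]
    rw [integral_add_add i1 (i3.const_mul _) (i2.const_mul _),
      integral_const_mul, integral_const_mul, h3, h.var, ih, Finset.sum_insert hi]
    ring

/-- The cross term contains the mean of a linear form and vanishes, so third moments play no role.
The factor 2 is E(ξ_i² - 1)² = 3 - 2 + 1; here the vanishing excess kurtosis is essential, since
otherwise the diagonal of b would enter the variance separately. -/
theorem StdIndep.integral_sq_quadInc (h : StdIndep ξ K μ) (b : ι → ι → ℝ) {s : Finset ι} {i : ι}
    (hi : i ∉ s) : ∫ ω, quadInc ξ b s i ω ^ 2 ∂μ = ∑ j ∈ s, (b i j + b j i) ^ 2 + 2 * b i i ^ 2 := by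
  set β : ι → ℝ := fun j => b i j + b j i
  have hs := h.memLp_sq_sub_one i
  have hlξ : MemLp (fun ω => linForm ξ β s ω * ξ i ω) 4 μ :=
    (h.memLp i).mul (r := 4) (h.memLp_linForm _ s)
  obtain ⟨hi1, h1⟩ := h.integral_mul_of_notMem hi (fun _ _ => 0) β β (g := fun x => x.2.1 ^ 2)
    (by fun_prop) (f := fun x => x ^ 2) (by fun_prop)
  have h2 := (h.integral_mul_of_notMem hi (fun _ _ => 0) β β (g := fun x => x.2.1)
    (by fun_prop) (f := fun x => x * (x ^ 2 - 1)) (by fun_prop)).2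
  rw [h.integral_linForm, zero_mul] at h2
  rw [h.integral_sq_linForm, h.var, mul_one] at h1
  have j1 : Integrable (fun ω => linForm ξ β s ω ^ 2 * ξ i ω ^ 2) μ := by
    refine (hlξ.mono_exponent (p := 2) (by norm_num)).integrable_sq.congr (ae_of_all _ fun ω => ?_)
    simp only; ring
  have j2 : Integrable (fun ω => linForm ξ β s ω * (ξ i ω * (ξ i ω ^ 2 - 1))) μ := by
    have : Integrable (fun ω => (linForm ξ β s ω * ξ i ω) * (ξ i ω ^ 2 - 1)) μ :=
      (hlξ.mono_exponent (p := 2) (by norm_num)).integrable_mul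
        (hs.mono_exponent (p := 2) (by norm_num))
    simpa only [mul_assoc] using this
  have j3 : Integrable (fun ω => (ξ i ω ^ 2 - 1) ^ 2) μ :=
    (hs.mono_exponent (p := 2) (by norm_num)).integrable_sq
  have i2 : Integrable (fun ω => ξ i ω ^ 2) μ :=
    ((h.memLp i).mono_exponent (p := 2) (by norm_num)).integrable_sq
  have h3 : ∫ ω, (ξ i ω ^ 2 - 1) ^ 2 ∂μ = 2 := by
    have e : ∀ ω, (ξ i ω ^ 2 - 1) ^ 2 = ξ i ω ^ 4 - 2 * ξ i ω ^ 2 + 1 := fun ω => by ring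
    simp only [e]
    rw [integral_add _ (integrable_const _), integral_sub _ (i2.const_mul _), integral_const_mul,
      h.var, h.fourth]
    · simp; norm_num
    · exact MemLp.integrable_pow_four (h.memLp_four i)
    · exact (MemLp.integrable_pow_four (h.memLp_four i)).sub (i2.const_mul _)
  have e : ∀ ω, quadInc ξ b s i ω ^ 2 = linForm ξ β s ω ^ 2 * ξ i ω ^ 2
      + 2 * b i i * (linForm ξ β s ω * (ξ i ω * (ξ i ω ^ 2 - 1)))
      + b i i ^ 2 * (ξ i ω ^ 2 - 1) ^ 2 := fun ω => by simp only [quadInc, β]; ring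
  simp only [e]
  rw [integral_add_add j1 (j2.const_mul _) (j3.const_mul _),
    integral_const_mul, integral_const_mul, h1, h2, h3]
  ring

/-- The variance of a quadratic form in variables with vanishing excess kurtosis. -/
theorem StdIndep.integral_sq_quadForm (h : StdIndep ξ K μ) (b : ι → ι → ℝ) (s : Finset ι) :
    ∫ ω, quadForm ξ b s ω ^ 2 ∂μ = ∑ i ∈ s, ∑ j ∈ s, b i j * (b i j + b j i) := by
  induction s using Finset.induction with
  | empty => simp [quadForm]
  | insert i s hi ih =>
    have hX := (h.memLp_quadForm b s).mono_exponent (p := 2) (by norm_num)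
    have hl : MemLp (fun ω => linForm ξ (fun j => b i j + b j i) s ω * ξ i ω) 2 μ :=
      ((h.memLp i).mul (r := 4) (h.memLp_linForm _ s)).mono_exponent (p := 2) (by norm_num)
    have hs := (h.memLp_sq_sub_one i).mono_exponent (p := 2) (by norm_num)
    have hY := (h.memLp_quadInc b s i).mono_exponent (p := 2) (by norm_num)
    have i1 : Integrable (fun ω => quadForm ξ b s ω * quadInc ξ b s i ω) μ := hX.integrable_mul hY
    have h0 := h.integral_mul_quadInc b b hi (r := 1)
      (by simp only [pow_one]; exact hX.integrable_mul hl)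
      (by simp only [pow_one]; exact hX.integrable_mul hs)
    simp only [pow_one] at h0
    have e : ∀ ω, quadForm ξ b (insert i s) ω ^ 2 = quadForm ξ b s ω ^ 2
        + 2 * (quadForm ξ b s ω * quadInc ξ b s i ω) + quadInc ξ b s i ω ^ 2 := fun ω => by
      rw [quadForm_insert b hi]; ring
    simp only [e]
    rw [integral_add_add hX.integrable_sq (i1.const_mul 2) hY.integrable_sq, integral_const_mul, h0, ih,
      h.integral_sq_quadInc b hi]
    simp only [Finset.sum_insert hi, Finset.sum_add_distrib]
    have : ∑ j ∈ s, (b i j + b j i) ^ 2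
        = ∑ j ∈ s, b i j * (b i j + b j i) + ∑ j ∈ s, b j i * (b j i + b i j) := by
      rw [← Finset.sum_add_distrib]
      exact Finset.sum_congr rfl fun j _ => by ring
    rw [this]
    ring

/-- The covariance of two quadratic forms in variables with vanishing excess kurtosis. -/
theorem StdIndep.integral_quadForm_mul (h : StdIndep ξ K μ) (a b : ι → ι → ℝ) (s : Finset ι) :
    ∫ ω, quadForm ξ a s ω * quadForm ξ b s ω ∂μ = ∑ i ∈ s, ∑ j ∈ s, a i j * (b i j + b j i) := by
  have e : ∀ ω, quadForm ξ a s ω * quadForm ξ b s ω = (quadForm ξ (fun i j => a i j + b i j) s ω ^ 2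
      - quadForm ξ a s ω ^ 2 - quadForm ξ b s ω ^ 2) / 2 := fun ω => by
    simp only [quadForm, add_mul, Finset.sum_add_distrib]; ring
  simp only [e]
  rw [integral_div, integral_sub, integral_sub, h.integral_sq_quadForm, h.integral_sq_quadForm,
    h.integral_sq_quadForm]
  · simp only [mul_add, add_mul, Finset.sum_add_distrib]
    have c1 : ∑ i ∈ s, ∑ j ∈ s, b i j * a j i = ∑ i ∈ s, ∑ j ∈ s, a i j * b j i := by
      rw [Finset.sum_comm]
      exact Finset.sum_congr rfl fun i _ => Finset.sum_congr rfl fun j _ => mul_comm _ _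
    have c2 : ∑ i ∈ s, ∑ j ∈ s, b i j * a i j = ∑ i ∈ s, ∑ j ∈ s, a i j * b i j :=
      Finset.sum_congr rfl fun i _ => Finset.sum_congr rfl fun j _ => mul_comm _ _
    rw [c1, c2]
    ring
  · exact h.integrable_sq_quadForm _ s
  · exact h.integrable_sq_quadForm _ s
  · exact (h.integrable_sq_quadForm _ s).sub (h.integrable_sq_quadForm _ s)
  · exact h.integrable_sq_quadForm _ s

theorem StdIndep.integral_quadForm (h : StdIndep ξ K μ) (b : ι → ι → ℝ) (s : Finset ι) :
    ∫ ω, quadForm ξ b s ω ∂μ = 0 := by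
  induction s using Finset.induction with
  | empty => simp [quadForm]
  | insert i s hi ih =>
    have hl : MemLp (fun ω => linForm ξ (fun j => b i j + b j i) s ω * ξ i ω) 4 μ :=
      (h.memLp i).mul (r := 4) (h.memLp_linForm _ s)
    have h0 := h.integral_mul_quadInc b b hi (r := 0)
      (by simpa only [pow_zero, one_mul] using hl.integrable (by norm_num))
      (by simpa only [pow_zero, one_mul] using (h.memLp_sq_sub_one i).integrable (by norm_num))
    simp only [pow_zero, one_mul] at h0
    simp only [quadForm_insert b hi]
    rw [integral_add ((h.memLp_quadForm b s).integrable (by norm_num))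
      ((h.memLp_quadInc b s i).integrable (by norm_num)), ih, h0, add_zero]

end Moments

/-! ### Second-order expansions with uniform constants -/

section Jets

variable {k : ℕ} {𝒜 : Type*} [NormedRing 𝒜] [NormedAlgebra ℝ 𝒜]

/-- The linear combination `∑_b v_b G_b`. -/
def dir {F : Type*} [AddCommGroup F] [Module ℝ F] (v : Fin k → ℝ) (G : Fin k → F) : F :=
  ∑ b, v b • G b

/-- The quadratic expression `∑_{b,c} v_b v_c G_{bc}`. -/
def dir₂ {F : Type*} [AddCommGroup F] [Module ℝ F] (v : Fin k → ℝ) (G : Fin k → Fin k → F) : F :=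
  ∑ b, ∑ c, (v b * v c) • G b c

theorem norm_dir_le {F : Type*} [NormedAddCommGroup F] [NormedSpace ℝ F] {v : Fin k → ℝ}
    {G : Fin k → F} {C : ℝ} (hG : ∀ b, ‖G b‖ ≤ C) : ‖dir v G‖ ≤ k * C * ‖v‖ := by
  refine (norm_sum_le _ _).trans ?_
  calc ∑ b, ‖v b • G b‖ ≤ ∑ _b : Fin k, ‖v‖ * C := by
        refine Finset.sum_le_sum fun b _ => ?_
        rw [norm_smul]
        exact mul_le_mul (norm_le_pi_norm v b) (hG b) (norm_nonneg _) (norm_nonneg _)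
    _ = _ := by simp; ring

theorem norm_dir₂_le {F : Type*} [NormedAddCommGroup F] [NormedSpace ℝ F] {v : Fin k → ℝ}
    {G : Fin k → Fin k → F} {C : ℝ} (hG : ∀ b c, ‖G b c‖ ≤ C) :
    ‖dir₂ v G‖ ≤ k ^ 2 * C * ‖v‖ ^ 2 := by
  refine (norm_sum_le _ _).trans ?_
  calc ∑ b, ‖∑ c, (v b * v c) • G b c‖ ≤ ∑ _b : Fin k, ∑ _c : Fin k, ‖v‖ * ‖v‖ * C := by
        refine Finset.sum_le_sum fun b _ => (norm_sum_le _ _).trans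
          (Finset.sum_le_sum fun c _ => ?_)
        rw [norm_smul, norm_mul]
        exact mul_le_mul (mul_le_mul (norm_le_pi_norm v b) (norm_le_pi_norm v c) (norm_nonneg _)
          (norm_nonneg _)) (hG b c) (norm_nonneg _) (by positivity)
    _ = _ := by simp; ring

/-- First and second order expansions at `ψ₀`, uniform on `Ψ`, of a function with values in a
normed space; `G1` are its partial derivatives at `ψ₀`. -/
structure Jet {F : Type*} [NormedAddCommGroup F] [NormedSpace ℝ F] (Ψ : Set (Fin k → ℝ))
    (ψ₀ : Fin k → ℝ) (C : ℝ) (G : (Fin k → ℝ) → F) (G1 : Fin k → F) : Prop where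
  bound : ∀ ψ ∈ Ψ, ‖G ψ‖ ≤ C
  lip : ∀ ψ ∈ Ψ, ∀ ψ' ∈ Ψ, ‖G ψ - G ψ'‖ ≤ C * ‖ψ - ψ'‖
  bound_one : ∀ b, ‖G1 b‖ ≤ C
  strict : ∀ ψ ∈ Ψ, ∀ ψ' ∈ Ψ,
    ‖G ψ - G ψ' - dir (ψ - ψ') G1‖ ≤ C * (‖ψ - ψ₀‖ + ‖ψ' - ψ₀‖) * ‖ψ - ψ'‖
  second : ∃ G2 : Fin k → Fin k → F, (∀ b c, ‖G2 b c‖ ≤ C) ∧ ∀ ψ ∈ Ψ,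
    ‖G ψ - G ψ₀ - dir (ψ - ψ₀) G1 - dir₂ (ψ - ψ₀) G2‖ ≤ C * ‖ψ - ψ₀‖ ^ 3

variable {Ψ : Set (Fin k → ℝ)} {ψ₀ : Fin k → ℝ}

section
variable {F : Type*} [NormedAddCommGroup F] [NormedSpace ℝ F] {G H : (Fin k → ℝ) → F}
  {G1 H1 : Fin k → F} {C C' : ℝ}

theorem Jet.mono (h : Jet Ψ ψ₀ C G G1) (hC : C ≤ C') : Jet Ψ ψ₀ C' G G1 where
  bound ψ hψ := (h.bound ψ hψ).trans hC
  lip ψ hψ ψ' hψ' := (h.lip ψ hψ ψ' hψ').trans (by gcongr)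
  bound_one b := (h.bound_one b).trans hC
  strict ψ hψ ψ' hψ' := (h.strict ψ hψ ψ' hψ').trans (by gcongr)
  second := by
    obtain ⟨G2, h1, h2⟩ := h.second
    exact ⟨G2, fun b c => (h1 b c).trans hC, fun ψ hψ => (h2 ψ hψ).trans (by gcongr)⟩

theorem dir_add (v : Fin k → ℝ) : dir v (fun b => G1 b + H1 b) = dir v G1 + dir v H1 := by
  simp [dir, Finset.sum_add_distrib]

theorem dir₂_add (v : Fin k → ℝ) (G2 H2 : Fin k → Fin k → F) :
    dir₂ v (fun b c => G2 b c + H2 b c) = dir₂ v G2 + dir₂ v H2 := by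
  simp [dir₂, Finset.sum_add_distrib]

theorem Jet.add (h : Jet Ψ ψ₀ C G G1) (h' : Jet Ψ ψ₀ C' H H1) :
    Jet Ψ ψ₀ (C + C') (fun ψ => G ψ + H ψ) (fun b => G1 b + H1 b) where
  bound ψ hψ := (norm_add_le _ _).trans (add_le_add (h.bound ψ hψ) (h'.bound ψ hψ))
  lip ψ hψ ψ' hψ' := by
    have := norm_add_le_of_le (h.lip ψ hψ ψ' hψ') (h'.lip ψ hψ ψ' hψ')
    rw [← add_mul] at this
    refine le_trans (le_of_eq ?_) this
    congr 1; abel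
  bound_one b := (norm_add_le _ _).trans (add_le_add (h.bound_one b) (h'.bound_one b))
  strict ψ hψ ψ' hψ' := by
    have := norm_add_le_of_le (h.strict ψ hψ ψ' hψ') (h'.strict ψ hψ ψ' hψ')
    rw [← add_mul, ← add_mul] at this
    refine le_trans (le_of_eq ?_) this
    rw [dir_add]
    congr 1; abel
  second := by
    obtain ⟨G2, h1, h2⟩ := h.second
    obtain ⟨H2, h1', h2'⟩ := h'.second
    refine ⟨fun b c => G2 b c + H2 b c,
      fun b c => (norm_add_le _ _).trans (add_le_add (h1 b c) (h1' b c)), fun ψ hψ => ?_⟩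
    have := norm_add_le_of_le (h2 ψ hψ) (h2' ψ hψ)
    rw [← add_mul] at this
    refine le_trans (le_of_eq ?_) this
    rw [dir_add, dir₂_add]
    congr 1; abel

theorem Jet.const (x : F) : Jet Ψ ψ₀ ‖x‖ (fun _ => x) (fun _ => 0) where
  bound _ _ := le_rfl
  lip _ _ _ _ := by simp; positivity
  bound_one _ := by simp
  strict _ _ _ _ := by simp [dir]; positivity
  second := ⟨fun _ _ => 0, by simp, fun _ _ => by simp [dir, dir₂]; positivity⟩

/-- The image of an expansion under a linear contraction. -/
theorem Jet.map {F' : Type*} [NormedAddCommGroup F'] [NormedSpace ℝ F'] (T : F →ₗ[ℝ] F') {c : ℝ}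
    (hc : 0 ≤ c) (hT : ∀ x, ‖T x‖ ≤ c * ‖x‖) (h : Jet Ψ ψ₀ C G G1) :
    Jet Ψ ψ₀ (c * C) (fun ψ => T (G ψ)) (fun b => T (G1 b)) := by
  have e1 : ∀ v, dir v (fun b => T (G1 b)) = T (dir v G1) := fun v => by simp [dir]
  have e2 : ∀ v (G2 : Fin k → Fin k → F), dir₂ v (fun b c => T (G2 b c)) = T (dir₂ v G2) :=
    fun v G2 => by simp [dir₂]
  refine ⟨fun ψ hψ => ?_, fun ψ hψ ψ' hψ' => ?_, fun b => ?_, fun ψ hψ ψ' hψ' => ?_, ?_⟩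
  · exact (hT _).trans (mul_le_mul_of_nonneg_left (h.bound ψ hψ) hc)
  · rw [← map_sub, mul_assoc]
    exact (hT _).trans (mul_le_mul_of_nonneg_left (h.lip ψ hψ ψ' hψ') hc)
  · exact (hT _).trans (mul_le_mul_of_nonneg_left (h.bound_one b) hc)
  · rw [e1, ← map_sub, ← map_sub, mul_assoc, mul_assoc, ← mul_assoc C]
    exact (hT _).trans (mul_le_mul_of_nonneg_left (h.strict ψ hψ ψ' hψ') hc)
  · obtain ⟨G2, h1, h2⟩ := h.second
    refine ⟨fun b c => T (G2 b c),
      fun b c => (hT _).trans (mul_le_mul_of_nonneg_left (h1 b c) hc), fun ψ hψ => ?_⟩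
    rw [e1, e2, ← map_sub, ← map_sub, ← map_sub, mul_assoc]
    exact (hT _).trans (mul_le_mul_of_nonneg_left (h2 ψ hψ) hc)

theorem Jet.first (h : Jet Ψ ψ₀ C G G1) (h0 : ψ₀ ∈ Ψ) {ψ : Fin k → ℝ} (hψ : ψ ∈ Ψ) :
    ‖G ψ - G ψ₀ - dir (ψ - ψ₀) G1‖ ≤ C * ‖ψ - ψ₀‖ ^ 2 := by
  have := h.strict ψ hψ ψ₀ h0
  simp only [sub_self, norm_zero, add_zero] at this
  rwa [mul_assoc, ← pow_two] at this

theorem Jet.nonneg (h : Jet Ψ ψ₀ C G G1) (h0 : ψ₀ ∈ Ψ) : 0 ≤ C :=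
  (norm_nonneg _).trans (h.bound ψ₀ h0)

end

section Mul

variable {G H : (Fin k → ℝ) → 𝒜} {G1 H1 : Fin k → 𝒜} {C C' : ℝ}

theorem norm_mul_le_of_le {x y : 𝒜} {a b : ℝ} (hx : ‖x‖ ≤ a) (hy : ‖y‖ ≤ b) :
    ‖x * y‖ ≤ a * b :=
  (norm_mul_le x y).trans
    (mul_le_mul hx hy (norm_nonneg _) ((norm_nonneg _).trans hx))

/-- The Leibniz rule in a noncommutative algebra, with each remainder split so that every summand
contains one remainder or one increment of a single factor. The second-order coefficient need not be
symmetric, because only its quadratic form matters. The factor (k + 2)² dominates the largest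
constant that occurs, k² + k + 2. -/
theorem Jet.mul (h : Jet Ψ ψ₀ C G G1) (h' : Jet Ψ ψ₀ C' H H1) (h0 : ψ₀ ∈ Ψ) :
    Jet Ψ ψ₀ ((k + 2) ^ 2 * (C * C')) (fun ψ => G ψ * H ψ)
      (fun b => G1 b * H ψ₀ + G ψ₀ * H1 b) := by
  have hC := h.nonneg h0
  have hC' := h'.nonneg h0
  have hk : (0 : ℝ) ≤ k := Nat.cast_nonneg k
  have hCC : 0 ≤ C * C' := mul_nonneg hC hC'
  have hd : ∀ v, dir v (fun b => G1 b * H ψ₀ + G ψ₀ * H1 b)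
      = dir v G1 * H ψ₀ + G ψ₀ * dir v H1 := fun v => by
    simp [dir, Finset.sum_add_distrib, Finset.sum_mul, Finset.mul_sum]
  refine ⟨fun ψ hψ => ?_, fun ψ hψ ψ' hψ' => ?_, fun b => ?_, fun ψ hψ ψ' hψ' => ?_, ?_⟩
  · refine (norm_mul_le_of_le (h.bound ψ hψ) (h'.bound ψ hψ)).trans ?_
    nlinarith [mul_nonneg hk hCC, mul_nonneg (mul_nonneg hk hk) hCC]
  · have e : G ψ * H ψ - G ψ' * H ψ' = (G ψ - G ψ') * H ψ + G ψ' * (H ψ - H ψ') := by noncomm_ring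
    rw [e]
    refine (norm_add_le_of_le (norm_mul_le_of_le (h.lip ψ hψ ψ' hψ') (h'.bound ψ hψ))
      (norm_mul_le_of_le (h.bound ψ' hψ') (h'.lip ψ hψ ψ' hψ'))).trans ?_
    have : C * ‖ψ - ψ'‖ * C' + C * (C' * ‖ψ - ψ'‖) = 2 * (C * C') * ‖ψ - ψ'‖ := by ring
    rw [this]
    gcongr
    nlinarith
  · refine (norm_add_le_of_le (norm_mul_le_of_le (h.bound_one b) (h'.bound ψ₀ h0))
      (norm_mul_le_of_le (h.bound ψ₀ h0) (h'.bound_one b))).trans ?_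
    nlinarith [mul_nonneg hk hCC, mul_nonneg (mul_nonneg hk hk) hCC]
  · have e : G ψ * H ψ - G ψ' * H ψ' - dir (ψ - ψ') (fun b => G1 b * H ψ₀ + G ψ₀ * H1 b)
        = (G ψ - G ψ' - dir (ψ - ψ') G1) * H ψ + dir (ψ - ψ') G1 * (H ψ - H ψ₀)
          + (G ψ' * (H ψ - H ψ' - dir (ψ - ψ') H1) + (G ψ' - G ψ₀) * dir (ψ - ψ') H1) := by
      rw [hd]; noncomm_ring
    rw [e]
    refine (norm_add_le_of_le
      (norm_add_le_of_le (norm_mul_le_of_le (h.strict ψ hψ ψ' hψ') (h'.bound ψ hψ))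
        (norm_mul_le_of_le (norm_dir_le h.bound_one) (h'.lip ψ hψ ψ₀ h0)))
      (norm_add_le_of_le (norm_mul_le_of_le (h.bound ψ' hψ') (h'.strict ψ hψ ψ' hψ'))
        (norm_mul_le_of_le (h.lip ψ' hψ' ψ₀ h0) (norm_dir_le h'.bound_one)))).trans ?_
    have e2 : C * (‖ψ - ψ₀‖ + ‖ψ' - ψ₀‖) * ‖ψ - ψ'‖ * C'
        + k * C * ‖ψ - ψ'‖ * (C' * ‖ψ - ψ₀‖)
        + (C * (C' * (‖ψ - ψ₀‖ + ‖ψ' - ψ₀‖) * ‖ψ - ψ'‖)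
        + C * ‖ψ' - ψ₀‖ * (k * C' * ‖ψ - ψ'‖))
        = (k + 2) * (C * C') * (‖ψ - ψ₀‖ + ‖ψ' - ψ₀‖) * ‖ψ - ψ'‖ := by ring
    rw [e2]
    gcongr
    nlinarith
  · obtain ⟨G2, g1, g2⟩ := h.second
    obtain ⟨H2, h1, h2⟩ := h'.second
    refine ⟨fun b c => G2 b c * H ψ₀ + G1 b * H1 c + G ψ₀ * H2 b c, fun b c => ?_,
      fun ψ hψ => ?_⟩
    · refine (norm_add_le_of_le (norm_add_le_of_le (norm_mul_le_of_le (g1 b c) (h'.bound ψ₀ h0))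
        (norm_mul_le_of_le (h.bound_one b) (h'.bound_one c)))
        (norm_mul_le_of_le (h.bound ψ₀ h0) (h1 b c))).trans ?_
      nlinarith [mul_nonneg hk hCC, mul_nonneg (mul_nonneg hk hk) hCC]
    · set v := ψ - ψ₀
      have hd2 : dir₂ v (fun b c => G2 b c * H ψ₀ + G1 b * H1 c + G ψ₀ * H2 b c)
          = dir₂ v G2 * H ψ₀ + dir v G1 * dir v H1 + G ψ₀ * dir₂ v H2 := by
        simp only [dir, dir₂, smul_add, Finset.sum_add_distrib, Finset.sum_mul, Finset.mul_sum,
          smul_mul_assoc, mul_smul_comm]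
        congr 2
        rw [Finset.sum_comm]
        simp only [Finset.smul_sum, smul_smul]
        exact Finset.sum_congr rfl fun y _ => Finset.sum_congr rfl fun x _ => by rw [mul_comm]
      have e : G ψ * H ψ - G ψ₀ * H ψ₀ - dir v (fun b => G1 b * H ψ₀ + G ψ₀ * H1 b)
          - dir₂ v (fun b c => G2 b c * H ψ₀ + G1 b * H1 c + G ψ₀ * H2 b c)
          = (G ψ - G ψ₀ - dir v G1 - dir₂ v G2) * H ψ + dir₂ v G2 * (H ψ - H ψ₀)
            + (dir v G1 * (H ψ - H ψ₀ - dir v H1)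
              + G ψ₀ * (H ψ - H ψ₀ - dir v H1 - dir₂ v H2)) := by
        rw [hd, hd2]; noncomm_ring
      rw [e]
      refine (norm_add_le_of_le
        (norm_add_le_of_le (norm_mul_le_of_le (g2 ψ hψ) (h'.bound ψ hψ))
          (norm_mul_le_of_le (norm_dir₂_le g1) (h'.lip ψ hψ ψ₀ h0)))
        (norm_add_le_of_le (norm_mul_le_of_le (norm_dir_le h.bound_one) (h'.first h0 hψ))
          (norm_mul_le_of_le (h.bound ψ₀ h0) (h2 ψ hψ)))).trans ?_
      have e2 : C * ‖v‖ ^ 3 * C' + k ^ 2 * C * ‖v‖ ^ 2 * (C' * ‖v‖)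
          + (k * C * ‖v‖ * (C' * ‖v‖ ^ 2) + C * (C' * ‖v‖ ^ 3))
          = (k ^ 2 + k + 2) * (C * C') * ‖v‖ ^ 3 := by ring
      rw [e2]
      gcongr
      nlinarith

/-- For affine T the resolvent identity S(ψ) - S(ψ') = -S(ψ)(T(ψ) - T(ψ'))S(ψ') is exact. Iterating
it three times gives the Neumann series to second order with an explicit cubic remainder. Every
bound has the form k^i C^j with i ≤ 3 and j ≤ 7, so one constant suffices. -/
theorem Jet.inverse {S T : (Fin k → ℝ) → 𝒜} {D : Fin k → 𝒜} (h0 : ψ₀ ∈ Ψ)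
    (hl : ∀ ψ ∈ Ψ, S ψ * T ψ = 1) (hr : ∀ ψ ∈ Ψ, T ψ * S ψ = 1)
    (hT : ∀ ψ ∈ Ψ, ∀ ψ' ∈ Ψ, T ψ - T ψ' = dir (ψ - ψ') D) (hS : ∀ ψ ∈ Ψ, ‖S ψ‖ ≤ C)
    (hD : ∀ b, ‖D b‖ ≤ C) :
    Jet Ψ ψ₀ ((k + 1) ^ 3 * (C + 1) ^ 7) S (fun b => -(S ψ₀ * D b * S ψ₀)) := by
  have hC : 0 ≤ C := (norm_nonneg _).trans (hS ψ₀ h0)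
  have hk : (0 : ℝ) ≤ k := Nat.cast_nonneg k
  have hd : ∀ v, dir v (fun b => -(S ψ₀ * D b * S ψ₀)) = -(S ψ₀ * dir v D * S ψ₀) := fun v => by
    simp [dir, Finset.sum_mul, Finset.mul_sum]
  have diff : ∀ ψ ∈ Ψ, ∀ ψ' ∈ Ψ, S ψ - S ψ' = -(S ψ * dir (ψ - ψ') D * S ψ') := by
    intro ψ hψ ψ' hψ'
    rw [← hT ψ hψ ψ' hψ', mul_sub, sub_mul, hl ψ hψ, mul_assoc, hr ψ' hψ']
    simp
  have pw : ∀ {i j : ℕ} (_ : i ≤ 3) (_ : j ≤ 7), (k : ℝ) ^ i * C ^ j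
      ≤ (k + 1) ^ 3 * (C + 1) ^ 7 := fun {i j} hi hj => by
    have h1 : (k : ℝ) ^ i ≤ (k + 1) ^ 3 :=
      (pow_le_pow_left₀ hk (by linarith) i).trans (pow_le_pow_right₀ (by linarith) hi)
    have h2 : C ^ j ≤ (C + 1) ^ 7 :=
      (pow_le_pow_left₀ hC (by linarith) j).trans (pow_le_pow_right₀ (by linarith) hj)
    exact mul_le_mul h1 h2 (by positivity) (by positivity)
  have lip : ∀ ψ ∈ Ψ, ∀ ψ' ∈ Ψ, ‖S ψ - S ψ'‖ ≤ k * C ^ 3 * ‖ψ - ψ'‖ := by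
    intro ψ hψ ψ' hψ'
    rw [diff ψ hψ ψ' hψ', norm_neg]
    refine (norm_mul_le_of_le (norm_mul_le_of_le (hS ψ hψ) (norm_dir_le hD)) (hS ψ' hψ')).trans
      (le_of_eq (by ring))
  refine ⟨fun ψ hψ => ?_, fun ψ hψ ψ' hψ' => ?_, fun b => ?_, fun ψ hψ ψ' hψ' => ?_, ?_⟩
  · have := pw (i := 0) (j := 1) (by norm_num) (by norm_num)
    exact (hS ψ hψ).trans (by simpa using this)
  · have := pw (i := 1) (j := 3) (by norm_num) (by norm_num)
    refine (lip ψ hψ ψ' hψ').trans ?_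
    refine mul_le_mul_of_nonneg_right ?_ (norm_nonneg _)
    simpa using this
  · have := pw (i := 0) (j := 3) (by norm_num) (by norm_num)
    rw [norm_neg]
    refine (norm_mul_le_of_le (norm_mul_le_of_le (hS ψ₀ h0) (hD b)) (hS ψ₀ h0)).trans
      (le_trans (le_of_eq ?_) this)
    ring
  · have e : S ψ - S ψ' - dir (ψ - ψ') (fun b => -(S ψ₀ * D b * S ψ₀))
        = -((S ψ - S ψ₀) * dir (ψ - ψ') D * S ψ' + S ψ₀ * dir (ψ - ψ') D * (S ψ' - S ψ₀)) := by
      rw [hd, diff ψ hψ ψ' hψ']; noncomm_ring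
    rw [e, norm_neg]
    refine (norm_add_le_of_le
      (norm_mul_le_of_le (norm_mul_le_of_le (lip ψ hψ ψ₀ h0) (norm_dir_le hD)) (hS ψ' hψ'))
      (norm_mul_le_of_le (norm_mul_le_of_le (hS ψ₀ h0) (norm_dir_le hD)) (lip ψ' hψ' ψ₀ h0))).trans ?_
    have := pw (i := 2) (j := 5) (by norm_num) (by norm_num)
    have e2 : k * C ^ 3 * ‖ψ - ψ₀‖ * (k * C * ‖ψ - ψ'‖) * C
        + C * (k * C * ‖ψ - ψ'‖) * (k * C ^ 3 * ‖ψ' - ψ₀‖)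
        = k ^ 2 * C ^ 5 * (‖ψ - ψ₀‖ + ‖ψ' - ψ₀‖) * ‖ψ - ψ'‖ := by ring
    rw [e2]
    gcongr
  · refine ⟨fun b c => S ψ₀ * D b * S ψ₀ * D c * S ψ₀, fun b c => ?_, fun ψ hψ => ?_⟩
    · have := pw (i := 0) (j := 5) (by norm_num) (by norm_num)
      refine (norm_mul_le_of_le (norm_mul_le_of_le (norm_mul_le_of_le (norm_mul_le_of_le
        (hS ψ₀ h0) (hD b)) (hS ψ₀ h0)) (hD c)) (hS ψ₀ h0)).trans (le_trans (le_of_eq ?_) this)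
      ring
    · set v := ψ - ψ₀
      have hd2 : dir₂ v (fun b c => S ψ₀ * D b * S ψ₀ * D c * S ψ₀)
          = S ψ₀ * dir v D * S ψ₀ * dir v D * S ψ₀ := by
        simp only [dir, dir₂, Finset.sum_mul, Finset.mul_sum, smul_mul_assoc, mul_smul_comm]
        rw [Finset.sum_comm]
        simp only [Finset.smul_sum, smul_smul]
        exact Finset.sum_congr rfl fun y _ => Finset.sum_congr rfl fun x _ => by rw [mul_comm]
      have d0 : S ψ = S ψ₀ - S ψ * dir v D * S ψ₀ := by
        rw [sub_eq_add_neg, ← diff ψ hψ ψ₀ h0]; abel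
      have e : S ψ - S ψ₀ - dir v (fun b => -(S ψ₀ * D b * S ψ₀))
          - dir₂ v (fun b c => S ψ₀ * D b * S ψ₀ * D c * S ψ₀)
          = -(S ψ * dir v D * S ψ₀ * dir v D * S ψ₀ * dir v D * S ψ₀) := by
        rw [hd, hd2]
        have e1 : S ψ - S ψ₀ = -(S ψ * dir v D * S ψ₀) := diff ψ hψ ψ₀ h0
        have e3 : S ψ - S ψ₀ - -(S ψ₀ * dir v D * S ψ₀)
            = -((S ψ - S ψ₀) * dir v D * S ψ₀) := by
          conv_lhs => rw [e1]
          noncomm_ring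
        rw [e3, e1]
        have e4 : -(-(S ψ * dir v D * S ψ₀) * dir v D * S ψ₀)
            - S ψ₀ * dir v D * S ψ₀ * dir v D * S ψ₀
            = (S ψ - S ψ₀) * dir v D * S ψ₀ * dir v D * S ψ₀ := by noncomm_ring
        rw [e4, e1]
        noncomm_ring
      rw [e, norm_neg]
      have hdv := norm_dir_le (v := v) hD
      refine (norm_mul_le_of_le (norm_mul_le_of_le (norm_mul_le_of_le (norm_mul_le_of_le
        (norm_mul_le_of_le (norm_mul_le_of_le (hS ψ hψ) hdv) (hS ψ₀ h0)) hdv) (hS ψ₀ h0)) hdv)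
        (hS ψ₀ h0)).trans ?_
      have := pw (i := 3) (j := 7) (by norm_num) (by norm_num)
      have e2 : C * (k * C * ‖v‖) * C * (k * C * ‖v‖) * C * (k * C * ‖v‖) * C
          = k ^ 3 * C ^ 7 * ‖v‖ ^ 3 := by ring
      rw [e2]
      gcongr

end Mul

section Smooth

variable {F : Type*} [NormedAddCommGroup F] [NormedSpace ℝ F]

/-- The mean value inequality for f minus its linearization at ψ₀, on the part of Ψ inside the ball
around ψ₀ whose radius is the sum of the two distances. This set is convex, contains both points,
and the derivative of the difference is at most C times the radius there. -/
theorem norm_sub_sub_fderiv_le {E : Type*} [NormedAddCommGroup E] [NormedSpace ℝ E] {Ψ : Set E}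
    {ψ₀ : E} {f : E → F} {C : ℝ} (hC : 0 ≤ C) (hΨ : Convex ℝ Ψ)
    (hf : ∀ x ∈ Ψ, DifferentiableAt ℝ f x)
    (hf' : ∀ x ∈ Ψ, ‖fderiv ℝ f x - fderiv ℝ f ψ₀‖ ≤ C * ‖x - ψ₀‖) {ψ ψ' : E} (hψ : ψ ∈ Ψ)
    (hψ' : ψ' ∈ Ψ) :
    ‖f ψ - f ψ' - fderiv ℝ f ψ₀ (ψ - ψ')‖ ≤ C * (‖ψ - ψ₀‖ + ‖ψ' - ψ₀‖) * ‖ψ - ψ'‖ := by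
  set r := ‖ψ - ψ₀‖ + ‖ψ' - ψ₀‖
  have hs : Convex ℝ (Ψ ∩ Metric.closedBall ψ₀ r) := hΨ.inter (convex_closedBall _ _)
  refine hs.norm_image_sub_le_of_norm_hasFDerivWithin_le' (f' := fun x => fderiv ℝ f x)
    (fun x hx => (hf x hx.1).hasFDerivAt.hasFDerivWithinAt) (fun x hx => ?_)
    ⟨hψ', ?_⟩ ⟨hψ, ?_⟩
  · refine (hf' x hx.1).trans (mul_le_mul_of_nonneg_left ?_ hC)
    simpa [dist_eq_norm] using hx.2
  · simp [dist_eq_norm, r]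
  · simp [dist_eq_norm, r]

theorem dir_fderiv (T : (Fin k → ℝ) →L[ℝ] F) (v : Fin k → ℝ) :
    dir v (fun b => T (Pi.single b 1)) = T v := by
  conv_rhs => rw [pi_eq_sum_univ' v]
  simp [dir, map_sum]

set_option maxSynthPendingDepth 5 in
set_option synthInstance.maxHeartbeats 200000 in
-- Taylor's formula. The derivative of the second-order remainder is the first-order remainder of
-- the derivative of f, which is quadratically small by `norm_sub_sub_fderiv_le`; the mean value
-- inequality on a ball around ψ₀ then gives the cubic bound.
theorem Jet.of_contDiffOn {f : (Fin k → ℝ) → ℝ} {C : ℝ} (hC : 0 ≤ C) (h0 : ψ₀ ∈ Ψ)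
    (ho : IsOpen Ψ) (hΨ : Convex ℝ Ψ) (hf : ContDiffOn ℝ 3 f Ψ)
    (hb : ∀ r ≤ 3, ∀ ψ ∈ Ψ, ‖iteratedFDeriv ℝ r f ψ‖ ≤ C) :
    Jet Ψ ψ₀ C f (fun b => fderiv ℝ f ψ₀ (Pi.single b 1)) := by
  have hf0 : ∀ x ∈ Ψ, ContDiffAt ℝ 3 f x := fun x hx => hf.contDiffAt (ho.mem_nhds hx)
  have hf1 : ∀ x ∈ Ψ, ContDiffAt ℝ 2 (fderiv ℝ f) x := fun x hx =>
    (hf0 x hx).fderiv_right (by norm_num)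
  have hf2 : ∀ x ∈ Ψ, ContDiffAt ℝ 1 (fderiv ℝ (fderiv ℝ f)) x := fun x hx =>
    (hf1 x hx).fderiv_right (by norm_num)
  have d0 : ∀ x ∈ Ψ, DifferentiableAt ℝ f x := fun x hx => (hf0 x hx).differentiableAt (by norm_num)
  have d1 : ∀ x ∈ Ψ, DifferentiableAt ℝ (fderiv ℝ f) x := fun x hx =>
    (hf1 x hx).differentiableAt (by norm_num)
  have d2 : ∀ x ∈ Ψ, DifferentiableAt ℝ (fderiv ℝ (fderiv ℝ f)) x := fun x hx =>
    (hf2 x hx).differentiableAt (by norm_num)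
  have b1 : ∀ x ∈ Ψ, ‖fderiv ℝ f x‖ ≤ C := fun x hx => by
    have := hb 1 (by norm_num) x hx
    rwa [norm_iteratedFDeriv_one] at this
  have b2 : ∀ x ∈ Ψ, ‖fderiv ℝ (fderiv ℝ f) x‖ ≤ C := fun x hx => by
    have := hb 2 (by norm_num) x hx
    rwa [← norm_iteratedFDeriv_fderiv, norm_iteratedFDeriv_one] at this
  have b3 : ∀ x ∈ Ψ, ‖fderiv ℝ (fderiv ℝ (fderiv ℝ f)) x‖ ≤ C := fun x hx => by
    have := hb 3 (by norm_num) x hx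
    rwa [← norm_iteratedFDeriv_fderiv, ← norm_iteratedFDeriv_fderiv,
      norm_iteratedFDeriv_one] at this
  have l1 : ∀ x ∈ Ψ, ‖fderiv ℝ f x - fderiv ℝ f ψ₀‖ ≤ C * ‖x - ψ₀‖ := fun x hx =>
    hΨ.norm_image_sub_le_of_norm_fderiv_le d1 b2 h0 hx
  have l2 : ∀ x ∈ Ψ, ‖fderiv ℝ (fderiv ℝ f) x - fderiv ℝ (fderiv ℝ f) ψ₀‖ ≤ C * ‖x - ψ₀‖ :=
    fun x hx => hΨ.norm_image_sub_le_of_norm_fderiv_le d2 b3 h0 hx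
  have single : ∀ b : Fin k, ‖(Pi.single b 1 : Fin k → ℝ)‖ ≤ 1 := fun b => by
    rw [Pi.norm_single]; simp
  refine ⟨fun ψ hψ => ?_, fun ψ hψ ψ' hψ' => ?_, fun b => ?_, fun ψ hψ ψ' hψ' => ?_, ?_⟩
  · simpa using hb 0 (by norm_num) ψ hψ
  · exact hΨ.norm_image_sub_le_of_norm_fderiv_le d0 b1 hψ' hψ
  · refine (ContinuousLinearMap.le_opNorm _ _).trans ?_
    exact (mul_le_mul (b1 ψ₀ h0) (single b) (norm_nonneg _) hC).trans (by simp)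
  · rw [dir_fderiv]
    exact norm_sub_sub_fderiv_le hC hΨ d0 l1 hψ hψ'
  · set B := fderiv ℝ (fderiv ℝ f) ψ₀
    -- By symmetry of the second derivative, x ↦ B(x, x)/2 has derivative B x.
    have hsymm : ∀ v w, B v w = B w v := fun v w =>
      ((hf0 ψ₀ h0).isSymmSndFDerivAt (by simp; norm_num)).eq v w
    refine ⟨fun b c => (1 / 2 : ℝ) • B (Pi.single b 1) (Pi.single c 1), fun b c => ?_,
      fun ψ hψ => ?_⟩
    · rw [norm_smul]
      have h1 : ‖B (Pi.single b 1) (Pi.single c 1)‖ ≤ C := by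
        refine (ContinuousLinearMap.le_opNorm₂ _ _ _).trans ?_
        calc _ ≤ C * 1 * 1 := by
              gcongr
              · exact b2 ψ₀ h0
              · exact single b
              · exact single c
          _ = C := by ring
      have : ‖(1 / 2 : ℝ)‖ = 1 / 2 := by norm_num
      rw [this]
      linarith
    · have e2 : ∀ v, dir₂ v (fun b c => (1 / 2 : ℝ) • B (Pi.single b 1) (Pi.single c 1))
          = (1 / 2 : ℝ) * B v v := fun v => by
        have h1 : ∀ w, B v w = ∑ b, v b * B (Pi.single b 1) w := fun w => by
          have := dir_fderiv (B.flip w) v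
          simp only [ContinuousLinearMap.flip_apply, dir, smul_eq_mul] at this
          exact this.symm
        have h2 : ∀ u, B u v = ∑ c, v c * B u (Pi.single c 1) := fun u => by
          have := dir_fderiv (B u) v
          simp only [dir, smul_eq_mul] at this
          exact this.symm
        rw [h1, Finset.mul_sum, dir₂]
        refine Finset.sum_congr rfl fun b _ => ?_
        rw [h2, Finset.mul_sum, Finset.mul_sum]
        refine Finset.sum_congr rfl fun c _ => ?_
        simp only [smul_eq_mul]; ring
      rw [dir_fderiv, e2]
      have hh : ∀ x ∈ Ψ, HasFDerivAt
          (fun x => f x - f ψ₀ - fderiv ℝ f ψ₀ (x - ψ₀) - (1 / 2 : ℝ) * B (x - ψ₀) (x - ψ₀))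
          (fderiv ℝ f x - fderiv ℝ f ψ₀ - B (x - ψ₀)) x := fun x hx => by
        have t : HasFDerivAt (fun y => y - ψ₀) (ContinuousLinearMap.id ℝ (Fin k → ℝ)) x :=
          (hasFDerivAt_id x).sub_const ψ₀
        have h1 := ((d0 x hx).hasFDerivAt.sub_const (f ψ₀)).sub
          ((fderiv ℝ f ψ₀).hasFDerivAt.comp x t)
        have h2 := (B.isBoundedBilinearMap.hasFDerivAt (x - ψ₀, x - ψ₀)).comp x (t.prodMk t)
        have h3 := h1.sub (h2.const_mul (1 / 2 : ℝ))
        refine h3.congr_fderiv ?_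
        ext v
        simp [hsymm v]
        ring
      set r := ‖ψ - ψ₀‖
      have hs : Convex ℝ (Ψ ∩ Metric.closedBall ψ₀ r) := hΨ.inter (convex_closedBall _ _)
      have key := hs.norm_image_sub_le_of_norm_hasFDerivWithin_le (x := ψ₀) (y := ψ)
        (C := C * r ^ 2) (fun x hx => (hh x hx.1).hasFDerivWithinAt) (fun x hx => ?_)
        ⟨h0, by simp [r]⟩ ⟨hψ, by simp [dist_eq_norm, r]⟩
      · simp only [sub_self, map_zero, mul_zero, sub_zero] at key
        refine key.trans (le_of_eq ?_)
        simp only [r]; ring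
      · have := norm_sub_sub_fderiv_le hC hΨ d1 l2 hx.1 h0
        simp only [sub_self, norm_zero, add_zero] at this
        refine this.trans ?_
        rw [mul_assoc, ← pow_two]
        have hx2 : ‖x - ψ₀‖ ≤ r := by simpa [dist_eq_norm] using hx.2
        gcongr

end Smooth

end Jets

/-! ### Existence, localization and expansion of roots -/

section Roots

variable {k : ℕ} {Ψ : Set (Fin k → ℝ)} {ψ₀ : Fin k → ℝ}

theorem abs_dir_le {v : Fin k → ℝ} {g : Fin k → ℝ} {C : ℝ} (hg : ∀ b, |g b| ≤ C) :
    |dir v g| ≤ k * C * ‖v‖ := by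
  have := norm_dir_le (F := ℝ) (v := v) (G := g) (C := C) hg
  rwa [Real.norm_eq_abs] at this

theorem dir_sub_left (v w : Fin k → ℝ) (g : Fin k → ℝ) : dir (v - w) g = dir v g - dir w g := by
  simp [dir, sub_mul, Finset.sum_sub_distrib]

theorem dir_sub_right (v : Fin k → ℝ) (g h : Fin k → ℝ) :
    dir v (fun b => g b - h b) = dir v g - dir v h := by
  simp [dir, mul_sub, Finset.sum_sub_distrib]

/-- Coercivity, uniformly on `Ψ`, of the matrices `α(ψ)`. -/
def Coercive (Ψ : Set (Fin k → ℝ)) (c : ℝ) (α : Fin k → Fin k → (Fin k → ℝ) → ℝ) : Prop :=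
  ∀ ψ ∈ Ψ, ∀ t : Fin k → ℝ, c * ‖t‖ ^ 2 ≤ ∑ a, t a * dir t (fun b => α a b ψ)

/-- In the sup norm, c‖t‖² ≤ ∑ t_a (At)_a ≤ k‖t‖F. Writing k + 1 instead of k keeps the constant
positive when k = 0. -/
theorem norm_le_of_coercive {c : ℝ} (hc : 0 < c) {A : Fin k → Fin k → ℝ} {t : Fin k → ℝ}
    (h : c * ‖t‖ ^ 2 ≤ ∑ a, t a * dir t (A a)) {F : ℝ} (hF : ∀ a, |dir t (A a)| ≤ F) (hF0 : 0 ≤ F) :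
    ‖t‖ ≤ (k + 1) / c * F := by
  have h1 : ∑ a, t a * dir t (A a) ≤ ∑ _a : Fin k, ‖t‖ * F := Finset.sum_le_sum fun a _ =>
    (le_abs_self _).trans (by
      rw [abs_mul]
      exact mul_le_mul (norm_le_pi_norm t a) (hF a) (abs_nonneg _) (norm_nonneg _))
  simp only [Finset.sum_const, Finset.card_univ, Fintype.card_fin, nsmul_eq_mul] at h1
  rcases (norm_nonneg t).eq_or_lt with h0 | h0
  · rw [← h0]; positivity
  · rw [div_mul_eq_mul_div, le_div_iff₀ hc]
    have : ‖t‖ * (‖t‖ * c) ≤ ‖t‖ * ((k + 1) * F) := by nlinarith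
    exact le_of_mul_le_mul_left this h0

theorem injective_of_coercive {c : ℝ} (hc : 0 < c) {A : Matrix (Fin k) (Fin k) ℝ}
    (h : ∀ t : Fin k → ℝ, c * ‖t‖ ^ 2 ≤ ∑ a, t a * dir t (A a)) :
    Function.Injective A.mulVec := by
  intro x y hxy
  have h1 := norm_le_of_coercive hc (h (x - y)) (F := 0) (fun a => by
    have := congrFun (Matrix.mulVec_sub A x y) a
    have h2 : dir (x - y) (A a) = (A *ᵥ (x - y)) a := by
      simp only [dir, Matrix.mulVec, dotProduct, smul_eq_mul, mul_comm]
    rw [h2, this, hxy]; simp) le_rfl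
  rw [mul_zero] at h1
  exact sub_eq_zero.1 (norm_le_zero_iff.1 h1)

theorem isUnit_det_of_coercive {c : ℝ} (hc : 0 < c) {A : Matrix (Fin k) (Fin k) ℝ}
    (h : ∀ t : Fin k → ℝ, c * ‖t‖ ^ 2 ≤ ∑ a, t a * dir t (A a)) : IsUnit A.det :=
  A.isUnit_iff_isUnit_det.1 (Matrix.mulVec_injective_iff_isUnit.1 (injective_of_coercive hc h))

theorem abs_inv_le_of_coercive {c : ℝ} (hc : 0 < c) {A : Matrix (Fin k) (Fin k) ℝ}
    (h : ∀ t : Fin k → ℝ, c * ‖t‖ ^ 2 ≤ ∑ a, t a * dir t (A a)) (i j : Fin k) :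
    |A⁻¹ i j| ≤ (k + 1) / c := by
  have hu := isUnit_det_of_coercive hc h
  have h1 := norm_le_of_coercive hc (h (A⁻¹ *ᵥ Pi.single j 1)) (F := 1) (fun a => by
    have h2 : dir (A⁻¹ *ᵥ Pi.single j 1) (A a) = (A *ᵥ (A⁻¹ *ᵥ Pi.single j 1)) a := by
      simp only [dir, Matrix.mulVec, dotProduct, smul_eq_mul, mul_comm]
    rw [h2, Matrix.mulVec_mulVec, Matrix.mul_nonsing_inv _ hu, Matrix.one_mulVec]
    by_cases haj : a = j
    · subst haj; simp
    · simp [haj]) zero_le_one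
  rw [mul_one] at h1
  refine le_trans ?_ ((norm_le_pi_norm _ i).trans h1)
  simp [Matrix.col_apply]

/-- The system `f(ψ) = α(ψ) (ψ - ψ₀)`. -/
def IsRoot (ψ₀ : Fin k → ℝ) (f : Fin k → (Fin k → ℝ) → ℝ) (α : Fin k → Fin k → (Fin k → ℝ) → ℝ)
    (ψ : Fin k → ℝ) : Prop :=
  ∀ a, f a ψ = dir (ψ - ψ₀) (fun b => α a b ψ)

/-- A bootstrap. Coercivity bounds ψ - ψ₀ by f(ψ), and a nearby net point shows that f(ψ) is small,
so every root lies near ψ₀. Near ψ₀ the difference f(ψ) - f(ψ₀) is at most a small multiple of ‖ψ -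
ψ₀‖, which is absorbed into the left-hand side and leaves f(ψ₀). -/
theorem norm_le_of_isRoot {f : Fin k → (Fin k → ℝ) → ℝ} {f1 : Fin k → Fin k → ℝ}
    {α : Fin k → Fin k → (Fin k → ℝ) → ℝ} {C c η ε : ℝ} (hc : 0 < c) (hη : 0 ≤ η) (hε : 0 ≤ ε)
    (h0 : ψ₀ ∈ Ψ)
    (hf : ∀ a, Jet Ψ ψ₀ C (f a) (f1 a)) (hα : Coercive Ψ c α) (hf1 : ∀ a b, |f1 a b| ≤ η)
    (hs : (k + 1) / c * (k * η + C * ((k + 1) / c * (η + C * ε))) ≤ 1 / 2)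
    {ψ : Fin k → ℝ} (hψ : ψ ∈ Ψ) (hr : IsRoot ψ₀ f α ψ)
    (hT : ∃ τ ∈ Ψ, ‖ψ - τ‖ ≤ ε ∧ ∀ a, |f a τ| ≤ η) :
    ‖ψ - ψ₀‖ ≤ 2 * ((k + 1) / c) * ‖fun a => f a ψ₀‖ := by
  -- The sign of C is read off from a jet, and for k = 0 there is none.
  rcases isEmpty_or_nonempty (Fin k) with hk | ⟨⟨i0⟩⟩
  · have : ψ - ψ₀ = 0 := Subsingleton.elim _ _
    rw [this]; simp; positivity
  have hC : 0 ≤ C := (hf i0).nonneg h0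
  obtain ⟨τ, hτ, h1, h2⟩ := hT
  have hb : ∀ F : ℝ, 0 ≤ F → (∀ a, |f a ψ| ≤ F) → ‖ψ - ψ₀‖ ≤ (k + 1) / c * F := fun F hF0 hF =>
    norm_le_of_coercive hc (hα ψ hψ (ψ - ψ₀)) (fun a => by rw [← hr a]; exact hF a) hF0
  have hd1 := hb (η + C * ε) (by positivity) fun a => by
    have := (hf a).lip ψ hψ τ hτ
    rw [Real.norm_eq_abs] at this
    have e : f a ψ = f a τ + (f a ψ - f a τ) := by ring
    rw [e]
    refine (abs_add_le _ _).trans (add_le_add (h2 a) (this.trans ?_))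
    gcongr
  have hd2 := hb (‖fun a => f a ψ₀‖ + (k * η + C * ((k + 1) / c * (η + C * ε))) * ‖ψ - ψ₀‖)
    (by positivity) fun a => by
      have h3 := (hf a).first h0 hψ
      rw [Real.norm_eq_abs] at h3
      have h4 := abs_dir_le (v := ψ - ψ₀) (hf1 a)
      have h5 : |f a ψ₀| ≤ ‖fun a => f a ψ₀‖ := norm_le_pi_norm (fun a => f a ψ₀) a
      have e : f a ψ = f a ψ₀ + dir (ψ - ψ₀) (f1 a) + (f a ψ - f a ψ₀ - dir (ψ - ψ₀) (f1 a)) := by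
        ring
      rw [e]
      refine (abs_add_le _ _).trans ((add_le_add ((abs_add_le _ _).trans (add_le_add h5 h4))
        h3).trans ?_)
      have : C * ‖ψ - ψ₀‖ ^ 2 ≤ C * ((k + 1) / c * (η + C * ε)) * ‖ψ - ψ₀‖ := by
        rw [pow_two, ← mul_assoc]
        gcongr
      linarith
  have : (k + 1) / c * ((k * η + C * ((k + 1) / c * (η + C * ε))) * ‖ψ - ψ₀‖)
      ≤ 1 / 2 * ‖ψ - ψ₀‖ := by
    rw [← mul_assoc]
    gcongr
  rw [mul_add] at hd2
  linarith

/-- On the closed δ-ball the map g(ψ) = f(ψ) - α(ψ)(ψ - ψ₀) differs from the linear map -α(ψ₀) by a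
Lipschitz error of at most half the reciprocal of the bound (k + 1)/c for the inverse. By the
quantitative inverse function theorem the image of the ball contains a ball around g(ψ₀) = f(ψ₀),
large enough to reach 0. -/
theorem exists_isRoot {f : Fin k → (Fin k → ℝ) → ℝ} {f1 : Fin k → Fin k → ℝ}
    {α : Fin k → Fin k → (Fin k → ℝ) → ℝ} {α1 : Fin k → Fin k → Fin k → ℝ} {C c η δ : ℝ} (hc : 0 < c) (hη : 0 ≤ η) (hδ : 0 ≤ δ)
    (hC : 0 ≤ C)
    (hball : Metric.closedBall ψ₀ δ ⊆ Ψ)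
    (hf : ∀ a, Jet Ψ ψ₀ C (f a) (f1 a)) (hα : Coercive Ψ c α)
    (hαj : ∀ a b, Jet Ψ ψ₀ C (α a b) (α1 a b)) (hf1 : ∀ a b, |f1 a b| ≤ η)
    (hs : k * η + (2 + 2 * k) * C * δ ≤ c / (k + 1) / 2)
    (hf0 : ‖fun a => f a ψ₀‖ ≤ c / (k + 1) / 2 * δ) :
    ∃ ψ ∈ Ψ, IsRoot ψ₀ f α ψ := by
  have h0 : ψ₀ ∈ Ψ := hball (Metric.mem_closedBall_self hδ)
  set A : Matrix (Fin k) (Fin k) ℝ := fun a b => α a b ψ₀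
  have hA : ∀ t : Fin k → ℝ, c * ‖t‖ ^ 2 ≤ ∑ a, t a * dir t (A a) := hα ψ₀ h0
  have hu := isUnit_det_of_coercive hc hA
  have hAv : ∀ (t : Fin k → ℝ) a, (A *ᵥ t) a = dir t (A a) := fun t a => by
    simp only [dir, Matrix.mulVec, dotProduct, smul_eq_mul, mul_comm]
  let f' : (Fin k → ℝ) →L[ℝ] (Fin k → ℝ) := -(LinearMap.toContinuousLinearMap A.mulVecLin)
  have hf' : ∀ t, f' t = -(A *ᵥ t) := fun t => rfl
  let inv : f'.NonlinearRightInverse :=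
    { toFun := fun y => -(A⁻¹ *ᵥ y)
      nnnorm := ⟨(k + 1) / c, by positivity⟩
      bound' := fun y => by
        rw [norm_neg]
        refine norm_le_of_coercive hc (hA _) (fun a => ?_) (norm_nonneg y)
        rw [← hAv, Matrix.mulVec_mulVec, Matrix.mul_nonsing_inv _ hu, Matrix.one_mulVec]
        exact norm_le_pi_norm y a
      right_inv' := fun y => by
        rw [hf', Matrix.mulVec_neg, Matrix.mulVec_mulVec, Matrix.mul_nonsing_inv _ hu,
          Matrix.one_mulVec, neg_neg] }
  let g : (Fin k → ℝ) → (Fin k → ℝ) := fun ψ a => f a ψ - dir (ψ - ψ₀) (fun b => α a b ψ)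
  -- The Lipschitz error: kη from the first derivatives of f, 2Cδ from its second-order part, and
  -- kCδ twice from the variation of α.
  let q : NNReal := ⟨k * η + (2 + 2 * k) * C * δ, by positivity⟩
  have happ : ApproximatesLinearOn g f' (Metric.closedBall ψ₀ δ) q := by
    intro ψ hψ ψ' hψ'
    refine (pi_norm_le_iff_of_nonneg (by positivity)).2 fun a => ?_
    have d1 : ‖ψ - ψ₀‖ ≤ δ := by simpa [dist_eq_norm] using hψ
    have d2 : ‖ψ' - ψ₀‖ ≤ δ := by simpa [dist_eq_norm] using hψ'
    have e : (g ψ - g ψ' - f' (ψ - ψ')) a = (f a ψ - f a ψ' - dir (ψ - ψ') (f1 a))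
        + dir (ψ - ψ') (f1 a) - dir (ψ - ψ') (fun b => α a b ψ - α a b ψ₀)
        - dir (ψ' - ψ₀) (fun b => α a b ψ - α a b ψ') := by
      have e1 : (f' (ψ - ψ')) a = -dir (ψ - ψ') (A a) := by rw [hf', Pi.neg_apply, hAv]
      have e2 : ψ - ψ₀ = (ψ - ψ') + (ψ' - ψ₀) := by abel
      simp only [Pi.sub_apply, e1, g]
      rw [dir_sub_right, dir_sub_right]
      have e3 : dir (ψ - ψ₀) (fun b => α a b ψ)
          = dir (ψ - ψ') (fun b => α a b ψ) + dir (ψ' - ψ₀) (fun b => α a b ψ) := by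
        rw [dir_sub_left, dir_sub_left, dir_sub_left]; ring
      rw [e3]
      simp only [A]
      ring
    rw [e, Real.norm_eq_abs]
    have t1 := (hf a).strict ψ (hball hψ) ψ' (hball hψ')
    have t2 := abs_dir_le (v := ψ - ψ') (hf1 a)
    have t3 := abs_dir_le (v := ψ - ψ') (g := fun b => α a b ψ - α a b ψ₀) (C := C * δ) fun b =>
      ((hαj a b).lip ψ (hball hψ) ψ₀ h0).trans (by gcongr)
    have t4 := abs_dir_le (v := ψ' - ψ₀) (g := fun b => α a b ψ - α a b ψ') (C := C * ‖ψ - ψ'‖)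
      fun b => (hαj a b).lip ψ (hball hψ) ψ' (hball hψ')
    rw [Real.norm_eq_abs] at t1
    have t1' : C * (‖ψ - ψ₀‖ + ‖ψ' - ψ₀‖) * ‖ψ - ψ'‖ ≤ C * (δ + δ) * ‖ψ - ψ'‖ := by gcongr
    have t4' : k * (C * ‖ψ - ψ'‖) * ‖ψ' - ψ₀‖ ≤ k * (C * ‖ψ - ψ'‖) * δ := by gcongr
    refine (abs_sub _ _).trans ((add_le_add ((abs_sub _ _).trans (add_le_add
      ((abs_add_le _ _).trans (add_le_add t1 t2)) t3)) t4).trans ?_)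
    have : (q : ℝ) = k * η + (2 + 2 * k) * C * δ := rfl
    rw [this]
    linarith
  have hsurj := happ.surjOn_closedBall_of_nonlinearRightInverse inv hδ subset_rfl
  have hg0 : ‖g ψ₀‖ = ‖fun a => f a ψ₀‖ := by
    congr 1; ext a; simp [g, dir]
  have hmem : (0 : Fin k → ℝ) ∈ Metric.closedBall (g ψ₀) (((inv.nnnorm : ℝ)⁻¹ - q) * δ) := by
    rw [mem_closedBall_iff_norm, zero_sub, norm_neg, hg0]
    refine hf0.trans ?_
    gcongr
    have h1 : (inv.nnnorm : ℝ) = (k + 1) / c := rfl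
    have h2 : (q : ℝ) = k * η + (2 + 2 * k) * C * δ := rfl
    rw [h1, h2, inv_div]
    linarith
  obtain ⟨ψ, hψ, hgψ⟩ := hsurj hmem
  exact ⟨ψ, hball hψ, fun a => sub_eq_zero.1 (congrFun hgψ a)⟩

/-- Existence and localization of roots: if the perturbation `f` and its derivatives are small at
`ψ₀` and `f` is small on a finite net, then there is a root, and all roots are close to `ψ₀`. -/
theorem exists_net_isRoot (hΨo : IsOpen Ψ) (hΨb : Bornology.IsBounded Ψ) (h0 : ψ₀ ∈ Ψ)
    {C c : ℝ} (hC : 0 ≤ C) (hc : 0 < c) :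
    ∃ η : ℝ, 0 < η ∧ ∃ T : Finset (Fin k → ℝ), (∀ τ ∈ T, τ ∈ Ψ) ∧
      ∀ (f : Fin k → (Fin k → ℝ) → ℝ) (f1 : Fin k → Fin k → ℝ)
        (α : Fin k → Fin k → (Fin k → ℝ) → ℝ) (α1 : Fin k → Fin k → Fin k → ℝ),
        (∀ a, Jet Ψ ψ₀ C (f a) (f1 a)) → Coercive Ψ c α → (∀ a b, Jet Ψ ψ₀ C (α a b) (α1 a b)) →
        (∀ a, |f a ψ₀| ≤ η) → (∀ a b, |f1 a b| ≤ η) → (∀ τ ∈ T, ∀ a, |f a τ| ≤ η) →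
        (∃ ψ ∈ Ψ, IsRoot ψ₀ f α ψ) ∧ ∀ ψ ∈ Ψ, IsRoot ψ₀ f α ψ →
          ‖ψ - ψ₀‖ ≤ 2 * ((k + 1) / c) * ‖fun a => f a ψ₀‖ := by
  obtain ⟨δ₁, hδ₁, hball₁⟩ := Metric.isOpen_iff.1 hΨo ψ₀ h0
  set L : ℝ := (k + 1) / c with hLdef
  have hL : 0 < L := by positivity
  have hk : (0 : ℝ) ≤ k := Nat.cast_nonneg k
  have hLi : c / (k + 1) = L⁻¹ := by rw [hLdef, inv_div]
  -- The ball of radius δ must lie in Ψ, and (2 + 2k)Cδ may use half of the error budget L⁻¹/2; the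
  -- other half is left for kη.
  set δ : ℝ := min (δ₁ / 2) (L⁻¹ / 4 / ((2 + 2 * k) * C + 1)) with hδdef
  have hδ : 0 < δ := by positivity
  have hball : Metric.closedBall ψ₀ δ ⊆ Ψ := fun x hx => hball₁ (by
    have h1 := Metric.mem_closedBall.1 hx
    have h2 : δ ≤ δ₁ / 2 := min_le_left _ _
    rw [Metric.mem_ball]; linarith)
  have hδ2 : (2 + 2 * k) * C * δ ≤ L⁻¹ / 4 := by
    have h2 : δ ≤ L⁻¹ / 4 / ((2 + 2 * k) * C + 1) := min_le_right _ _
    rw [le_div_iff₀ (by positivity)] at h2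
    nlinarith
  set ε : ℝ := 1 / (8 * L ^ 2 * (C + 1) ^ 2) with hεdef
  have hε : 0 < ε := by positivity
  -- Three requirements: kη within the remaining error budget, f(ψ₀) small enough for a root in the
  -- δ-ball, and, together with ε, the contraction factor 1/2 in the bootstrap of
  -- `norm_le_of_isRoot`.
  set η : ℝ := min (min (L⁻¹ / 4 / (k + 1)) (L⁻¹ / 2 * δ))
    (1 / (8 * (L * (k + 1) + L ^ 2 * (C + 1)))) with hηdef
  have hη : 0 < η := by positivity
  have hη1 : k * η ≤ L⁻¹ / 4 := by
    have h2 : η ≤ L⁻¹ / 4 / (k + 1) := (min_le_left _ _).trans (min_le_left _ _)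
    rw [le_div_iff₀ (by positivity)] at h2
    nlinarith
  have hη2 : η ≤ L⁻¹ / 2 * δ := (min_le_left _ _).trans (min_le_right _ _)
  have hη3 : L * (k * η + C * (L * (η + C * ε))) ≤ 1 / 2 := by
    have h2 : η ≤ 1 / (8 * (L * (k + 1) + L ^ 2 * (C + 1))) := min_le_right _ _
    rw [le_div_iff₀ (by positivity)] at h2
    have h3 : ε * (8 * L ^ 2 * (C + 1) ^ 2) = 1 := by rw [hεdef]; field_simp
    have h4 : L ^ 2 * C ^ 2 * ε ≤ L ^ 2 * (C + 1) ^ 2 * ε := by gcongr; linarith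
    have h5 : 0 ≤ L * η := by positivity
    have h6 : 0 ≤ L ^ 2 * η := by positivity
    nlinarith
  -- A bounded subset of a finite-dimensional space is totally bounded. The net depends only on Ψ, C
  -- and c, not on the equation, so the same finitely many points serve all ω and n.
  obtain ⟨T, hTΨ, hTf, hTc⟩ := 
    Metric.finite_approx_of_totallyBounded
    (hΨb.isCompact_closure.totallyBounded.subset subset_closure) ε hε
  refine ⟨η, hη, hTf.toFinset, fun τ hτ => hTΨ (hTf.mem_toFinset.1 hτ), ?_⟩
  intro f f1 α α1 hf hα hαj hf0 hf1 hfT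
  refine ⟨exists_isRoot (η := η) (δ := δ) hc hη.le hδ.le hC hball hf hα hαj hf1 ?_ ?_,
    fun ψ hψ hr => ?_⟩
  · rw [hLi]; linarith
  · rw [hLi]
    exact (pi_norm_le_iff_of_nonneg (by positivity)).2 fun a => (hf0 a).trans hη2
  · refine norm_le_of_isRoot hc hη.le hε.le h0 hf hα hf1 hη3 hψ hr ?_
    obtain ⟨τ, hτ, hd⟩ := Set.mem_iUnion₂.1 (hTc hψ)
    exact ⟨τ, hTΨ hτ, by rw [← dist_eq_norm]; exact (Metric.mem_ball.1 hd).le,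
      fun a => hfT τ (hTf.mem_toFinset.2 hτ) a⟩

theorem norm_mulVec_le {β : Matrix (Fin k) (Fin k) ℝ} {B X : ℝ} (hβ : ∀ a b, |β a b| ≤ B)
    {x : Fin k → ℝ} (hx : ∀ a, |x a| ≤ X) (hB : 0 ≤ B) (hX : 0 ≤ X) : ‖β *ᵥ x‖ ≤ k * B * X := by
  refine (pi_norm_le_iff_of_nonneg (by positivity)).2 fun a => ?_
  have h1 : (β *ᵥ x) a = dir x (β a) := by
    simp only [dir, Matrix.mulVec, dotProduct, smul_eq_mul, mul_comm]
  rw [h1, Real.norm_eq_abs]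
  refine (abs_dir_le (hβ a)).trans ?_
  have : ‖x‖ ≤ X := (pi_norm_le_iff_of_nonneg hX).2 hx
  gcongr

/-- The first two terms of the expansion of a root. -/
theorem root_expansion {C B : ℝ} (hC : 0 ≤ C) (hB : 0 ≤ B) : ∃ K : ℝ, 0 ≤ K ∧
    ∀ (Ψ : Set (Fin k → ℝ)) (ψ₀ : Fin k → ℝ) (f : Fin k → (Fin k → ℝ) → ℝ) (f1 : Fin k → Fin k → ℝ)
      (f2 : Fin k → Fin k → Fin k → ℝ) (α : Fin k → Fin k → (Fin k → ℝ) → ℝ)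
      (α1 : Fin k → Fin k → Fin k → ℝ) (β : Matrix (Fin k) (Fin k) ℝ) (z : ℝ) (ψ : Fin k → ℝ),
      ψ₀ ∈ Ψ → ψ ∈ Ψ →
      (∀ a, Jet Ψ ψ₀ C (f a) (f1 a)) → (∀ a b, Jet Ψ ψ₀ C (α a b) (α1 a b)) →
      (∀ a, |f a ψ - f a ψ₀ - dir (ψ - ψ₀) (f1 a) - dir₂ (ψ - ψ₀) (f2 a)| ≤ C * ‖ψ - ψ₀‖ ^ 3) →
      (β * Matrix.of fun a b => α a b ψ₀) = 1 → (∀ a b, |β a b| ≤ B) →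
      IsRoot ψ₀ f α ψ → ‖ψ - ψ₀‖ ≤ B * ‖fun a => f a ψ₀‖ →
      (∀ a, |f a ψ₀| ≤ z) → (∀ a b, |f1 a b| ≤ z) → (∀ a b c, |f2 a b c| ≤ z) → 0 ≤ z →
      ‖ψ - ψ₀‖ ≤ K * z ∧ ‖ψ - ψ₀ - β *ᵥ (fun a => f a ψ₀)‖ ≤ K * z ^ 2 ∧
      ‖ψ - ψ₀ - β *ᵥ (fun a => f a ψ₀) - β *ᵥ (fun a => dir (β *ᵥ (fun a => f a ψ₀)) (f1 a)
        - dir (β *ᵥ (fun a => f a ψ₀)) (fun b => dir (β *ᵥ (fun a => f a ψ₀)) (α1 a b)))‖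
        ≤ K * z ^ 3 := by
  -- X1·z² and X2·z³ bound the vectors to which β is applied in the second- and third-order
  -- identities below; K1 = kB·X1 is the resulting bound for d - h.
  set X1 : ℝ := k * B + C * B ^ 2 + k * C * B ^ 2 with hX1
  set K1 : ℝ := k * B * X1 with hK1
  set X2 : ℝ := C * B ^ 3 + k ^ 2 * B ^ 2 + k * K1 + k * C * B ^ 3 + k * (k * C * K1) * B
    + k * (k * C * (k * B)) * K1 with hX2
  have hk : (0 : ℝ) ≤ k := Nat.cast_nonneg k
  have p1 : 0 ≤ X1 := by positivity
  have p2 : 0 ≤ K1 := by positivity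
  have p3 : 0 ≤ X2 := by positivity
  refine ⟨B + K1 + k * B * X2, by positivity, ?_⟩
  intro Ψ ψ₀ f f1 f2 α α1 β z ψ h0 hψ hf hα hf2 hβα hβ hr hd hz0 hz1 hz2 hz
  set d := ψ - ψ₀ with hdd
  set F : Fin k → ℝ := fun a => f a ψ₀ with hF
  set h := β *ᵥ F with hh
  have hFz : ‖F‖ ≤ z := (pi_norm_le_iff_of_nonneg hz).2 hz0
  have hdz : ‖d‖ ≤ B * z := hd.trans (by gcongr)
  have hhz : ‖h‖ ≤ k * B * z := norm_mulVec_le hβ hz0 hB hz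
  have dβ : d = β *ᵥ fun a => dir d (fun b => α a b ψ₀) := by
    have e : (fun a => dir d (fun b => α a b ψ₀)) = (Matrix.of fun a b => α a b ψ₀) *ᵥ d := by
      ext a
      simp only [dir, Matrix.mulVec, dotProduct, smul_eq_mul, mul_comm, Matrix.of_apply]
    rw [e, Matrix.mulVec_mulVec, hβα, Matrix.one_mulVec]
  -- Since β inverts α(ψ₀), d is β applied to α(ψ₀)d. The root equation replaces f(ψ) by α(ψ)d, and
  -- only differences between ψ and ψ₀ remain.
  have ex1 : d - h = β *ᵥ fun a => (f a ψ - f a ψ₀) - dir d (fun b => α a b ψ - α a b ψ₀) := by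
    conv_lhs => rw [dβ]
    rw [hh, ← Matrix.mulVec_sub]
    congr 1
    ext a
    rw [dir_sub_right, hr a, Pi.sub_apply]
    ring
  have bx1 : ∀ a, |(f a ψ - f a ψ₀) - dir d (fun b => α a b ψ - α a b ψ₀)| ≤ X1 * z ^ 2 := by
    intro a
    have t1 := (hf a).first h0 hψ
    rw [Real.norm_eq_abs, ← hdd] at t1
    have t2 := abs_dir_le (v := d) (hz1 a)
    have t3 := abs_dir_le (v := d) (g := fun b => α a b ψ - α a b ψ₀) (C := C * ‖d‖) fun b =>
      (hα a b).lip ψ hψ ψ₀ h0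
    have e : (f a ψ - f a ψ₀) - dir d (fun b => α a b ψ - α a b ψ₀)
        = (f a ψ - f a ψ₀ - dir d (f1 a)) + dir d (f1 a)
          - dir d (fun b => α a b ψ - α a b ψ₀) := by ring
    rw [e]
    refine (abs_sub _ _).trans ((add_le_add ((abs_add_le _ _).trans (add_le_add t1 t2)) t3).trans ?_)
    calc _ ≤ C * (B * z) ^ 2 + k * z * (B * z) + k * (C * (B * z)) * (B * z) := by gcongr
      _ = _ := by rw [hX1]; ring
  have hr1 : ‖d - h‖ ≤ K1 * z ^ 2 := by
    rw [ex1]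
    refine (norm_mulVec_le hβ bx1 hB (by positivity)).trans (le_of_eq ?_)
    rw [hK1]; ring
  have p4 : 0 ≤ k * B * X2 := by positivity
  refine ⟨hdz.trans ?_, hr1.trans ?_, ?_⟩
  · gcongr; linarith
  · gcongr; linarith
  -- What remains is cubic in z: the Taylor remainders of f and α, the second-order coefficients of
  -- f, which are themselves of size z, and the cost of replacing d by h.
  have ex2 : d - h - β *ᵥ (fun a => dir h (f1 a) - dir h (fun b => dir h (α1 a b)))
      = β *ᵥ fun a => (f a ψ - f a ψ₀ - dir d (f1 a) - dir₂ d (f2 a)) + dir₂ d (f2 a)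
        + dir (d - h) (f1 a) - dir d (fun b => α a b ψ - α a b ψ₀ - dir d (α1 a b))
        - dir d (fun b => dir (d - h) (α1 a b)) - dir (d - h) (fun b => dir h (α1 a b)) := by
    conv_lhs => rw [ex1, ← Matrix.mulVec_sub]
    congr 1
    ext a
    have e1 : dir d (fun b => dir (d - h) (α1 a b))
        = dir d (fun b => dir d (α1 a b)) - dir d (fun b => dir h (α1 a b)) := by
      simp only [dir_sub_left]
      rw [dir_sub_right]
    simp only [Pi.sub_apply]
    rw [dir_sub_right d (fun b => α a b ψ - α a b ψ₀), e1, dir_sub_left d h, dir_sub_left d h]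
    ring
  rw [ex2]
  refine (norm_mulVec_le hβ (X := X2 * z ^ 3) (fun a => ?_) hB (by positivity)).trans ?_
  · have t1 := hf2 a
    have t2 : |dir₂ d (f2 a)| ≤ k ^ 2 * z * ‖d‖ ^ 2 := norm_dir₂_le (F := ℝ) (hz2 a)
    have t3 := abs_dir_le (v := d - h) (hz1 a)
    have t4 := abs_dir_le (v := d) (g := fun b => α a b ψ - α a b ψ₀ - dir d (α1 a b))
      (C := C * ‖d‖ ^ 2) fun b => (hα a b).first h0 hψ
    have t5 := abs_dir_le (v := d) (g := fun b => dir (d - h) (α1 a b))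
      (C := k * C * ‖d - h‖) fun b => abs_dir_le (hα a b).bound_one
    have t6 := abs_dir_le (v := d - h) (g := fun b => dir h (α1 a b))
      (C := k * C * ‖h‖) fun b => abs_dir_le (hα a b).bound_one
    refine (abs_sub _ _).trans ((add_le_add ((abs_sub _ _).trans (add_le_add ((abs_sub _ _).trans
      (add_le_add ((abs_add_le _ _).trans (add_le_add ((abs_add_le _ _).trans (add_le_add t1 t2))
        t3)) t4)) t5)) t6).trans ?_)
    calc _ ≤ C * (B * z) ^ 3 + k ^ 2 * z * (B * z) ^ 2 + k * z * (K1 * z ^ 2)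
          + k * (C * (B * z) ^ 2) * (B * z) + k * (k * C * (K1 * z ^ 2)) * (B * z)
          + k * (k * C * (k * B * z)) * (K1 * z ^ 2) := by gcongr
      _ = _ := by rw [hX2]; ring
  · rw [← mul_assoc]
    gcongr
    linarith

end Roots

/-! ### Expectations of stochastic expansions -/

section Expectations

variable {Ω : Type*} [MeasurableSpace Ω] {μ : Measure Ω} [IsProbabilityMeasure μ]

/-- The weight w is τ^{4-r} in the applications. It converts a bound by z^r into one by (z⁴ + τ⁴)/w,
so that only the fourth moment of z and the probability of the exceptional event are needed. -/
theorem abs_integral_le_of_le_fourth {z X : Ω → ℝ} {bad : Set Ω} {K K' τ w : ℝ}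
    (hz4 : MemLp z 4 μ) (hz : ∫ ω, z ω ^ 4 ∂μ ≤ K * τ ^ 4) (hbad : MeasurableSet bad)
    (hb : μ.real bad ≤ K * τ ^ 4) (hw : 0 < w) (hK' : 0 ≤ K') (hX : AEStronglyMeasurable X μ)
    (h : ∀ ω, |X ω| ≤ K' / w * (z ω ^ 4 + τ ^ 4 + bad.indicator 1 ω)) :
    Integrable X μ ∧ |∫ ω, X ω ∂μ| ≤ K' / w * ((2 * K + 1) * τ ^ 4) := by
  have i4 := MemLp.integrable_pow_four hz4
  have ib : Integrable (bad.indicator (1 : Ω → ℝ)) μ := (integrable_const 1).indicator hbad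
  have ig : Integrable (fun ω => K' / w * (z ω ^ 4 + τ ^ 4 + bad.indicator 1 ω)) μ :=
    ((i4.add (integrable_const _)).add ib).const_mul _
  have iX : Integrable X μ := ig.mono' hX (ae_of_all _ h)
  refine ⟨iX, (abs_integral_le_integral_abs).trans ((integral_mono iX.abs ig h).trans ?_)⟩
  rw [integral_const_mul, integral_add_add i4 (integrable_const _) ib, integral_indicator_one hbad]
  simp only [integral_const, probReal_univ, smul_eq_mul, one_mul]
  gcongr
  linarith

theorem sq_le_fourth_div {z τ : ℝ} (hτ : 0 < τ) : z ^ 2 ≤ (z ^ 4 + τ ^ 4) / τ ^ 2 := by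
  rw [le_div_iff₀ (by positivity)]
  nlinarith [sq_nonneg (z ^ 2 - τ ^ 2), sq_nonneg z, sq_nonneg (z ^ 2)]

theorem cube_le_fourth_div {z τ : ℝ} (hz : 0 ≤ z) (hτ : 0 < τ) : z ^ 3 ≤ (z ^ 4 + τ ^ 4) / τ := by
  rw [le_div_iff₀ (by positivity)]
  rcases le_total z τ with h | h
  · have : z ^ 3 ≤ τ ^ 3 := by gcongr
    nlinarith [pow_nonneg hz 4]
  · have : z ^ 3 * τ ≤ z ^ 3 * z := by gcongr
    nlinarith [pow_pos hτ 4]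

theorem quadratic_le_fourth {z : ℝ} : 1 + z + z ^ 2 ≤ 3 * (z ^ 4 + 1) := by
  nlinarith [sq_nonneg (z - 1), sq_nonneg (z ^ 2 - 1)]

/-- A random variable which is `O(z^r)` off a set of small probability, and `O(1 + z + z²)` on that
set, has expectation `O(τ^r)` if `z` has fourth moment `O(τ⁴)`; here `r = 2` or `r = 3`. -/
theorem abs_integral_le_pow {z X : Ω → ℝ} {bad : Set Ω} {K K' τ : ℝ} {r : ℕ} (hr : r = 2 ∨ r = 3)
    (hτ : 0 < τ) (hτ1 : τ ≤ 1)
    (hz4 : MemLp z 4 μ) (hz0 : ∀ ω, 0 ≤ z ω) (hz : ∫ ω, z ω ^ 4 ∂μ ≤ K * τ ^ 4)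
    (hbad : MeasurableSet bad)
    (hb : μ.real bad ≤ K * τ ^ 4) (hK' : 0 ≤ K') (hX : AEStronglyMeasurable X μ)
    (h1 : ∀ ω ∉ bad, |X ω| ≤ K' * z ω ^ r) (h2 : ∀ ω ∈ bad, |X ω| ≤ K' * (1 + z ω + z ω ^ 2)) :
    Integrable X μ ∧ |∫ ω, X ω ∂μ| ≤ 3 * K' * (2 * K + 1) * τ ^ r := by
  have key : ∀ w : ℝ, 0 < w → w ≤ 1 → (∀ ω, z ω ^ r ≤ (z ω ^ 4 + τ ^ 4) / w) →
      ∀ ω, |X ω| ≤ 3 * K' / w * (z ω ^ 4 + τ ^ 4 + bad.indicator 1 ω) := by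
    intro w hw hw1 hr ω
    have h4 : 0 ≤ z ω ^ 4 + τ ^ 4 := by positivity
    by_cases hω : ω ∈ bad
    · refine (h2 ω hω).trans ?_
      rw [Set.indicator_of_mem hω, Pi.one_apply, div_mul_eq_mul_div, le_div_iff₀ hw]
      have := quadratic_le_fourth (z := z ω)
      have h5 : 0 ≤ 1 + z ω + z ω ^ 2 := by have := hz0 ω; positivity
      calc K' * (1 + z ω + z ω ^ 2) * w ≤ K' * (1 + z ω + z ω ^ 2) * 1 := by gcongr
        _ ≤ K' * (3 * (z ω ^ 4 + 1)) := by rw [mul_one]; gcongr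
        _ ≤ _ := by
          have : 0 ≤ K' * τ ^ 4 := by positivity
          linarith
    · refine (h1 ω hω).trans ?_
      rw [Set.indicator_of_notMem hω, add_zero]
      calc K' * z ω ^ r ≤ K' * ((z ω ^ 4 + τ ^ 4) / w) := by gcongr; exact hr ω
        _ ≤ 3 * (K' * ((z ω ^ 4 + τ ^ 4) / w)) := by
          have : 0 ≤ K' * ((z ω ^ 4 + τ ^ 4) / w) := by positivity
          linarith
        _ = _ := by ring
  rcases hr with rfl | rfl
  · obtain ⟨a, b⟩ := abs_integral_le_of_le_fourth hz4 hz hbad hb (w := τ ^ 2) (by positivity)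
      (K' := 3 * K') (by positivity) hX (key _ (by positivity) (pow_le_one₀ hτ.le hτ1)
        fun ω => sq_le_fourth_div hτ)
    refine ⟨a, b.trans (le_of_eq ?_)⟩
    field_simp
  · obtain ⟨a, b⟩ := abs_integral_le_of_le_fourth hz4 hz hbad hb (w := τ) (by positivity)
      (K' := 3 * K') (by positivity) hX (key _ (by positivity) hτ1
        fun ω => cube_le_fourth_div (hz0 ω) hτ)
    refine ⟨a, b.trans (le_of_eq ?_)⟩
    field_simp

/-- The mean and the covariances of a bounded random vector `d` with a stochastic expansion
`d = h₁ + h₂ + …` on an event of high probability. -/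
theorem mean_cov_of_expansion {K : ℝ} (hK : 0 ≤ K) : ∃ K' : ℝ, ∀ (k : ℕ) (d h₁ h₂ : Ω → Fin k → ℝ)
    (z : Ω → ℝ) (bad : Set Ω) (τ : ℝ), 0 < τ → τ ≤ 1 → Measurable d → Measurable h₁ →
    Measurable h₂ → MemLp z 4 μ → (∀ ω, 0 ≤ z ω) → ∫ ω, z ω ^ 4 ∂μ ≤ K * τ ^ 4 →
    MeasurableSet bad → μ.real bad ≤ K * τ ^ 4 → (∀ ω, ‖d ω‖ ≤ K) → (∀ ω, ‖h₁ ω‖ ≤ K * z ω) →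
    (∀ ω, ‖h₂ ω‖ ≤ K * z ω ^ 2) → (∀ ω ∉ bad, ‖d ω‖ ≤ K * z ω) →
    (∀ ω ∉ bad, ‖d ω - h₁ ω‖ ≤ K * z ω ^ 2) → (∀ ω ∉ bad, ‖d ω - h₁ ω - h₂ ω‖ ≤ K * z ω ^ 3) →
    (∀ a, ∫ ω, h₁ ω a ∂μ = 0) →
    (∀ a, |∫ ω, d ω a ∂μ - ∫ ω, h₂ ω a ∂μ| ≤ K' * τ ^ 3) ∧
    ∀ a b, |cov[fun ω => d ω a, fun ω => d ω b; μ] - ∫ ω, h₁ ω a * h₁ ω b ∂μ| ≤ K' * τ ^ 3 := by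
  set M : ℝ := 3 * K * (2 * K + 1) with hM
  set M3 : ℝ := 3 * (3 * K + 1) ^ 2 * (2 * K + 1) with hM3
  -- M·τ² bounds E h₂, and M3·τ³ bounds the expectations of the cubic errors; the square accounts
  -- for the product of the two means in the covariance.
  refine ⟨M3 + (M3 + M) ^ 2, ?_⟩
  intro k d h₁ h₂ z bad τ hτ hτ1 md m1 m2 hz4 hz0 hz hbad hb bd b1 b2 gd g1 g2 h0
  have hKz : ∀ ω, 0 ≤ K * z ω := fun ω => mul_nonneg hK (hz0 ω)
  have hKz2 : ∀ ω, 0 ≤ K * z ω ^ 2 := fun ω => mul_nonneg hK (sq_nonneg _)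
  have ma : ∀ {f : Ω → Fin k → ℝ}, Measurable f → ∀ a, Measurable fun ω => f ω a :=
    fun hf a => (measurable_pi_apply a).comp hf
  have pM : 0 ≤ M := by positivity
  have pM3 : 0 ≤ M3 := by positivity
  have τ32 : τ ^ 3 ≤ τ ^ 2 := pow_le_pow_of_le_one hτ.le hτ1 (by norm_num)
  have τ43 : τ ^ 4 ≤ τ ^ 3 := pow_le_pow_of_le_one hτ.le hτ1 (by norm_num)
  have co : ∀ (x : Fin k → ℝ) a, |x a| ≤ ‖x‖ := fun x a => norm_le_pi_norm x a
  have int1 : ∀ a, Integrable (fun ω => h₁ ω a) μ := fun a =>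
    ((hz4.integrable (by norm_num)).const_mul K).mono' (ma m1 a).aestronglyMeasurable
      (ae_of_all _ fun ω => (co _ a).trans (b1 ω))
  have I2 : ∀ a, Integrable (fun ω => h₂ ω a) μ ∧ |∫ ω, h₂ ω a ∂μ| ≤ M * τ ^ 2 := fun a =>
    abs_integral_le_pow (Or.inl rfl) hτ hτ1 hz4 hz0 hz hbad hb hK (ma m2 a).aestronglyMeasurable
      (fun ω _ => (co _ a).trans (b2 ω)) fun ω _ => (co _ a).trans ((b2 ω).trans (by
        have := hz0 ω
        gcongr
        linarith))
  have intd : ∀ a, Integrable (fun ω => d ω a) μ := fun a =>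
    (integrable_const K).mono' (ma md a).aestronglyMeasurable
      (ae_of_all _ fun ω => (co _ a).trans (bd ω))
  have I3 : ∀ a, |∫ ω, (d ω a - h₁ ω a - h₂ ω a) ∂μ| ≤ M3 * τ ^ 3 := fun a =>
    (abs_integral_le_pow (K' := (3 * K + 1) ^ 2) (Or.inr rfl) hτ hτ1 hz4 hz0 hz hbad hb
      (by positivity)
      (((ma md a).sub (ma m1 a)).sub (ma m2 a)).aestronglyMeasurable
      (fun ω hω => (co (d ω - h₁ ω - h₂ ω) a).trans ((g2 ω hω).trans (by
        have := hz0 ω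
        gcongr
        nlinarith)))
      fun ω _ => by
        refine (abs_sub _ _).trans ((add_le_add ((abs_sub _ _).trans (add_le_add
          ((co _ a).trans (bd ω)) ((co _ a).trans (b1 ω)))) ((co _ a).trans (b2 ω))).trans ?_)
        have h5 : 0 ≤ 1 + z ω + z ω ^ 2 := by have := hz0 ω; positivity
        calc K + K * z ω + K * z ω ^ 2 = K * (1 + z ω + z ω ^ 2) := by ring
          _ ≤ _ := by gcongr; nlinarith).2
  have Ed : ∀ a, ∫ ω, (d ω a - h₁ ω a - h₂ ω a) ∂μ = ∫ ω, d ω a ∂μ - ∫ ω, h₂ ω a ∂μ := fun a => by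
    rw [integral_sub (f := fun ω => d ω a - h₁ ω a) ((intd a).sub (int1 a)) (I2 a).1, integral_sub (intd a) (int1 a), h0, sub_zero]
  have mean : ∀ a, |∫ ω, d ω a ∂μ - ∫ ω, h₂ ω a ∂μ| ≤ M3 * τ ^ 3 := fun a => by
    rw [← Ed]; exact I3 a
  refine ⟨fun a => (mean a).trans (by gcongr; nlinarith), fun a b => ?_⟩
  have lpd : ∀ a, MemLp (fun ω => d ω a) 2 μ := fun a =>
    MemLp.of_bound (ma md a).aestronglyMeasurable K (ae_of_all _ fun ω => (co _ a).trans (bd ω))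
  -- Each mean is O(τ²), so the product of means in the covariance is O(τ⁴) and negligible.
  have small : ∀ a, |∫ ω, d ω a ∂μ| ≤ (M3 + M) * τ ^ 2 := fun a => by
    have e : ∫ ω, d ω a ∂μ = (∫ ω, d ω a ∂μ - ∫ ω, h₂ ω a ∂μ) + ∫ ω, h₂ ω a ∂μ := by ring
    rw [e]
    refine (abs_add_le _ _).trans ((add_le_add (mean a) (I2 a).2).trans ?_)
    nlinarith
  rw [covariance_eq_sub (lpd a) (lpd b)]
  have I4 := abs_integral_le_pow (X := fun ω => d ω a * d ω b - h₁ ω a * h₁ ω b)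
    (K' := (3 * K + 1) ^ 2) (Or.inr rfl) hτ hτ1 hz4 hz0 hz hbad hb
    (by positivity) (((ma md a).mul (ma md b)).sub ((ma m1 a).mul (ma m1 b))).aestronglyMeasurable
    (fun ω hω => by
      have e : d ω a * d ω b - h₁ ω a * h₁ ω b
          = (d ω - h₁ ω) a * d ω b + h₁ ω a * (d ω - h₁ ω) b := by
        simp only [Pi.sub_apply]; ring
      rw [e]
      refine (abs_add_le _ _).trans ?_
      rw [abs_mul, abs_mul]
      calc _ ≤ K * z ω ^ 2 * (K * z ω) + K * z ω * (K * z ω ^ 2) :=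
            add_le_add (mul_le_mul ((co _ a).trans (g1 ω hω)) ((co _ b).trans (gd ω hω))
              (abs_nonneg _) (hKz2 ω)) (mul_le_mul ((co _ a).trans (b1 ω))
              ((co _ b).trans (g1 ω hω)) (abs_nonneg _) (hKz ω))
        _ = 2 * K ^ 2 * z ω ^ 3 := by ring
        _ ≤ _ := by
          have := hz0 ω
          gcongr
          nlinarith)
    (fun ω _ => by
      refine (abs_sub _ _).trans ?_
      rw [abs_mul, abs_mul]
      have h5 := hz0 ω
      calc _ ≤ K * K + K * z ω * (K * z ω) :=
            add_le_add (mul_le_mul ((co _ a).trans (bd ω)) ((co _ b).trans (bd ω))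
              (abs_nonneg _) hK) (mul_le_mul ((co _ a).trans (b1 ω))
              ((co _ b).trans (b1 ω)) (abs_nonneg _) (hKz ω))
        _ ≤ K ^ 2 * (1 + z ω + z ω ^ 2) := by nlinarith [mul_nonneg (sq_nonneg K) h5]
        _ ≤ _ := by gcongr; nlinarith)
  have idd : Integrable (fun ω => d ω a * d ω b) μ := (lpd a).integrable_mul (lpd b)
  have i11 : Integrable (fun ω => h₁ ω a * h₁ ω b) μ := by
    refine (idd.sub I4.1).congr (ae_of_all _ fun ω => ?_)
    simp
  have e2 := integral_sub idd i11
  have e3 : (∫ ω, ((fun ω => d ω a) * fun ω => d ω b) ω ∂μ) = ∫ ω, d ω a * d ω b ∂μ := rfl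
  rw [e3]
  have e4 : ∫ ω, d ω a * d ω b ∂μ - (∫ ω, d ω a ∂μ) * (∫ ω, d ω b ∂μ) - ∫ ω, h₁ ω a * h₁ ω b ∂μ
      = ∫ ω, (d ω a * d ω b - h₁ ω a * h₁ ω b) ∂μ - (∫ ω, d ω a ∂μ) * (∫ ω, d ω b ∂μ) := by
    rw [e2]; ring
  rw [e4]
  refine (abs_sub _ _).trans ?_
  rw [abs_mul]
  calc _ ≤ M3 * τ ^ 3 + (M3 + M) * τ ^ 2 * ((M3 + M) * τ ^ 2) := add_le_add I4.2
        (mul_le_mul (small a) (small b) (abs_nonneg _) (by positivity))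
    _ = M3 * τ ^ 3 + (M3 + M) ^ 2 * τ ^ 4 := by ring
    _ ≤ _ := by nlinarith [sq_nonneg (M3 + M)]

end Expectations

/-! ### Operator norm, quadratic forms and nuclear norm -/

section MatrixNorms

open scoped Matrix.Norms.L2Operator

variable {m n l : Type*} [Fintype m] [Fintype n] [Fintype l] [DecidableEq m] [DecidableEq n]
  [DecidableEq l]

theorem norm_toLp_sq (x : n → ℝ) : ‖WithLp.toLp 2 x‖ ^ 2 = x ⬝ᵥ x := by
  rw [EuclideanSpace.norm_sq_eq]
  simp [dotProduct, pow_two]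

theorem dotProduct_self_nonneg' (x : n → ℝ) : 0 ≤ x ⬝ᵥ x := by
  rw [← norm_toLp_sq]; positivity

theorem dotProduct_sq_le (x y : n → ℝ) : (x ⬝ᵥ y) ^ 2 ≤ (x ⬝ᵥ x) * (y ⬝ᵥ y) := by
  have := Finset.sum_mul_sq_le_sq_mul_sq Finset.univ x y
  simpa [dotProduct, pow_two] using this

theorem mulVec_dotProduct_self_le (A : Matrix m n ℝ) (x : n → ℝ) :
    (A *ᵥ x) ⬝ᵥ (A *ᵥ x) ≤ ‖A‖ ^ 2 * (x ⬝ᵥ x) := by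
  have := Matrix.l2_opNorm_mulVec A (WithLp.toLp 2 x)
  rw [← norm_toLp_sq, ← norm_toLp_sq, ← mul_pow]
  exact pow_le_pow_left₀ (norm_nonneg _) this 2

theorem norm_le_of_mulVec {A : Matrix m n ℝ} {C : ℝ} (hC : 0 ≤ C)
    (h : ∀ x, (A *ᵥ x) ⬝ᵥ (A *ᵥ x) ≤ C ^ 2 * (x ⬝ᵥ x)) : ‖A‖ ≤ C := by
  rw [Matrix.l2_opNorm_def]
  refine ContinuousLinearMap.opNorm_le_bound _ hC fun x => ?_
  have := h x.ofLp
  rw [← norm_toLp_sq, ← norm_toLp_sq, ← mul_pow] at this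
  exact (pow_le_pow_iff_left₀ (norm_nonneg _) (by positivity) two_ne_zero).1 this

theorem abs_entry_le (A : Matrix m n ℝ) (i : m) (j : n) : |A i j| ≤ ‖A‖ := by
  refine abs_le_of_sq_le_sq ?_ (norm_nonneg _)
  have h := mulVec_dotProduct_self_le A (Pi.single j 1)
  have h1 : A i j ^ 2 ≤ (A *ᵥ Pi.single j 1) ⬝ᵥ (A *ᵥ Pi.single j 1) := by
    have : ∑ r, A r j ^ 2 = (A *ᵥ Pi.single j 1) ⬝ᵥ (A *ᵥ Pi.single j 1) := by
      simp [dotProduct, pow_two]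
    rw [← this]
    exact Finset.single_le_sum (f := fun r => A r j ^ 2) (fun r _ => sq_nonneg _)
      (Finset.mem_univ i)
  simpa using h1.trans h

theorem abs_trace_le (A : Matrix n n ℝ) : |A.trace| ≤ Fintype.card n * ‖A‖ := by
  refine (Finset.abs_sum_le_sum_abs _ _).trans ?_
  refine (Finset.sum_le_sum fun i _ => abs_entry_le A i i).trans ?_
  simp

theorem abs_quadratic_le (A : Matrix n n ℝ) (x : n → ℝ) : |x ⬝ᵥ (A *ᵥ x)| ≤ ‖A‖ * (x ⬝ᵥ x) := by
  refine abs_le_of_sq_le_sq ((dotProduct_sq_le _ _).trans ?_)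
    (mul_nonneg (norm_nonneg _) (dotProduct_self_nonneg' x))
  have := mul_le_mul_of_nonneg_left (mulVec_dotProduct_self_le A x) (dotProduct_self_nonneg' x)
  nlinarith

theorem norm_transpose (A : Matrix m n ℝ) : ‖Aᵀ‖ = ‖A‖ := by
  rw [← Matrix.conjTranspose_eq_transpose_of_trivial, Matrix.l2_opNorm_conjTranspose]

/-- Cauchy-Schwarz in each row; in effect the Frobenius norm is at most C. This turns entrywise
bounds of order 1/N into operator bounds free of the dimension. -/
theorem norm_le_of_entries {A : Matrix n n ℝ} {C : ℝ} (hC : 0 ≤ C)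
    (h : ∀ i j, |A i j| ≤ C / Fintype.card n) : ‖A‖ ≤ C := by
  refine norm_le_of_mulVec hC fun x => ?_
  rcases isEmpty_or_nonempty n with hn | hn
  · simp [dotProduct]
  have hN : (0 : ℝ) < Fintype.card n := by exact_mod_cast Fintype.card_pos
  set N : ℝ := (Fintype.card n : ℝ)
  have h1 : ∀ i, (A *ᵥ x) i ^ 2 ≤ C ^ 2 / N * (x ⬝ᵥ x) := fun i => by
    have := dotProduct_sq_le (A i) x
    refine this.trans (mul_le_mul_of_nonneg_right ?_ (dotProduct_self_nonneg' x))
    have h2 : A i ⬝ᵥ A i ≤ ∑ _j : n, (C / N) ^ 2 := Finset.sum_le_sum fun j _ => by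
      rw [← pow_two, ← sq_abs]
      exact pow_le_pow_left₀ (abs_nonneg _) (h i j) 2
    refine h2.trans (le_of_eq ?_)
    simp only [Finset.sum_const, Finset.card_univ, nsmul_eq_mul]
    change N * _ = _
    field_simp
  have h3 : (A *ᵥ x) ⬝ᵥ (A *ᵥ x) ≤ ∑ _i : n, C ^ 2 / N * (x ⬝ᵥ x) :=
    Finset.sum_le_sum fun i _ => by rw [← pow_two]; exact h1 i
  refine h3.trans (le_of_eq ?_)
  simp only [Finset.sum_const, Finset.card_univ, nsmul_eq_mul]
  change N * _ = _
  field_simp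

section Spectral

variable {S : Matrix n n ℝ} {c C : ℝ}

theorem dotProduct_mulVec_comm (hS : Sᵀ = S) (x y : n → ℝ) : x ⬝ᵥ (S *ᵥ y) = y ⬝ᵥ (S *ᵥ x) := by
  rw [Matrix.dotProduct_mulVec, ← Matrix.mulVec_transpose, hS, dotProduct_comm]

theorem dotProduct_mulVec_sq_le (hS : Sᵀ = S) (h : ∀ x, 0 ≤ x ⬝ᵥ (S *ᵥ x)) (x y : n → ℝ) :
    (x ⬝ᵥ (S *ᵥ y)) ^ 2 ≤ (x ⬝ᵥ (S *ᵥ x)) * (y ⬝ᵥ (S *ᵥ y)) := by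
  have key : ∀ t : ℝ, 0 ≤ (x ⬝ᵥ (S *ᵥ x)) * (t * t) + (2 * (x ⬝ᵥ (S *ᵥ y))) * t
      + y ⬝ᵥ (S *ᵥ y) := fun t => by
    have := h (t • x + y)
    rw [Matrix.mulVec_add, Matrix.mulVec_smul, add_dotProduct, dotProduct_add, dotProduct_add,
      smul_dotProduct, smul_dotProduct, dotProduct_smul, dotProduct_smul,
      dotProduct_mulVec_comm hS y x] at this
    simp only [smul_eq_mul] at this
    linarith
  have := discrim_le_zero key
  rw [discrim] at this
  linarith

/-- The Cauchy-Schwarz inequality of the semi-inner product defined by S, applied to x and Sx. In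
operator terms, 0 ≤ S ≤ C implies S² ≤ CS. -/
theorem mulVec_dotProduct_le (hS : Sᵀ = S) (h0 : ∀ x, 0 ≤ x ⬝ᵥ (S *ᵥ x))
    (h : ∀ x, x ⬝ᵥ (S *ᵥ x) ≤ C * (x ⬝ᵥ x)) (x : n → ℝ) :
    (S *ᵥ x) ⬝ᵥ (S *ᵥ x) ≤ C * (x ⬝ᵥ (S *ᵥ x)) := by
  have h1 := dotProduct_mulVec_sq_le hS h0 x (S *ᵥ x)
  rw [dotProduct_mulVec_comm hS x (S *ᵥ x)] at h1
  have h2 := h (S *ᵥ x)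
  rcases (dotProduct_self_nonneg' (S *ᵥ x)).eq_or_lt with h3 | h3
  · rw [← h3] at h2 ⊢
    have hz : S *ᵥ x = 0 := dotProduct_self_eq_zero.1 h3.symm
    rw [hz]; simp
  · have h4 := mul_le_mul_of_nonneg_left h2 (h0 x)
    nlinarith

theorem norm_le_of_quadratic (hC : 0 ≤ C) (hS : Sᵀ = S) (h0 : ∀ x, 0 ≤ x ⬝ᵥ (S *ᵥ x))
    (h : ∀ x, x ⬝ᵥ (S *ᵥ x) ≤ C * (x ⬝ᵥ x)) : ‖S‖ ≤ C := by
  refine norm_le_of_mulVec hC fun x => (mulVec_dotProduct_le hS h0 h x).trans ?_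
  have := mul_le_mul_of_nonneg_left (h x) hC
  linarith

theorem le_mulVec_dotProduct (hc : 0 < c) (h : ∀ x, c * (x ⬝ᵥ x) ≤ x ⬝ᵥ (S *ᵥ x)) (x : n → ℝ) :
    c ^ 2 * (x ⬝ᵥ x) ≤ (S *ᵥ x) ⬝ᵥ (S *ᵥ x) := by
  have h1 := dotProduct_sq_le x (S *ᵥ x)
  have h2 := h x
  rcases (dotProduct_self_nonneg' x).eq_or_lt with h3 | h3
  · rw [← h3, mul_zero]; exact dotProduct_self_nonneg' _
  · have h4 : (c * (x ⬝ᵥ x)) ^ 2 ≤ (x ⬝ᵥ (S *ᵥ x)) ^ 2 := pow_le_pow_left₀ (by positivity) h2 2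
    have h5 : (x ⬝ᵥ x) * (c ^ 2 * (x ⬝ᵥ x)) ≤ (x ⬝ᵥ x) * ((S *ᵥ x) ⬝ᵥ (S *ᵥ x)) := by nlinarith
    exact le_of_mul_le_mul_left h5 h3

theorem isUnit_det_of_quadratic (hc : 0 < c) (h : ∀ x, c * (x ⬝ᵥ x) ≤ x ⬝ᵥ (S *ᵥ x)) :
    IsUnit S.det := by
  refine S.isUnit_iff_isUnit_det.1 (Matrix.mulVec_injective_iff_isUnit.1 fun x y hxy => ?_)
  have h1 := h (x - y)
  rw [Matrix.mulVec_sub, hxy, sub_self, dotProduct_zero] at h1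
  have h2 := dotProduct_self_nonneg' (x - y)
  have h3 : (x - y) ⬝ᵥ (x - y) = 0 := le_antisymm (by nlinarith) h2
  exact sub_eq_zero.1 (dotProduct_self_eq_zero.1 h3)

theorem norm_inv_le_of_quadratic (hc : 0 < c) (h : ∀ x, c * (x ⬝ᵥ x) ≤ x ⬝ᵥ (S *ᵥ x)) :
    ‖S⁻¹‖ ≤ 1 / c := by
  have hu := isUnit_det_of_quadratic hc h
  refine norm_le_of_mulVec (by positivity) fun x => ?_
  have := le_mulVec_dotProduct hc h (S⁻¹ *ᵥ x)
  rw [Matrix.mulVec_mulVec, Matrix.mul_nonsing_inv _ hu, Matrix.one_mulVec] at this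
  rw [div_pow, one_pow, div_mul_eq_mul_div, le_div_iff₀ (by positivity)]
  linarith

/-- The inequality S² ≤ CS evaluated at S⁻¹x. -/
theorem le_inv_quadratic (hc : 0 < c) (hS : Sᵀ = S) (h : ∀ x, c * (x ⬝ᵥ x) ≤ x ⬝ᵥ (S *ᵥ x))
    (hC : ∀ x, x ⬝ᵥ (S *ᵥ x) ≤ C * (x ⬝ᵥ x)) (x : n → ℝ) : x ⬝ᵥ x ≤ C * (x ⬝ᵥ (S⁻¹ *ᵥ x)) := by
  have hu := isUnit_det_of_quadratic hc h
  have := mulVec_dotProduct_le hS (fun x => (mul_nonneg hc.le (dotProduct_self_nonneg' x)).trans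
    (h x)) hC (S⁻¹ *ᵥ x)
  rw [Matrix.mulVec_mulVec, Matrix.mul_nonsing_inv _ hu, Matrix.one_mulVec] at this
  rwa [dotProduct_comm (S⁻¹ *ᵥ x)] at this

/-- Comparison of traces of congruent matrices. -/
theorem trace_transpose_mul_le (h : ∀ x, x ⬝ᵥ x ≤ C * (x ⬝ᵥ (S *ᵥ x))) (B : Matrix n m ℝ) :
    (Bᵀ * B).trace ≤ C * (Bᵀ * S * B).trace := by
  rw [Matrix.trace, Matrix.trace, Finset.mul_sum]
  refine Finset.sum_le_sum fun j _ => ?_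
  have e1 : (Bᵀ * B).diag j = B.col j ⬝ᵥ B.col j := by
    simp [Matrix.mul_apply, dotProduct]
  have e2 : (Bᵀ * S * B).diag j = B.col j ⬝ᵥ (S *ᵥ B.col j) := by
    rw [Matrix.mul_assoc]
    simp [Matrix.mul_apply, dotProduct, Matrix.mulVec]
  rw [e1, e2]
  exact h _

end Spectral

/-- A bound for the nuclear norm, in terms of the dual pairing. -/
def Nuc (C : ℝ) (E : Matrix n n ℝ) : Prop := ∀ B : Matrix n n ℝ, |(E * B).trace| ≤ C * ‖B‖

section Nuclear

variable {E F : Matrix n n ℝ} {C C' : ℝ}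

theorem Nuc.add (hE : Nuc C E) (hF : Nuc C' F) : Nuc (C + C') (E + F) := fun B => by
  rw [add_mul, Matrix.trace_add, add_mul]
  exact (abs_add_le _ _).trans (add_le_add (hE B) (hF B))

theorem Nuc.neg (hE : Nuc C E) : Nuc C (-E) := fun B => by
  rw [neg_mul, Matrix.trace_neg, abs_neg]; exact hE B

theorem Nuc.mono (hE : Nuc C E) (h : C ≤ C') : Nuc C' E := fun B =>
  (hE B).trans (by gcongr)

theorem Nuc.mul_right (hE : Nuc C E) (hC : 0 ≤ C) {A : Matrix n n ℝ} {a : ℝ} (hA : ‖A‖ ≤ a) :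
    Nuc (C * a) (E * A) := fun B => by
  rw [Matrix.mul_assoc, mul_assoc]
  exact (hE _).trans (mul_le_mul_of_nonneg_left ((norm_mul_le _ _).trans (by gcongr)) hC)

theorem Nuc.mul_left (hE : Nuc C E) (hC : 0 ≤ C) {A : Matrix n n ℝ} {a : ℝ} (hA : ‖A‖ ≤ a) :
    Nuc (C * a) (A * E) := fun B => by
  rw [Matrix.mul_assoc, Matrix.trace_mul_comm, Matrix.mul_assoc, mul_assoc]
  refine (hE _).trans (mul_le_mul_of_nonneg_left ((norm_mul_le _ _).trans ?_) hC)
  rw [mul_comm]; gcongr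

theorem Nuc.transpose (hE : Nuc C E) : Nuc C Eᵀ := fun B => by
  have : (Eᵀ * B).trace = (E * Bᵀ).trace := by
    rw [← Matrix.trace_transpose, Matrix.transpose_mul, Matrix.transpose_transpose,
      Matrix.trace_mul_comm]
  rw [this, ← norm_transpose B]
  exact hE _

theorem sum_sq_le_of_entries {A : Matrix n n ℝ} (h : ∀ i j, |A i j| ≤ C / Fintype.card n) :
    ∑ i, ∑ j, A i j ^ 2 ≤ C ^ 2 := by
  rcases isEmpty_or_nonempty n with hn | hn
  · simp; positivity
  have hN : (0 : ℝ) < Fintype.card n := by exact_mod_cast Fintype.card_pos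
  set N : ℝ := (Fintype.card n : ℝ)
  have : ∑ i, ∑ j, A i j ^ 2 ≤ ∑ _i : n, ∑ _j : n, (C / N) ^ 2 :=
    Finset.sum_le_sum fun i _ => Finset.sum_le_sum fun j _ => by
      rw [← sq_abs]
      exact pow_le_pow_left₀ (abs_nonneg _) (h i j) 2
  refine this.trans (le_of_eq ?_)
  simp only [Finset.sum_const, Finset.card_univ, nsmul_eq_mul]
  change N * (N * _) = _
  field_simp

theorem sum_sq_mul_le (A B : Matrix n n ℝ) :
    ∑ i, ∑ j, (A * B) i j ^ 2 ≤ ‖B‖ ^ 2 * ∑ i, ∑ j, A i j ^ 2 := by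
  rw [Finset.mul_sum]
  refine Finset.sum_le_sum fun i _ => ?_
  have h := mulVec_dotProduct_self_le Bᵀ (A i)
  rw [norm_transpose] at h
  have e1 : (Bᵀ *ᵥ A i) ⬝ᵥ (Bᵀ *ᵥ A i) = ∑ j, (A * B) i j ^ 2 := by
    simp only [dotProduct, Matrix.mulVec, Matrix.mul_apply, Matrix.transpose_apply, pow_two,
      mul_comm]
  have e2 : A i ⬝ᵥ A i = ∑ j, A i j ^ 2 := by simp [dotProduct, pow_two]
  rwa [e1, e2] at h

/-- The trace of EFB pairs the entries of E with those of FB, and E and F have Frobenius norm at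
most C. The gain over an operator bound is that a trace against a bounded matrix is O(1) instead of
O(N). -/
theorem Nuc.of_mul_entries (hE : ∀ i j, |E i j| ≤ C / Fintype.card n)
    (hF : ∀ i j, |F i j| ≤ C / Fintype.card n) : Nuc (C ^ 2) (E * F) := fun B => by
  refine abs_le_of_sq_le_sq ?_ (by positivity)
  have e : (E * F * B).trace = ∑ p : n × n, E p.1 p.2 * (F * B) p.2 p.1 := by
    rw [Matrix.mul_assoc, Matrix.trace, Fintype.sum_prod_type]
    simp [Matrix.mul_apply]
  rw [e]
  refine (Finset.sum_mul_sq_le_sq_mul_sq _ _ _).trans ?_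
  rw [Fintype.sum_prod_type, Fintype.sum_prod_type_right]
  have h1 := sum_sq_le_of_entries hE
  have h2 := (sum_sq_mul_le F B).trans (mul_le_mul_of_nonneg_left (sum_sq_le_of_entries hF)
    (sq_nonneg _))
  have := mul_le_mul h1 h2 (Finset.sum_nonneg fun _ _ => Finset.sum_nonneg fun _ _ => sq_nonneg _)
    (sq_nonneg _)
  refine this.trans (le_of_eq ?_)
  ring

end Nuclear

variable {k : ℕ} {Ψ : Set (Fin k → ℝ)} {ψ₀ : Fin k → ℝ}

theorem dir_apply {p q : Type*} (v : Fin k → ℝ) (G : Fin k → Matrix p q ℝ) (i : p) (j : q) :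
    (dir v G) i j = dir v (fun b => G b i j) := by
  simp [dir, Matrix.sum_apply]

theorem dir₂_apply {p q : Type*} (v : Fin k → ℝ) (G : Fin k → Fin k → Matrix p q ℝ) (i : p)
    (j : q) : (dir₂ v G) i j = dir₂ v (fun b c => G b c i j) := by
  simp [dir₂, Matrix.sum_apply]

theorem Jet.of_entries {G : (Fin k → ℝ) → Matrix n n ℝ} {G1 : Fin k → Matrix n n ℝ} {C : ℝ}
    (hC : 0 ≤ C)
    (h : ∀ i j, Jet Ψ ψ₀ (C / Fintype.card n) (fun ψ => G ψ i j) (fun b => G1 b i j)) :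
    Jet Ψ ψ₀ C G G1 := by
  choose g2 h1 h2 using fun i j => (h i j).second
  refine ⟨fun ψ hψ => norm_le_of_entries hC fun i j => (h i j).bound ψ hψ,
    fun ψ hψ ψ' hψ' => norm_le_of_entries (by positivity) fun i j => ?_,
    fun b => norm_le_of_entries hC fun i j => (h i j).bound_one b,
    fun ψ hψ ψ' hψ' => norm_le_of_entries (by positivity) fun i j => ?_,
    fun b c => Matrix.of fun i j => g2 i j b c,
    fun b c => norm_le_of_entries hC fun i j => h1 i j b c,
    fun ψ hψ => norm_le_of_entries (by positivity) fun i j => ?_⟩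
  · rw [mul_div_right_comm]
    exact (h i j).lip ψ hψ ψ' hψ'
  · rw [mul_div_right_comm, mul_div_right_comm, Matrix.sub_apply, Matrix.sub_apply, dir_apply]
    exact (h i j).strict ψ hψ ψ' hψ'
  · rw [mul_div_right_comm, Matrix.sub_apply, Matrix.sub_apply, Matrix.sub_apply, dir_apply,
      dir₂_apply]
    exact h2 i j ψ hψ

end MatrixNorms

/-! ### Whitening by the symmetric square root -/

section SquareRoot

variable {d : ℕ} {R : Matrix (Fin d) (Fin d) ℝ}

theorem sqrt_mul_sqrt (hR : R.PosDef) : CFC.sqrt R * CFC.sqrt R = R :=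
  CFC.sqrt_mul_sqrt_self R (Matrix.nonneg_iff_posSemidef.2 hR.posSemidef)

theorem transpose_sqrt : (CFC.sqrt R)ᵀ = CFC.sqrt R := by
  have := (Matrix.nonneg_iff_posSemidef.1 (CFC.sqrt_nonneg R)).1
  rwa [Matrix.IsHermitian, Matrix.conjTranspose_eq_transpose_of_trivial] at this

theorem isUnit_det_sqrt (hR : R.PosDef) : IsUnit (CFC.sqrt R).det := by
  have h : IsUnit R.det := hR.det_pos.ne'.isUnit
  rw [← sqrt_mul_sqrt hR, Matrix.det_mul] at h
  exact isUnit_of_mul_isUnit_left h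

theorem sqrt_mulVec_whiten (hR : R.PosDef) (x : Fin d → ℝ) : CFC.sqrt R *ᵥ whiten R x = x := by
  rw [whiten, Matrix.mulVec_mulVec, Matrix.mul_nonsing_inv _ (isUnit_det_sqrt hR),
    Matrix.one_mulVec]

theorem inv_sqrt_mul_mul (hR : R.PosDef) : (CFC.sqrt R)⁻¹ * R * (CFC.sqrt R)⁻¹ᵀ = 1 := by
  have hu := isUnit_det_sqrt hR
  rw [Matrix.transpose_nonsing_inv, transpose_sqrt]
  nth_rewrite 2 [← sqrt_mul_sqrt hR]
  rw [← Matrix.mul_assoc, Matrix.nonsing_inv_mul _ hu, Matrix.one_mul, Matrix.mul_nonsing_inv _ hu]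

theorem measurable_whiten : Measurable (whiten R) := by
  refine measurable_pi_lambda _ fun i => ?_
  simp only [whiten, Matrix.mulVec, dotProduct]
  fun_prop

variable {Ω : Type*} [MeasurableSpace Ω] {μ : Measure Ω} [IsProbabilityMeasure μ]

theorem integral_whiten {x : Ω → Fin d → ℝ} (hm : ∀ i, MemLp (fun ω => x ω i) 4 μ)
    (h0 : ∀ i, ∫ ω, x ω i ∂μ = 0) (i : Fin d) : ∫ ω, whiten R (x ω) i ∂μ = 0 := by
  simp only [whiten, Matrix.mulVec, dotProduct]
  rw [integral_finsetSum _ fun j _ => ((hm j).integrable (by norm_num)).const_mul _]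
  simp [integral_const_mul, h0]

theorem integral_sq_whiten (hR : R.PosDef) {x : Ω → Fin d → ℝ}
    (hm : ∀ i, MemLp (fun ω => x ω i) 4 μ) (hc : ∀ i j, ∫ ω, x ω i * x ω j ∂μ = R i j)
    (i : Fin d) : ∫ ω, whiten R (x ω) i ^ 2 ∂μ = 1 := by
  have hi : ∀ j l, Integrable (fun ω => x ω j * x ω l) μ := fun j l =>
    ((hm j).mono_exponent (p := 2) (by norm_num)).integrable_mul
      ((hm l).mono_exponent (p := 2) (by norm_num))
  set A := (CFC.sqrt R)⁻¹ with hA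
  have e : ∀ ω, whiten R (x ω) i ^ 2 = ∑ j, ∑ l, A i j * A i l * (x ω j * x ω l) := fun ω => by
    simp only [whiten, Matrix.mulVec, dotProduct, pow_two]
    rw [Finset.sum_mul_sum]
    exact Finset.sum_congr rfl fun j _ => Finset.sum_congr rfl fun l _ => by ring
  simp only [e]
  rw [integral_finsetSum _ fun j _ => integrable_finsetSum _ fun l _ => (hi j l).const_mul _]
  have h1 : ∀ j, ∫ ω, ∑ l, A i j * A i l * (x ω j * x ω l) ∂μ
      = ∑ l, A i j * A i l * R j l := fun j => by
    rw [integral_finsetSum _ fun l _ => (hi j l).const_mul _]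
    exact Finset.sum_congr rfl fun l _ => by rw [integral_const_mul, hc]
  simp only [h1]
  have h2 := congrFun (congrFun (inv_sqrt_mul_mul hR) i) i
  rw [Matrix.one_apply_eq, Matrix.mul_apply] at h2
  rw [← h2, Finset.sum_comm]
  refine Finset.sum_congr rfl fun l _ => ?_
  rw [Matrix.mul_apply, Finset.sum_mul, Matrix.transpose_apply]
  exact Finset.sum_congr rfl fun j _ => by rw [← hA]; ring

end SquareRoot

theorem trace_mul_transpose_self {m : Type*} [Fintype m] (A : Matrix m m ℝ) :
    (A * Aᵀ).trace = ∑ i, ∑ j, A i j ^ 2 := by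
  simp only [Matrix.trace, Matrix.diag_apply, Matrix.mul_apply, Matrix.transpose_apply, pow_two]

/-! ### Independence of two families taken together -/

section SumIndependence

variable {Ω : Type*} [MeasurableSpace Ω] {μ : Measure Ω} {ι κ : Type*} [Fintype ι] [Fintype κ]

/-- A finite set of indices splits into its left and right parts; independence of the two vectors
separates these, and independence inside each family does the rest. It makes the standardized
coordinates of v and ε one independent family. -/
theorem iIndepFun_sumElim {f : ι → Ω → ℝ} {g : κ → Ω → ℝ} (hf : iIndepFun f μ)
    (hg : iIndepFun g μ) (h : IndepFun (fun ω i => f i ω) (fun ω j => g j ω) μ) :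
    iIndepFun (Sum.elim f g : ι ⊕ κ → Ω → ℝ) μ := by
  rw [iIndepFun_iff_measure_inter_preimage_eq_mul]
  intro S sets hS
  have e1 : (⋂ i ∈ S, (Sum.elim f g : ι ⊕ κ → Ω → ℝ) i ⁻¹' sets i)
      = ((fun ω i => f i ω) ⁻¹' (⋂ i ∈ S.toLeft, (fun x : ι → ℝ => x i) ⁻¹' sets (Sum.inl i)))
        ∩ ((fun ω j => g j ω) ⁻¹' (⋂ j ∈ S.toRight, (fun x : κ → ℝ => x j) ⁻¹' sets (Sum.inr j)))
      := by
    ext ω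
    simp [Sum.forall]
  have e2 : ((fun ω i => f i ω) ⁻¹' (⋂ i ∈ S.toLeft, (fun x : ι → ℝ => x i) ⁻¹' sets (Sum.inl i)))
      = ⋂ i ∈ S.toLeft, f i ⁻¹' sets (Sum.inl i) := by ext ω; simp
  have e3 : ((fun ω j => g j ω) ⁻¹' (⋂ j ∈ S.toRight, (fun x : κ → ℝ => x j) ⁻¹' sets (Sum.inr j)))
      = ⋂ j ∈ S.toRight, g j ⁻¹' sets (Sum.inr j) := by ext ω; simp
  rw [e1, h.measure_inter_preimage_eq_mul, e2, e3,
    (iIndepFun_iff_measure_inter_preimage_eq_mul.1 hf) _ fun i hi => hS _ (Finset.mem_toLeft.1 hi),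
    (iIndepFun_iff_measure_inter_preimage_eq_mul.1 hg) _ fun i hi => hS _ (Finset.mem_toRight.1 hi)]
  · conv_rhs => rw [← Finset.toLeft_disjSum_toRight (u := S)]
    rw [Finset.prod_disjSum]
    simp
  · exact Finset.measurableSet_biInter _ fun i hi =>
      measurable_pi_apply i (hS _ (Finset.mem_toLeft.1 hi))
  · exact Finset.measurableSet_biInter _ fun i hi =>
      measurable_pi_apply i (hS _ (Finset.mem_toRight.1 hi))

end SumIndependence

/-! ### The deviation from the mean as a linear image of standardized variables -/

namespace Model

variable {k p : ℕ} {Ω : Type*} [MeasurableSpace Ω] {μ : Measure Ω} (M : Model k p μ)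

/-- The standardized random effects and errors. -/
def xi (n : ℕ) : Fin (M.m n) ⊕ Fin (M.N n) → Ω → ℝ :=
  Sum.elim (fun i ω => whiten (M.Rv n M.ψ₀) (M.v n ω) i)
    (fun i ω => whiten (M.Re n M.ψ₀) (M.ε n ω) i)

/-- The matrix that maps the standardized variables to `Z v + ε`. -/
def fac (n : ℕ) : Matrix (Fin (M.N n)) (Fin (M.m n) ⊕ Fin (M.N n)) ℝ :=
  Matrix.fromCols (M.Z n * CFC.sqrt (M.Rv n M.ψ₀)) (CFC.sqrt (M.Re n M.ψ₀))

/-- The deviation `y - X β = Z v + ε`. -/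
def dev (n : ℕ) (ω : Ω) : Fin (M.N n) → ℝ := M.Z n *ᵥ M.v n ω + M.ε n ω

theorem y_eq (n : ℕ) (ω : Ω) : M.y n ω = M.X n *ᵥ M.β + M.dev n ω := by
  rw [y, dev, add_assoc]

theorem fac_mul_transpose (n : ℕ) : M.fac n * (M.fac n)ᵀ = M.S n := by
  have h1 := sqrt_mul_sqrt (M.Rv_posDef n M.ψ₀ M.true_mem)
  have h2 := sqrt_mul_sqrt (M.Re_posDef n M.ψ₀ M.true_mem)
  rw [fac, Matrix.transpose_fromCols, Matrix.fromCols_mul_fromRows, Matrix.transpose_mul,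
    transpose_sqrt, transpose_sqrt, h2, S, Sig, add_comm]
  congr 1
  rw [Matrix.mul_assoc, ← Matrix.mul_assoc (CFC.sqrt _), h1, Matrix.mul_assoc]

theorem dev_eq (n : ℕ) (ω : Ω) : M.dev n ω = M.fac n *ᵥ fun i => M.xi n i ω := by
  have e : (fun i => M.xi n i ω) = Sum.elim (whiten (M.Rv n M.ψ₀) (M.v n ω))
      (whiten (M.Re n M.ψ₀) (M.ε n ω)) := by
    ext i; cases i <;> rfl
  rw [e, fac, Matrix.fromCols_mulVec_sumElim, ← Matrix.mulVec_mulVec,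
    sqrt_mulVec_whiten (M.Rv_posDef n M.ψ₀ M.true_mem),
    sqrt_mulVec_whiten (M.Re_posDef n M.ψ₀ M.true_mem), dev]

theorem measurable_dev (n : ℕ) : Measurable (M.dev n) := by
  refine measurable_pi_lambda _ fun i => ?_
  simp only [dev, Matrix.mulVec, dotProduct, Pi.add_apply]
  have h1 : ∀ j, Measurable fun ω => M.v n ω j := fun j =>
    (measurable_pi_apply j).comp (M.measurable_v n)
  have h2 : ∀ j, Measurable fun ω => M.ε n ω j := fun j =>
    (measurable_pi_apply j).comp (M.measurable_ε n)
  fun_prop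

variable {M} in
theorem stdIndep_xi [IsProbabilityMeasure μ] (hreg : M.Regular) (he : M.Ke = 0) (hv : M.Kv = 0) :
    ∃ K : ℝ, ∀ n, StdIndep (M.xi n) K μ := by
  obtain ⟨C1, h1⟩ := hreg.eighth_ε
  obtain ⟨C2, h2⟩ := hreg.eighth_v
  refine ⟨max C1 C2, fun n => ⟨?_, ?_, ?_, ?_, ?_, ?_, ?_⟩⟩
  · rintro (i | i)
    · exact (measurable_pi_apply i).comp (measurable_whiten.comp (M.measurable_v n))
    · exact (measurable_pi_apply i).comp (measurable_whiten.comp (M.measurable_ε n))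
  · exact iIndepFun_sumElim (hreg.indep_v n) (hreg.indep_ε n)
      ((M.indep n).comp measurable_whiten measurable_whiten)
  · rintro (i | i)
    · exact (h2 n i).1
    · exact (h1 n i).1
  · rintro (i | i)
    · exact integral_whiten (M.memLp_v n) (M.mean_v n) i
    · exact integral_whiten (M.memLp_ε n) (M.mean_ε n) i
  · rintro (i | i)
    · exact integral_sq_whiten (M.Rv_posDef n _ M.true_mem) (M.memLp_v n) (M.cov_v n) i
    · exact integral_sq_whiten (M.Re_posDef n _ M.true_mem) (M.memLp_ε n) (M.cov_ε n) i
  · rintro (i | i)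
    · exact (M.fourth_v n i).trans (by rw [hv, zero_add])
    · exact (M.fourth_ε n i).trans (by rw [he, zero_add])
  · rintro (i | i)
    · exact (h2 n i).2.trans (le_max_right _ _)
    · exact (h1 n i).2.trans (le_max_left _ _)

/-- The centered quadratic form `uᵀ G u - tr (G Σ)` in the deviation `u = y - X β`. -/
def qf (n : ℕ) (G : Matrix (Fin (M.N n)) (Fin (M.N n)) ℝ) (ω : Ω) : ℝ :=
  M.dev n ω ⬝ᵥ (G *ᵥ M.dev n ω) - (G * M.S n).trace

variable {n : ℕ}

/-- With u = Fξ the matrix of the form in ξ is FᵀGF, and the centering agrees because FFᵀ = Σ and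
the trace is cyclic. -/
theorem qf_eq_quadForm (G : Matrix (Fin (M.N n)) (Fin (M.N n)) ℝ) (ω : Ω) :
    M.qf n G ω = quadForm (M.xi n) (fun i j => ((M.fac n)ᵀ * G * M.fac n) i j) Finset.univ ω := by
  rw [qf, quadForm]
  congr 1
  · rw [dev_eq, Matrix.mulVec_mulVec, ← Matrix.vecMul_transpose, ← Matrix.dotProduct_mulVec,
      Matrix.mulVec_mulVec, ← Matrix.mul_assoc]
    simp only [dotProduct, Matrix.mulVec, Finset.mul_sum]
    exact Finset.sum_congr rfl fun i _ => Finset.sum_congr rfl fun j _ => by ring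
  · rw [← fac_mul_transpose, ← Matrix.mul_assoc, Matrix.trace_mul_comm, ← Matrix.mul_assoc]
    rfl

theorem measurable_qf (G : Matrix (Fin (M.N n)) (Fin (M.N n)) ℝ) : Measurable (M.qf n G) := by
  have h : ∀ j, Measurable fun ω => M.dev n ω j := fun j =>
    (measurable_pi_apply j).comp (M.measurable_dev n)
  unfold qf
  simp only [dotProduct, Matrix.mulVec]
  fun_prop

theorem qf_add (G H : Matrix (Fin (M.N n)) (Fin (M.N n)) ℝ) (ω : Ω) :
    M.qf n (G + H) ω = M.qf n G ω + M.qf n H ω := by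
  simp only [qf, Matrix.add_mulVec, dotProduct_add, add_mul, Matrix.trace_add]; ring

theorem qf_smul (c : ℝ) (G : Matrix (Fin (M.N n)) (Fin (M.N n)) ℝ) (ω : Ω) :
    M.qf n (c • G) ω = c * M.qf n G ω := by
  simp only [qf, Matrix.smul_mulVec, dotProduct_smul, smul_mul_assoc, Matrix.trace_smul,
    smul_eq_mul]; ring

section Moments

open scoped Matrix.Norms.L2Operator

variable [IsProbabilityMeasure μ] {K : ℝ}

variable {M} in
theorem memLp_qf (h : StdIndep (M.xi n) K μ) (G : Matrix (Fin (M.N n)) (Fin (M.N n)) ℝ) :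
    MemLp (M.qf n G) 4 μ := by
  have : M.qf n G = quadForm (M.xi n) (fun i j => ((M.fac n)ᵀ * G * M.fac n) i j) Finset.univ :=
    funext fun ω => M.qf_eq_quadForm G ω
  rw [this]
  exact h.memLp_quadForm _ _

variable {M} in
theorem integral_qf (h : StdIndep (M.xi n) K μ) (G : Matrix (Fin (M.N n)) (Fin (M.N n)) ℝ) :
    ∫ ω, M.qf n G ω ∂μ = 0 := by
  simp only [qf_eq_quadForm]
  exact h.integral_quadForm _ _

theorem trace_congr_mul (G H : Matrix (Fin (M.N n)) (Fin (M.N n)) ℝ) :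
    (((M.fac n)ᵀ * G * M.fac n) * ((M.fac n)ᵀ * H * M.fac n)).trace
      = (G * M.S n * H * M.S n).trace := by
  rw [← fac_mul_transpose]
  simp only [Matrix.mul_assoc]
  rw [Matrix.trace_mul_comm]
  simp only [Matrix.mul_assoc]

variable {M} in
-- Symmetry of one of the two matrices is enough to merge the two terms of
-- `StdIndep.integral_quadForm_mul` into the factor 2; the other one, later a derivative of the
-- equation matrix, is arbitrary.
theorem integral_qf_mul (h : StdIndep (M.xi n) K μ)
    (G H : Matrix (Fin (M.N n)) (Fin (M.N n)) ℝ) (hH : Hᵀ = H) :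
    ∫ ω, M.qf n G ω * M.qf n H ω ∂μ = 2 * (G * M.S n * H * M.S n).trace := by
  simp only [qf_eq_quadForm]
  rw [h.integral_quadForm_mul, ← trace_congr_mul]
  set B := (M.fac n)ᵀ * H * M.fac n with hB
  have hBt : ∀ i j, B i j = B j i := fun i j => by
    have : Bᵀ = B := by
      rw [hB, Matrix.transpose_mul, Matrix.transpose_mul, Matrix.transpose_transpose, hH,
        Matrix.mul_assoc]
    exact congrFun (congrFun this j) i
  rw [Matrix.trace, Finset.mul_sum]
  refine Finset.sum_congr rfl fun i _ => ?_
  rw [Matrix.diag_apply, Matrix.mul_apply, Finset.mul_sum]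
  exact Finset.sum_congr rfl fun j _ => by rw [hBt i j]; ring

variable {M} in
-- Whittle's inequality, with the squared Frobenius norm of FᵀGF written as tr(GΣGᵀΣ) ≤ N‖G‖²‖Σ‖².
-- Thus the form has size √N in L⁴ when G and Σ are bounded.
theorem integral_qf_fourth_le (h : StdIndep (M.xi n) K μ) (hK : 0 ≤ K)
    (G : Matrix (Fin (M.N n)) (Fin (M.N n)) ℝ) :
    ∫ ω, M.qf n G ω ^ 4 ∂μ ≤ (320 * (K + 2) * ‖G‖ ^ 2 * ‖M.S n‖ ^ 2 * M.N n) ^ 2 := by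
  have h1 := h.sqrt_fourth_quadForm_le (fun i j => ((M.fac n)ᵀ * G * M.fac n) i j) Finset.univ
  simp only [qf_eq_quadForm]
  have e : ∑ i, ∑ j, ((M.fac n)ᵀ * G * M.fac n) i j ^ 2 = (G * M.S n * Gᵀ * M.S n).trace := by
    rw [← trace_congr_mul]
    have : (M.fac n)ᵀ * Gᵀ * M.fac n = ((M.fac n)ᵀ * G * M.fac n)ᵀ := by
      rw [Matrix.transpose_mul, Matrix.transpose_mul, Matrix.transpose_transpose, Matrix.mul_assoc]
    rw [this, trace_mul_transpose_self]
  rw [e] at h1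
  have h2 : (G * M.S n * Gᵀ * M.S n).trace ≤ M.N n * (‖G‖ ^ 2 * ‖M.S n‖ ^ 2) := by
    refine (le_abs_self _).trans ((abs_trace_le _).trans ?_)
    rw [Fintype.card_fin]
    gcongr
    refine (norm_mul_le_of_le (norm_mul_le_of_le (norm_mul_le _ _) le_rfl) le_rfl).trans ?_
    rw [norm_transpose]
    exact le_of_eq (by ring)
  have h3 := h1.trans (mul_le_mul_of_nonneg_left h2 (by positivity))
  refine ((Real.sqrt_le_left (by positivity)).1 h3).trans (le_of_eq (by ring))

/-- A pathwise bound that is linear in ‖G‖. Where |u|² = O(N) it transfers expansions of G(ψ),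
uniform in ψ, to the random functions. -/
theorem abs_qf_le (G : Matrix (Fin (M.N n)) (Fin (M.N n)) ℝ) (ω : Ω) :
    |M.qf n G ω| ≤ (M.dev n ω ⬝ᵥ M.dev n ω + M.N n * ‖M.S n‖) * ‖G‖ := by
  refine (abs_sub _ _).trans ?_
  have h1 := abs_quadratic_le G (M.dev n ω)
  have h2 := (abs_trace_le (G * M.S n)).trans (mul_le_mul_of_nonneg_left (norm_mul_le _ _)
    (Nat.cast_nonneg _))
  rw [Fintype.card_fin] at h2
  linarith

end Moments

end Model

/-! ### Bounds on Σ and its derivatives -/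

namespace Model

open scoped Matrix.Norms.L2Operator

variable {k p : ℕ} {Ω : Type*} [MeasurableSpace Ω] {μ : Measure Ω} {M : Model k p μ}

theorem Sig_transpose (n : ℕ) {ψ : Fin k → ℝ} (hψ : ψ ∈ M.Ψ) : (M.Sig n ψ)ᵀ = M.Sig n ψ := by
  have h1 := (M.Re_posDef n ψ hψ).1
  have h2 := (M.Rv_posDef n ψ hψ).1
  rw [Matrix.IsHermitian, Matrix.conjTranspose_eq_transpose_of_trivial] at h1 h2
  rw [Sig, Matrix.transpose_add, Matrix.transpose_mul, Matrix.transpose_mul,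
    Matrix.transpose_transpose, h1, h2, Matrix.mul_assoc]

/-- The affine formula is available only on Ψ; openness ensures that it holds along a short segment
in each coordinate direction, which is all that the line derivative sees. -/
theorem dSig_eq_of_affine (ho : IsOpen M.Ψ) {n : ℕ} {S₀ : Matrix (Fin (M.N n)) (Fin (M.N n)) ℝ}
    {S : Fin k → Matrix (Fin (M.N n)) (Fin (M.N n)) ℝ}
    (h : ∀ ψ ∈ M.Ψ, M.Sig n ψ = S₀ + ∑ a, ψ a • S a) {ψ : Fin k → ℝ} (hψ : ψ ∈ M.Ψ) (a : Fin k) :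
    M.dSig n a ψ = S a := by
  ext i j
  simp only [dSig, pderiv, Matrix.of_apply]
  have hc : Continuous fun t : ℝ => ψ + t • (Pi.single a 1 : Fin k → ℝ) := by fun_prop
  have hev : ∀ᶠ t : ℝ in 𝓝 0, ψ + t • (Pi.single a 1 : Fin k → ℝ) ∈ M.Ψ :=
    hc.continuousAt.eventually_mem (by simpa using ho.mem_nhds hψ)
  have he : (fun t : ℝ => M.Sig n (ψ + t • (Pi.single a 1 : Fin k → ℝ)) i j)
      =ᶠ[𝓝 0] fun t => M.Sig n ψ i j + t * S a i j := by
    filter_upwards [hev] with t ht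
    rw [h _ ht, h _ hψ]
    simp only [Matrix.add_apply, Matrix.sum_apply, Matrix.smul_apply, Pi.add_apply, Pi.smul_apply,
      smul_eq_mul, add_mul, Finset.sum_add_distrib]
    have : ∑ x, t * (Pi.single a 1 : Fin k → ℝ) x * S x i j = t * S a i j := by
      rw [Finset.sum_eq_single a]
      · simp
      · intro b _ hb; simp [hb]
      · simp
    rw [this]; ring
  have hd : HasDerivAt (fun t : ℝ => M.Sig n ψ i j + t * S a i j) (S a i j) 0 := by
    simpa using ((hasDerivAt_id (0 : ℝ)).mul_const (S a i j)).const_add (M.Sig n ψ i j)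
  exact HasLineDerivAt.lineDeriv (hd.congr_of_eventuallyEq he)

theorem dSig_eq (ho : IsOpen M.Ψ) (hlin : M.SigLinear) (n : ℕ) (a : Fin k) {ψ : Fin k → ℝ}
    (hψ : ψ ∈ M.Ψ) : M.dSig n a ψ = M.D n a := by
  obtain ⟨S₀, S, h⟩ := hlin n
  rw [D, dSig_eq_of_affine ho h hψ, dSig_eq_of_affine ho h M.true_mem]

theorem Sig_sub (ho : IsOpen M.Ψ) (hlin : M.SigLinear) (n : ℕ) {ψ ψ' : Fin k → ℝ}
    (hψ : ψ ∈ M.Ψ) (hψ' : ψ' ∈ M.Ψ) : M.Sig n ψ - M.Sig n ψ' = dir (ψ - ψ') (M.D n) := by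
  obtain ⟨S₀, S, h⟩ := hlin n
  have hD : ∀ a, M.D n a = S a := fun a => dSig_eq_of_affine ho h M.true_mem a
  rw [h ψ hψ, h ψ' hψ', add_sub_add_left_eq_sub, ← Finset.sum_sub_distrib, dir]
  exact Finset.sum_congr rfl fun a _ => by rw [hD, Pi.sub_apply, sub_smul]

/-- One step length t for all coordinates and all n makes each Σ_(a) an exact difference quotient of
Σ, so that it inherits symmetry and a uniform norm bound from values of Σ on Ψ. -/
theorem exists_step (ho : IsOpen M.Ψ) : ∃ t : ℝ, 0 < t ∧ ∀ a : Fin k,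
    M.ψ₀ + t • (Pi.single a 1 : Fin k → ℝ) ∈ M.Ψ := by
  obtain ⟨δ, hδ, hb⟩ := Metric.isOpen_iff.1 ho M.ψ₀ M.true_mem
  refine ⟨δ / 2, by positivity, fun a => hb ?_⟩
  rw [Metric.mem_ball, dist_eq_norm, add_sub_cancel_left, norm_smul, Pi.norm_single]
  simp only [Real.norm_eq_abs, abs_of_pos (half_pos hδ), norm_one, mul_one]
  linarith

theorem smul_D (ho : IsOpen M.Ψ) (hlin : M.SigLinear) (n : ℕ) {t : ℝ} {a : Fin k}
    (h : M.ψ₀ + t • (Pi.single a 1 : Fin k → ℝ) ∈ M.Ψ) :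
    t • M.D n a = M.Sig n (M.ψ₀ + t • (Pi.single a 1 : Fin k → ℝ)) - M.S n := by
  rw [S, Sig_sub ho hlin n h M.true_mem, add_sub_cancel_left, dir, Finset.sum_eq_single a]
  · simp
  · intro b _ hb; simp [hb]
  · simp

theorem D_transpose (ho : IsOpen M.Ψ) (hlin : M.SigLinear) (n : ℕ) (a : Fin k) :
    (M.D n a)ᵀ = M.D n a := by
  obtain ⟨t, ht, h⟩ := exists_step ho
  have h1 := smul_D ho hlin n (h a)
  have h2 := congrArg Matrix.transpose h1
  rw [Matrix.transpose_sub, Sig_transpose n (h a), S, Sig_transpose n M.true_mem, ← S, ← h1,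
    Matrix.transpose_smul] at h2
  exact smul_right_injective _ ht.ne' h2

/-- The bounds that hold for all large `n`. -/
structure Bounds (M : Model k p μ) (n : ℕ) (c C : ℝ) : Prop where
  pos : 0 < M.N n
  lower : ∀ ψ ∈ M.Ψ, ∀ x, c * (x ⬝ᵥ x) ≤ x ⬝ᵥ (M.Sig n ψ *ᵥ x)
  upper : ∀ ψ ∈ M.Ψ, ∀ x, x ⬝ᵥ (M.Sig n ψ *ᵥ x) ≤ C * (x ⬝ᵥ x)
  inv_norm : ∀ ψ ∈ M.Ψ, ‖(M.Sig n ψ)⁻¹‖ ≤ C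
  norm : ∀ ψ ∈ M.Ψ, ‖M.Sig n ψ‖ ≤ C
  norm_D : ∀ a, ‖M.D n a‖ ≤ C
  ident : ∀ t : Fin k → ℝ,
    c * (M.N n : ℝ) * (t ⬝ᵥ t) ≤ ∑ a, ∑ b, t a * t b * (M.D n a * M.D n b).trace

theorem exists_bounds (hreg : M.Regular) (hlin : M.SigLinear) :
    ∃ c C : ℝ, 0 < c ∧ 1 ≤ C ∧ ∀ᶠ n in atTop, Bounds M n c C := by
  obtain ⟨c, C, hc, hev⟩ := hreg.eigen
  obtain ⟨c', hc', hid⟩ := hreg.ident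
  obtain ⟨t, ht, hstep⟩ := exists_step hreg.isOpen
  set C₁ : ℝ := max C 1
  have hC₁ : 1 ≤ C₁ := le_max_right _ _
  -- The term 2C₁/t bounds Σ_(a) as a difference quotient of two matrices of norm at most C₁.
  refine ⟨min c c', max (max C₁ (1 / c)) (2 * C₁ / t), lt_min hc hc',
    hC₁.trans ((le_max_left _ _).trans (le_max_left _ _)), ?_⟩
  filter_upwards [hev, hid, hreg.tendsto_N.eventually_ge_atTop 1] with n h1 h2 h3
  have hup : ∀ ψ ∈ M.Ψ, ∀ x, x ⬝ᵥ (M.Sig n ψ *ᵥ x) ≤ C₁ * (x ⬝ᵥ x) := fun ψ hψ x =>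
    ((h1 ψ hψ x).2).trans (mul_le_mul_of_nonneg_right (le_max_left _ _) (dotProduct_self_nonneg' x))
  have hlo : ∀ ψ ∈ M.Ψ, ∀ x, c * (x ⬝ᵥ x) ≤ x ⬝ᵥ (M.Sig n ψ *ᵥ x) := fun ψ hψ x => (h1 ψ hψ x).1
  have hn : ∀ ψ ∈ M.Ψ, ‖M.Sig n ψ‖ ≤ C₁ := fun ψ hψ =>
    norm_le_of_quadratic (zero_le_one.trans hC₁) (Sig_transpose n hψ)
      (fun x => (mul_nonneg hc.le (dotProduct_self_nonneg' x)).trans (hlo ψ hψ x)) (hup ψ hψ)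
  refine ⟨h3, fun ψ hψ x => ?_, fun ψ hψ x => (hup ψ hψ x).trans ?_, fun ψ hψ => ?_,
    fun ψ hψ => ?_, fun a => ?_, fun s => ?_⟩
  · exact (mul_le_mul_of_nonneg_right (min_le_left _ _) (dotProduct_self_nonneg' x)).trans
      (hlo ψ hψ x)
  · exact mul_le_mul_of_nonneg_right ((le_max_left _ _).trans (le_max_left _ _))
      (dotProduct_self_nonneg' x)
  · exact (norm_inv_le_of_quadratic hc (hlo ψ hψ)).trans
      ((le_max_right _ _).trans (le_max_left _ _))
  · exact (hn ψ hψ).trans ((le_max_left _ _).trans (le_max_left _ _))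
  · refine le_trans ?_ (le_max_right _ _)
    have e := congrArg norm (smul_D hreg.isOpen hlin n (hstep a))
    rw [norm_smul, Real.norm_of_nonneg ht.le] at e
    rw [le_div_iff₀ ht, mul_comm, e]
    refine (norm_sub_le _ _).trans ?_
    have := hn _ (hstep a)
    have := hn _ M.true_mem
    rw [S]
    linarith
  · refine le_trans ?_ (h2 s)
    refine mul_le_mul_of_nonneg_right (mul_le_mul_of_nonneg_right (min_le_right _ _)
      (Nat.cast_nonneg _)) (dotProduct_self_nonneg' s)

namespace Bounds

variable {n : ℕ} {c C : ℝ}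

theorem isUnit_det (h : Bounds M n c C) (hc : 0 < c) {ψ : Fin k → ℝ} (hψ : ψ ∈ M.Ψ) :
    IsUnit (M.Sig n ψ).det := isUnit_det_of_quadratic hc (h.lower ψ hψ)

theorem jet_inv (h : Bounds M n c C) (hc : 0 < c) (ho : IsOpen M.Ψ) (hlin : M.SigLinear) :
    Jet M.Ψ M.ψ₀ ((k + 1) ^ 3 * (C + 1) ^ 7) (fun ψ => (M.Sig n ψ)⁻¹)
      (fun b => -((M.S n)⁻¹ * M.D n b * (M.S n)⁻¹)) :=
  Jet.inverse (T := M.Sig n) M.true_mem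
    (fun _ hψ => Matrix.nonsing_inv_mul _ (h.isUnit_det hc hψ))
    (fun _ hψ => Matrix.mul_nonsing_inv _ (h.isUnit_det hc hψ))
    (fun _ hψ _ hψ' => Sig_sub ho hlin n hψ hψ') h.inv_norm h.norm_D

theorem dotProduct_le_inv (h : Bounds M n c C) (hc : 0 < c) {ψ : Fin k → ℝ} (hψ : ψ ∈ M.Ψ)
    (x : Fin (M.N n) → ℝ) : x ⬝ᵥ x ≤ C * (x ⬝ᵥ ((M.Sig n ψ)⁻¹ *ᵥ x)) :=
  le_inv_quadratic hc (Sig_transpose n hψ) (h.lower ψ hψ) (h.upper ψ hψ) x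

end Bounds

/-- The projection `P(ψ) = X L(ψ)`. -/
def proj (M : Model k p μ) (L : LinEst M) (n : ℕ) (ψ : Fin k → ℝ) :
    Matrix (Fin (M.N n)) (Fin (M.N n)) ℝ := M.X n * L n ψ

/-- The partial derivatives of `X L` at the true parameter. -/
def proj1 (M : Model k p μ) (L : LinEst M) (n : ℕ) (b : Fin k) :
    Matrix (Fin (M.N n)) (Fin (M.N n)) ℝ :=
  Matrix.of fun i j => fderiv ℝ (fun φ => M.proj L n φ i j) M.ψ₀ (Pi.single b 1)

/-- The part of the order conditions which is used: the smoothness of `X L`. -/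
structure Leverage (M : Model k p μ) (L : LinEst M) (n : ℕ) (C : ℝ) : Prop where
  smooth : ∀ i j, ContDiffOn ℝ 3 (fun ψ => (M.X n * L n ψ) i j) M.Ψ
  bound : ∀ r ≤ 3, ∀ ψ ∈ M.Ψ, ∀ i j,
    ‖iteratedFDeriv ℝ r (fun φ => (M.X n * L n φ) i j) ψ‖ ≤ C / (M.N n : ℝ)

theorem OrderConditions.leverage' {L : LinEst M} {W : Weights M} (h : M.OrderConditions L W) :
    ∃ C : ℝ, 0 ≤ C ∧ ∀ᶠ n in atTop, Leverage M L n C := by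
  obtain ⟨C, hC⟩ := h.leverage
  refine ⟨max C 0, le_max_right _ _, ?_⟩
  filter_upwards [hC] with n hn
  refine ⟨h.smooth n, fun r hr ψ hψ i j => (hn r hr ψ hψ i j).trans ?_⟩
  gcongr
  exact le_max_left _ _

/-! ### Size of the projection XL and its derivatives -/

namespace Leverage

variable {n : ℕ} {C : ℝ} {L : LinEst M}

theorem jet_entry (h : Leverage M L n C) (hC : 0 ≤ C) (ho : IsOpen M.Ψ) (hcv : Convex ℝ M.Ψ)
    (i j : Fin (M.N n)) : Jet M.Ψ M.ψ₀ (C / M.N n) (fun ψ => M.proj L n ψ i j)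
      (fun b => M.proj1 L n b i j) :=
  Jet.of_contDiffOn (by positivity) M.true_mem ho hcv (h.smooth i j)
    fun r hr ψ hψ => h.bound r hr ψ hψ i j

theorem jet_proj (h : Leverage M L n C) (hC : 0 ≤ C) (ho : IsOpen M.Ψ) (hcv : Convex ℝ M.Ψ) :
    Jet M.Ψ M.ψ₀ C (M.proj L n) (M.proj1 L n) :=
  Jet.of_entries hC fun i j => by
    rw [Fintype.card_fin]; exact h.jet_entry hC ho hcv i j

theorem proj_mul_proj (hL : M.Unbiased L) {ψ : Fin k → ℝ} (hψ : ψ ∈ M.Ψ) (ψ' : Fin k → ℝ) :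
    M.proj L n ψ * M.proj L n ψ' = M.proj L n ψ' := by
  rw [proj, proj, Matrix.mul_assoc, ← Matrix.mul_assoc (L n ψ), hL n ψ hψ, Matrix.one_mul]

/-- Differentiation of P(ψ₀)P(φ) = P(φ) in φ. It exhibits the derivative as a product of two
matrices with entries O(1/N), which bounds its nuclear norm. -/
theorem proj_mul_proj1 (h : Leverage M L n C) (hL : M.Unbiased L) (ho : IsOpen M.Ψ) (b : Fin k) :
    M.proj L n M.ψ₀ * M.proj1 L n b = M.proj1 L n b := by
  ext i l
  have hd : ∀ j, HasFDerivAt (fun φ => M.proj L n φ j l)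
      (fderiv ℝ (fun φ => M.proj L n φ j l) M.ψ₀) M.ψ₀ := fun j =>
    (((h.smooth j l).contDiffAt (ho.mem_nhds M.true_mem)).differentiableAt
      (by norm_num)).hasFDerivAt
  have h1 := HasFDerivAt.fun_sum (u := Finset.univ)
    fun j _ => (hd j).const_mul (M.proj L n M.ψ₀ i j)
  have e : (fun φ => M.proj L n φ i l)
      = fun φ => ∑ j, M.proj L n M.ψ₀ i j * M.proj L n φ j l := by
    funext φ
    rw [← Matrix.mul_apply, proj_mul_proj hL M.true_mem]
  have h2 : HasFDerivAt (fun φ => M.proj L n φ i l) _ M.ψ₀ := e ▸ h1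
  have h3 := (hd i).unique h2
  simp only [proj1, Matrix.mul_apply, Matrix.of_apply]
  rw [h3]
  simp

/-- Idempotence: P = P·P is a product of two matrices with entries at most C/N. -/
theorem nuc_proj (h : Leverage M L n C) (hC : 0 ≤ C) (ho : IsOpen M.Ψ) (hcv : Convex ℝ M.Ψ)
    (hL : M.Unbiased L) {ψ : Fin k → ℝ} (hψ : ψ ∈ M.Ψ) : Nuc (C ^ 2) (M.proj L n ψ) := by
  rw [← proj_mul_proj hL hψ ψ]
  exact Nuc.of_mul_entries
    (fun i j => by rw [Fintype.card_fin]; exact (h.jet_entry hC ho hcv i j).bound ψ hψ)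
    (fun i j => by rw [Fintype.card_fin]; exact (h.jet_entry hC ho hcv i j).bound ψ hψ)

theorem nuc_proj1 (h : Leverage M L n C) (hC : 0 ≤ C) (ho : IsOpen M.Ψ) (hcv : Convex ℝ M.Ψ)
    (hL : M.Unbiased L) (b : Fin k) : Nuc (C ^ 2) (M.proj1 L n b) := by
  rw [← h.proj_mul_proj1 hL ho b]
  exact Nuc.of_mul_entries
    (fun i j => by rw [Fintype.card_fin]; exact (h.jet_entry hC ho hcv i j).bound _ M.true_mem)
    (fun i j => by rw [Fintype.card_fin]; exact (h.jet_entry hC ho hcv i j).bound_one b)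

end Leverage

/-- The matrix `G_a = Qᵀ W_a Q` of the `a`-th estimating equation. -/
def eeMat (M : Model k p μ) (L : LinEst M) (W : Weights M) (n : ℕ) (a : Fin k) (ψ : Fin k → ℝ) :
    Matrix (Fin (M.N n)) (Fin (M.N n)) ℝ := (M.Q L n ψ)ᵀ * W n a ψ * M.Q L n ψ

/-- The partial derivatives of `G_a` at the true parameter, in terms of those of `W_a`. -/
def eeMat1 (M : Model k p μ) (L : LinEst M) (W : Weights M)
    (W1 : ∀ n, Fin k → Fin k → Matrix (Fin (M.N n)) (Fin (M.N n)) ℝ) (n : ℕ) (a b : Fin k) :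
    Matrix (Fin (M.N n)) (Fin (M.N n)) ℝ :=
  (-(M.proj1 L n b)ᵀ * W n a M.ψ₀ + (M.Q L n M.ψ₀)ᵀ * W1 n a b) * M.Q L n M.ψ₀
    + (M.Q L n M.ψ₀)ᵀ * W n a M.ψ₀ * -(M.proj1 L n b)

/-- QX = 0 removes the regression part of y, and the affine formula for Σ(ψ) splits off the part of
the trace that is linear in ψ - ψ₀. This puts the equations into the form treated by `IsRoot`, with
all randomness on one side. -/
theorem ee_eq (ho : IsOpen M.Ψ) (hlin : M.SigLinear) {L : LinEst M} (hL : M.Unbiased L)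
    (W : Weights M) (n : ℕ) (a : Fin k) {ψ : Fin k → ℝ} (hψ : ψ ∈ M.Ψ) (ω : Ω) :
    M.ee L W n a ψ ω = M.qf n (M.eeMat L W n a ψ) ω
      - dir (ψ - M.ψ₀) (fun b => (M.eeMat L W n a ψ * M.D n b).trace) := by
  have hQX : M.Q L n ψ *ᵥ (M.X n *ᵥ M.β) = 0 := by
    rw [Q, Matrix.mulVec_mulVec, Matrix.sub_mul, Matrix.mul_assoc, hL n ψ hψ]
    simp
  have hy : M.y n ω ⬝ᵥ (M.eeMat L W n a ψ *ᵥ M.y n ω)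
      = M.dev n ω ⬝ᵥ (M.eeMat L W n a ψ *ᵥ M.dev n ω) := by
    have e : ∀ x, x ⬝ᵥ (M.eeMat L W n a ψ *ᵥ x)
        = (M.Q L n ψ *ᵥ x) ⬝ᵥ (W n a ψ *ᵥ (M.Q L n ψ *ᵥ x)) := fun x => by
      rw [eeMat, ← Matrix.mulVec_mulVec, ← Matrix.mulVec_mulVec, Matrix.dotProduct_mulVec x,
        Matrix.vecMul_transpose]
    rw [e, e, y_eq, Matrix.mulVec_add, hQX, zero_add]
  have hS : M.Sig n ψ = M.S n + dir (ψ - M.ψ₀) (M.D n) := by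
    rw [← Sig_sub ho hlin n hψ M.true_mem, S]; abel
  have htr : (M.eeMat L W n a ψ * dir (ψ - M.ψ₀) (M.D n)).trace
      = dir (ψ - M.ψ₀) (fun b => (M.eeMat L W n a ψ * M.D n b).trace) := by
    simp [dir, Finset.mul_sum, Matrix.trace_sum]
  rw [ee, ← eeMat, hy, hS, Matrix.mul_add, Matrix.trace_add, htr, qf]
  ring

theorem jet_Q {L : LinEst M} {n : ℕ} {C : ℝ} (h : Leverage M L n C) (hC : 0 ≤ C)
    (ho : IsOpen M.Ψ) (hcv : Convex ℝ M.Ψ) :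
    Jet M.Ψ M.ψ₀ (1 + C) (M.Q L n) (fun b => -(M.proj1 L n b)) := by
  have h1 := (h.jet_proj hC ho hcv).map (-LinearMap.id) zero_le_one (fun x => by simp)
  have h2 := (Jet.const (Ψ := M.Ψ) (ψ₀ := M.ψ₀) (1 : Matrix (Fin (M.N n)) (Fin (M.N n)) ℝ)).add h1
  have h3 : ‖(1 : Matrix (Fin (M.N n)) (Fin (M.N n)) ℝ)‖ ≤ 1 :=
    norm_le_of_mulVec zero_le_one fun x => by simp
  have h4 := h2.mono (C' := 1 + C) (by linarith)
  have e1 : M.Q L n = fun ψ => 1 + (-LinearMap.id : _ →ₗ[ℝ] _) (M.proj L n ψ) := by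
    funext ψ
    simp [Q, proj, sub_eq_add_neg]
  have e2 : (fun b => -(M.proj1 L n b))
      = fun b => 0 + (-LinearMap.id : _ →ₗ[ℝ] _) (M.proj1 L n b) := by
    funext b; simp
  rw [e1, e2]
  exact h4

/-- The conditions on the weight matrices: symmetry, smoothness, and coercivity of the matrices
`tr (W_a Σ_(b))`. -/
structure WeightBounds (M : Model k p μ) (W : Weights M)
    (W1 : ∀ n, Fin k → Fin k → Matrix (Fin (M.N n)) (Fin (M.N n)) ℝ) (n : ℕ) (c C : ℝ) : Prop where
  symm : ∀ a, (W n a M.ψ₀)ᵀ = W n a M.ψ₀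
  jet : ∀ a, Jet M.Ψ M.ψ₀ C (W n a) (W1 n a)
  coercive : ∀ ψ ∈ M.Ψ, ∀ t : Fin k → ℝ,
    c * M.N n * (t ⬝ᵥ t) ≤ ∑ a, t a * dir t (fun b => (W n a ψ * M.D n b).trace)

/-! ### The equation matrices compared with the weights -/

section EstimatingEquations

variable {L : LinEst M} {W : Weights M}
  {W1 : ∀ n, Fin k → Fin k → Matrix (Fin (M.N n)) (Fin (M.N n)) ℝ} {n : ℕ} {c C Cw : ℝ}

theorem jet_eeMat (h : Leverage M L n C) (hC : 0 ≤ C) (ho : IsOpen M.Ψ) (hcv : Convex ℝ M.Ψ)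
    (hw : WeightBounds M W W1 n c Cw) (a : Fin k) :
    Jet M.Ψ M.ψ₀ ((k + 2) ^ 2 * ((k + 2) ^ 2 * ((1 + C) * Cw) * (1 + C)))
      (M.eeMat L W n a) (M.eeMat1 L W W1 n a) := by
  have hQ := jet_Q h hC ho hcv
  have hQt := hQ.map (Matrix.transposeLinearEquiv (Fin (M.N n)) (Fin (M.N n)) ℝ ℝ).toLinearMap
    zero_le_one (fun x => by simp [norm_transpose])
  rw [one_mul] at hQt
  have := (hQt.mul (hw.jet a) M.true_mem).mul hQ M.true_mem
  have e : M.eeMat1 L W W1 n a = fun b =>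
      ((Matrix.transposeLinearEquiv (Fin (M.N n)) (Fin (M.N n)) ℝ ℝ).toLinearMap (-(M.proj1 L n b))
        * W n a M.ψ₀ + (Matrix.transposeLinearEquiv (Fin (M.N n)) (Fin (M.N n)) ℝ ℝ).toLinearMap
          (M.Q L n M.ψ₀) * W1 n a b) * M.Q L n M.ψ₀
        + (Matrix.transposeLinearEquiv (Fin (M.N n)) (Fin (M.N n)) ℝ ℝ).toLinearMap
          (M.Q L n M.ψ₀) * W n a M.ψ₀ * -(M.proj1 L n b) := by
    funext b
    simp [eeMat1]
  rw [e]
  exact this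

/-- After expanding QᵀWQ - W with Q = I - P, every term has a factor P or Pᵀ, and bounded nuclear
norm is stable under multiplication by bounded matrices. -/
theorem nuc_eeMat_sub (h : Leverage M L n C) (hC : 0 ≤ C) (ho : IsOpen M.Ψ) (hcv : Convex ℝ M.Ψ)
    (hL : M.Unbiased L) (hw : WeightBounds M W W1 n c Cw) (a : Fin k) {ψ : Fin k → ℝ}
    (hψ : ψ ∈ M.Ψ) : Nuc (2 * (C ^ 2 * (Cw * (1 + C)))) (M.eeMat L W n a ψ - W n a ψ) := by
  have hCw := (hw.jet a).nonneg M.true_mem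
  have hP := h.nuc_proj hC ho hcv hL hψ
  have hQ := (jet_Q h hC ho hcv).bound ψ hψ
  have hW := (hw.jet a).bound ψ hψ
  have e : M.eeMat L W n a ψ - W n a ψ
      = -((M.proj L n ψ)ᵀ * (W n a ψ * M.Q L n ψ)) + -(W n a ψ * M.proj L n ψ) := by
    have hq : M.Q L n ψ = 1 - M.proj L n ψ := rfl
    rw [eeMat, hq, Matrix.transpose_sub, Matrix.transpose_one]
    noncomm_ring
  rw [e]
  refine ((hP.transpose.mul_right (sq_nonneg _) (norm_mul_le_of_le hW hQ)).neg.add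
    (hP.mul_left (sq_nonneg _) hW).neg).mono ?_
  have : C ^ 2 * Cw ≤ C ^ 2 * (Cw * (1 + C)) := by
    gcongr; nlinarith
  linarith

/-- As for the matrices themselves: each of the four terms contains P, its derivative, or a
transpose of one of them. -/
theorem nuc_eeMat1_sub (h : Leverage M L n C) (hC : 0 ≤ C) (ho : IsOpen M.Ψ)
    (hcv : Convex ℝ M.Ψ) (hL : M.Unbiased L) (hw : WeightBounds M W W1 n c Cw) (a b : Fin k) :
    Nuc (4 * (C ^ 2 * (Cw * (1 + C)))) (M.eeMat1 L W W1 n a b - W1 n a b) := by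
  have h0 := M.true_mem
  have hCw := (hw.jet a).nonneg h0
  have hP := h.nuc_proj hC ho hcv hL h0
  have hP1 := h.nuc_proj1 hC ho hcv hL b
  have hQ := (jet_Q h hC ho hcv).bound _ h0
  have hQt : ‖(M.Q L n M.ψ₀)ᵀ‖ ≤ 1 + C := by rwa [norm_transpose]
  have hW := (hw.jet a).bound _ h0
  have hW1 := (hw.jet a).bound_one b
  have e : M.eeMat1 L W W1 n a b - W1 n a b
      = -((M.proj1 L n b)ᵀ * (W n a M.ψ₀ * M.Q L n M.ψ₀))
        + -((M.proj L n M.ψ₀)ᵀ * (W1 n a b * M.Q L n M.ψ₀)) + -(W1 n a b * M.proj L n M.ψ₀)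
        + -((M.Q L n M.ψ₀)ᵀ * W n a M.ψ₀ * M.proj1 L n b) := by
    have hq : M.Q L n M.ψ₀ = 1 - M.proj L n M.ψ₀ := rfl
    rw [eeMat1, hq, Matrix.transpose_sub, Matrix.transpose_one]
    noncomm_ring
  rw [e]
  refine ((((hP1.transpose.mul_right (sq_nonneg _) (norm_mul_le_of_le hW hQ)).neg.add
    (hP.transpose.mul_right (sq_nonneg _) (norm_mul_le_of_le hW1 hQ)).neg).add
    (hP.mul_left (sq_nonneg _) hW1).neg).add
    (hP1.mul_left (sq_nonneg _) (norm_mul_le_of_le hQt hW)).neg).mono ?_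
  have : C ^ 2 * Cw ≤ C ^ 2 * (Cw * (1 + C)) := by
    gcongr; nlinarith
  linarith

end EstimatingEquations

end Model

/-! ### Mean and covariance of a random root -/

section RandomEquations

variable {Ω : Type*} [MeasurableSpace Ω] {μ : Measure Ω} [IsProbabilityMeasure μ]

theorem fourth_sum_abs {ι : Type*} [Fintype ι] {X : ι → Ω → ℝ} {K : ℝ}
    (hX : ∀ i, MemLp (X i) 4 μ) (hK : ∀ i, ∫ ω, X i ω ^ 4 ∂μ ≤ K) :
    MemLp (fun ω => ∑ i, |X i ω|) 4 μ ∧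
      ∫ ω, (∑ i, |X i ω|) ^ 4 ∂μ ≤ (Fintype.card ι : ℝ) ^ 4 * K := by
  have hm : MemLp (fun ω => ∑ i, |X i ω|) 4 μ := memLp_finsetSum _ fun i _ => (hX i).abs
  have hi : ∀ i, Integrable (fun ω => X i ω ^ 4) μ := fun i => MemLp.integrable_pow_four (hX i)
  refine ⟨hm, ?_⟩
  have hle : ∀ ω, (∑ i, |X i ω|) ^ 4 ≤ (Fintype.card ι : ℝ) ^ 3 * ∑ i, X i ω ^ 4 := fun ω => by
    rcases isEmpty_or_nonempty ι with hι | hι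
    · simp
    have hc : (0 : ℝ) < Fintype.card ι := by exact_mod_cast Fintype.card_pos
    have := pow_sum_div_card_le_sum_pow (s := Finset.univ) (f := fun i => |X i ω|)
      (fun i _ => abs_nonneg _) 3
    rw [Finset.card_univ, div_le_iff₀ (by positivity), mul_comm] at this
    refine this.trans (le_of_eq ?_)
    congr 1
    exact Finset.sum_congr rfl fun i _ => by
      rw [show 3 + 1 = 2 * 2 by norm_num, pow_mul, sq_abs, ← pow_mul]
  refine (integral_mono (MemLp.integrable_pow_four hm)
    ((integrable_finsetSum _ fun i _ => hi i).const_mul _) hle).trans ?_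
  rw [integral_const_mul, integral_finsetSum _ fun i _ => hi i]
  calc (Fintype.card ι : ℝ) ^ 3 * ∑ i, ∫ ω, X i ω ^ 4 ∂μ
      ≤ (Fintype.card ι : ℝ) ^ 3 * ∑ _i : ι, K := by gcongr with i; exact hK i
    _ = _ := by simp; ring

theorem measureReal_lt_le {z : Ω → ℝ} {η K : ℝ} (hη : 0 < η) (hz : MemLp z 4 μ)
    (hK : ∫ ω, z ω ^ 4 ∂μ ≤ K) : μ.real {ω | η < z ω} ≤ K / η ^ 4 := by
  rw [le_div_iff₀ (by positivity), mul_comm]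
  refine le_trans ?_ ((mul_meas_ge_le_integral_of_nonneg (ae_of_all _ fun ω => by positivity)
    (MemLp.integrable_pow_four hz) (η ^ 4)).trans hK)
  exact mul_le_mul_of_nonneg_left (measureReal_mono fun ω (hω : η < z ω) =>
    pow_le_pow_left₀ hη.le hω.le 4) (by positivity)

variable {k : ℕ}

/-- The leading term `β f(ψ₀)` of the root. -/
def leadingTerm (β : Matrix (Fin k) (Fin k) ℝ) (f0 : Fin k → ℝ) : Fin k → ℝ := β *ᵥ f0

/-- The quadratic term in the expansion of the root. -/
def quadraticTerm (β : Matrix (Fin k) (Fin k) ℝ) (α1 : Fin k → Fin k → Fin k → ℝ)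
    (f0 : Fin k → ℝ) (f1 : Fin k → Fin k → ℝ) : Fin k → ℝ :=
  β *ᵥ fun a => dir (β *ᵥ f0) (f1 a) - dir (β *ᵥ f0) (fun b => dir (β *ᵥ f0) (α1 a b))

theorem norm_quadraticTerm_le {β : Matrix (Fin k) (Fin k) ℝ} {α1 : Fin k → Fin k → Fin k → ℝ}
    {f0 : Fin k → ℝ} {f1 : Fin k → Fin k → ℝ} {B C z : ℝ} (hB : 0 ≤ B) (hC : 0 ≤ C) (hz : 0 ≤ z)
    (hβ : ∀ a b, |β a b| ≤ B) (hα : ∀ a b c, |α1 a b c| ≤ C) (h0 : ∀ a, |f0 a| ≤ z)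
    (h1 : ∀ a b, |f1 a b| ≤ z) :
    ‖quadraticTerm β α1 f0 f1‖
      ≤ k * B * (k * (k * B) + k * (k * C * (k * B)) * (k * B)) * z ^ 2 := by
  have hh := norm_mulVec_le hβ h0 hB hz
  rw [mul_assoc]
  refine norm_mulVec_le hβ (fun a => ?_) hB (by positivity)
  refine (abs_sub _ _).trans ?_
  have t1 := abs_dir_le (v := β *ᵥ f0) (h1 a)
  have t2 := abs_dir_le (v := β *ᵥ f0) (g := fun b => dir (β *ᵥ f0) (α1 a b))
    fun b => abs_dir_le (hα a b)
  have t1' : k * z * ‖β *ᵥ f0‖ ≤ k * z * (k * B * z) := by gcongr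
  have t2' : k * (k * C * ‖β *ᵥ f0‖) * ‖β *ᵥ f0‖ ≤ k * (k * C * (k * B * z)) * (k * B * z) := by
    gcongr
  nlinarith

/-- Mean and covariance of a random solution of the equations `f(ψ) = α(ψ) (ψ - ψ₀)`. -/
theorem mean_cov_of_isRoot {Ψ : Set (Fin k → ℝ)} {ψ₀ : Fin k → ℝ} (hΨo : IsOpen Ψ)
    (hΨb : Bornology.IsBounded Ψ) (h0 : ψ₀ ∈ Ψ) {C c K : ℝ} (hC : 0 ≤ C) (hc : 0 < c)
    (hK : 0 ≤ K) : ∃ K' : ℝ, ∀ (f : Ω → Fin k → (Fin k → ℝ) → ℝ) (f1 : Ω → Fin k → Fin k → ℝ)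
      (f2 : Ω → Fin k → Fin k → Fin k → ℝ) (α : Fin k → Fin k → (Fin k → ℝ) → ℝ)
      (α1 : Fin k → Fin k → Fin k → ℝ) (ψhat : Ω → Fin k → ℝ) (bad : Set Ω) (τ : ℝ),
      0 < τ → τ ≤ 1 → Coercive Ψ c α → (∀ a b, Jet Ψ ψ₀ C (α a b) (α1 a b)) →
      MeasurableSet bad → μ.real bad ≤ K * τ ^ 4 →
      (∀ ω ∉ bad, ∀ a, Jet Ψ ψ₀ C (f ω a) (f1 ω a)) →
      (∀ ω ∉ bad, ∀ a, ∀ ψ ∈ Ψ, |f ω a ψ - f ω a ψ₀ - dir (ψ - ψ₀) (f1 ω a)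
        - dir₂ (ψ - ψ₀) (f2 ω a)| ≤ C * ‖ψ - ψ₀‖ ^ 3) →
      (∀ ψ ∈ Ψ, ∀ a, Measurable (fun ω => f ω a ψ) ∧ MemLp (fun ω => f ω a ψ) 4 μ ∧
        ∫ ω, f ω a ψ ^ 4 ∂μ ≤ K * τ ^ 4) →
      (∀ a b, Measurable (fun ω => f1 ω a b) ∧ MemLp (fun ω => f1 ω a b) 4 μ ∧
        ∫ ω, f1 ω a b ^ 4 ∂μ ≤ K * τ ^ 4) →
      (∀ a b c, Measurable (fun ω => f2 ω a b c) ∧ MemLp (fun ω => f2 ω a b c) 4 μ ∧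
        ∫ ω, f2 ω a b c ^ 4 ∂μ ≤ K * τ ^ 4) →
      (∀ a, ∫ ω, f ω a ψ₀ ∂μ = 0) →
      Measurable ψhat → (∀ ω, ψhat ω ∈ Ψ) →
      (∀ ω, (∃ ψ ∈ Ψ, IsRoot ψ₀ (f ω) α ψ) → IsRoot ψ₀ (f ω) α (ψhat ω)) →
      (∀ a, |∫ ω, (ψhat ω a - ψ₀ a) ∂μ
        - ∫ ω, quadraticTerm (Matrix.of fun a b => α a b ψ₀)⁻¹ α1 (fun a => f ω a ψ₀) (f1 ω) a ∂μ|
        ≤ K' * τ ^ 3) ∧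
      ∀ a b, |cov[fun ω => ψhat ω a, fun ω => ψhat ω b; μ]
        - ∫ ω, leadingTerm (Matrix.of fun a b => α a b ψ₀)⁻¹ (fun a => f ω a ψ₀) a
          * leadingTerm (Matrix.of fun a b => α a b ψ₀)⁻¹ (fun a => f ω a ψ₀) b ∂μ| ≤ K' * τ ^ 3 := by
  obtain ⟨η, hη, T, hT, hnet⟩ := exists_net_isRoot hΨo hΨb h0 hC hc
  set B : ℝ := 2 * ((k + 1) / c) with hBdef
  have hB : 0 ≤ B := by positivity
  obtain ⟨K₁, hK₁, hexp⟩ := root_expansion (k := k) hC hB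
  obtain ⟨R, hR⟩ := hΨb.exists_norm_le
  set K₂ : ℝ := k * B * (k * (k * B) + k * (k * C * (k * B)) * (k * B)) with hK₂
  have hK₂0 : 0 ≤ K₂ := by positivity
  -- The index set lists all random quantities that must be small: the values at ψ₀, the first- and
  -- second-order coefficients, and the values at the net points. The sum z of their absolute values
  -- controls everything at once.
  set ι := Fin k ⊕ (Fin k × Fin k) ⊕ (Fin k × Fin k × Fin k) ⊕ (T × Fin k)
  set m : ℝ := (Fintype.card ι : ℝ) ^ 4 * K
  have hm : 0 ≤ m := by positivity
  have hR0 : 0 ≤ R := (norm_nonneg _).trans (hR _ h0)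
  set K₃ : ℝ := (K + m + m / η ^ 4) + K₁ + K₂ + k * B + 2 * R with hK₃
  have hK₃0 : 0 ≤ K₃ := by positivity
  obtain ⟨K', hK'⟩ := mean_cov_of_expansion (μ := μ) hK₃0
  refine ⟨K', ?_⟩
  intro f f1 f2 α α1 ψhat bad τ hτ hτ1 hα hαj hbad hbadm hfj hf2 mf mf1 mf2 hf0 mψ hψ hsol
  set A : Matrix (Fin k) (Fin k) ℝ := Matrix.of fun a b => α a b ψ₀ with hA
  have hAc : ∀ t : Fin k → ℝ, c * ‖t‖ ^ 2 ≤ ∑ a, t a * dir t (A a) := hα ψ₀ h0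
  have hβ1 : A⁻¹ * A = 1 := Matrix.nonsing_inv_mul _ (isUnit_det_of_coercive hc hAc)
  have hβB : ∀ a b, |A⁻¹ a b| ≤ B := fun a b => (abs_inv_le_of_coercive hc hAc a b).trans (by
    have : (0 : ℝ) ≤ (k + 1) / c := by positivity
    rw [hBdef]; linarith)
  set X : ι → Ω → ℝ := Sum.elim (fun a ω => f ω a ψ₀) (Sum.elim (fun i ω => f1 ω i.1 i.2)
    (Sum.elim (fun i ω => f2 ω i.1 i.2.1 i.2.2) (fun i ω => f ω i.2 i.1))) with hX
  have hXm : ∀ i, Measurable (X i) ∧ MemLp (X i) 4 μ ∧ ∫ ω, X i ω ^ 4 ∂μ ≤ K * τ ^ 4 := by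
    rintro (a | i | i | i)
    · exact mf ψ₀ h0 a
    · exact mf1 _ _
    · exact mf2 _ _ _
    · exact mf _ (hT _ i.1.2) _
  set z : Ω → ℝ := fun ω => ∑ i, |X i ω| with hz
  obtain ⟨hz4, hz4'⟩ := fourth_sum_abs (fun i => (hXm i).2.1) fun i => (hXm i).2.2
  have hzm : Measurable z := Finset.measurable_fun_sum _ fun i _ => (hXm i).1.abs
  have hz0 : ∀ ω, 0 ≤ z ω := fun ω => Finset.sum_nonneg fun i _ => abs_nonneg _
  have hXz : ∀ i ω, |X i ω| ≤ z ω := fun i ω =>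
    Finset.single_le_sum (f := fun i => |X i ω|) (fun i _ => abs_nonneg _) (Finset.mem_univ i)
  have z0 : ∀ ω a, |f ω a ψ₀| ≤ z ω := fun ω a => hXz (Sum.inl a) ω
  have z1 : ∀ ω a b, |f1 ω a b| ≤ z ω := fun ω a b => hXz (Sum.inr (Sum.inl (a, b))) ω
  have z2 : ∀ ω a b c, |f2 ω a b c| ≤ z ω := fun ω a b c =>
    hXz (Sum.inr (Sum.inr (Sum.inl (a, b, c)))) ω
  have zT : ∀ ω, ∀ τ ∈ T, ∀ a, |f ω a τ| ≤ z ω := fun ω t ht a =>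
    hXz (Sum.inr (Sum.inr (Sum.inr (⟨t, ht⟩, a)))) ω
  have hα1 : ∀ a b c, |α1 a b c| ≤ C := fun a b c => (hαj a b).bound_one c
  have mfv : Measurable fun ω a => f ω a ψ₀ := measurable_pi_lambda _ fun a => (mf ψ₀ h0 a).1
  have mlead : Measurable fun ω => leadingTerm A⁻¹ (fun a => f ω a ψ₀) := by
    refine measurable_pi_lambda _ fun a => ?_
    simp only [leadingTerm, Matrix.mulVec, dotProduct]
    exact Finset.measurable_fun_sum _ fun b _ => (mf ψ₀ h0 b).1.const_mul _
  have mlead' : ∀ a, Measurable fun ω => (A⁻¹ *ᵥ fun a => f ω a ψ₀) a := fun a =>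
    (measurable_pi_apply a).comp mlead
  have mquad : Measurable fun ω => quadraticTerm A⁻¹ α1 (fun a => f ω a ψ₀) (f1 ω) := by
    refine measurable_pi_lambda _ fun a => ?_
    simp only [quadraticTerm]
    rw [show (fun ω => (A⁻¹ *ᵥ fun a => dir (A⁻¹ *ᵥ fun a => f ω a ψ₀) (f1 ω a)
        - dir (A⁻¹ *ᵥ fun a => f ω a ψ₀) fun b => dir (A⁻¹ *ᵥ fun a => f ω a ψ₀) (α1 a b)) a)
      = fun ω => ∑ e, A⁻¹ a e * (dir (A⁻¹ *ᵥ fun a => f ω a ψ₀) (f1 ω e)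
        - dir (A⁻¹ *ᵥ fun a => f ω a ψ₀) fun b => dir (A⁻¹ *ᵥ fun a => f ω a ψ₀) (α1 e b))
      from rfl]
    refine Finset.measurable_fun_sum _ fun e _ => (Measurable.sub ?_ ?_).const_mul _
    · simp only [dir, smul_eq_mul]
      exact Finset.measurable_fun_sum _ fun b _ => (mlead' b).mul (mf1 e b).1
    · simp only [dir, smul_eq_mul]
      exact Finset.measurable_fun_sum _ fun b _ => (mlead' b).mul
        (Finset.measurable_fun_sum _ fun c _ => (mlead' c).mul_const _)
  have hτ4 : (0 : ℝ) ≤ τ ^ 4 := by positivity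
  have hm4 : 0 ≤ m / η ^ 4 := by positivity
  have hkB : (0 : ℝ) ≤ k * B := by positivity
  -- Off the exceptional set, z ≤ η makes the existence and localization of roots available, so the
  -- estimator is a root and has the expansion. The set where z > η has probability O(τ⁴) by
  -- Markov's inequality for z⁴.
  have main : ∀ ω ∉ bad ∪ {ω | η < z ω}, ‖ψhat ω - ψ₀‖ ≤ K₁ * z ω ∧
      ‖ψhat ω - ψ₀ - leadingTerm A⁻¹ (fun a => f ω a ψ₀)‖ ≤ K₁ * z ω ^ 2 ∧
      ‖ψhat ω - ψ₀ - leadingTerm A⁻¹ (fun a => f ω a ψ₀)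
        - quadraticTerm A⁻¹ α1 (fun a => f ω a ψ₀) (f1 ω)‖ ≤ K₁ * z ω ^ 3 := by
    intro ω hω
    rw [Set.mem_union, not_or] at hω
    have hzη : z ω ≤ η := not_lt.1 hω.2
    obtain ⟨hex, hloc⟩ := hnet (f ω) (f1 ω) α α1 (hfj ω hω.1) hα hαj
      (fun a => (z0 ω a).trans hzη) (fun a b => (z1 ω a b).trans hzη)
      (fun t ht a => (zT ω t ht a).trans hzη)
    have hroot := hsol ω hex
    exact hexp Ψ ψ₀ (f ω) (f1 ω) (f2 ω) α α1 A⁻¹ (z ω) (ψhat ω) h0 (hψ ω) (hfj ω hω.1) hαj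
      (hf2 ω hω.1 · _ (hψ ω)) hβ1 hβB hroot (hloc _ (hψ ω) hroot) (z0 ω) (z1 ω) (z2 ω) (hz0 ω)
  have hres := hK' k (fun ω => ψhat ω - ψ₀) (fun ω => leadingTerm A⁻¹ (fun a => f ω a ψ₀))
    (fun ω => quadraticTerm A⁻¹ α1 (fun a => f ω a ψ₀) (f1 ω)) z (bad ∪ {ω | η < z ω}) τ hτ hτ1
    (mψ.sub_const _) mlead mquad hz4 hz0
    (hz4'.trans (by
      rw [← mul_assoc]
      refine mul_le_mul_of_nonneg_right ?_ hτ4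
      linarith))
    (hbad.union (measurableSet_lt measurable_const hzm))
    (by
      refine (measureReal_union_le _ _).trans ?_
      have h1 := measureReal_lt_le hη hz4 hz4'
      have h2 : (Fintype.card ι : ℝ) ^ 4 * (K * τ ^ 4) / η ^ 4 = m / η ^ 4 * τ ^ 4 := by
        simp only [m]; ring
      rw [h2] at h1
      refine (add_le_add hbadm h1).trans ?_
      rw [← add_mul]
      refine mul_le_mul_of_nonneg_right ?_ hτ4
      linarith)
    (fun ω => by
      refine (norm_sub_le _ _).trans ?_
      have := hR _ (hψ ω)
      have := hR _ h0
      linarith)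
    (fun ω => by
      refine (norm_mulVec_le hβB (z0 ω) hB (hz0 ω)).trans ?_
      refine mul_le_mul_of_nonneg_right ?_ (hz0 ω)
      linarith)
    (fun ω => (norm_quadraticTerm_le hB hC (hz0 ω) hβB hα1 (z0 ω) (z1 ω)).trans (by
      refine mul_le_mul_of_nonneg_right ?_ (sq_nonneg _)
      linarith))
    (fun ω hω => (main ω hω).1.trans (by
      refine mul_le_mul_of_nonneg_right ?_ (hz0 ω)
      linarith))
    (fun ω hω => (main ω hω).2.1.trans (by
      refine mul_le_mul_of_nonneg_right ?_ (sq_nonneg _)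
      linarith))
    (fun ω hω => (main ω hω).2.2.trans (by
      refine mul_le_mul_of_nonneg_right ?_ (pow_nonneg (hz0 ω) 3)
      linarith))
    (fun a => by
      simp only [leadingTerm, Matrix.mulVec, dotProduct]
      rw [integral_finsetSum _ fun b _ => ((mf ψ₀ h0 b).2.1.integrable (by norm_num)).const_mul _]
      simp [integral_const_mul, hf0])
  refine ⟨hres.1, fun a b => ?_⟩
  have hcov := hres.2 a b
  have hint : ∀ a, Integrable (fun ω => ψhat ω a) μ := fun a =>
    Integrable.of_bound ((measurable_pi_apply a).comp mψ).aestronglyMeasurable R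
      (ae_of_all _ fun ω => (norm_le_pi_norm _ a).trans (hR _ (hψ ω)))
  have e : cov[fun ω => (ψhat ω - ψ₀) a, fun ω => (ψhat ω - ψ₀) b; μ]
      = cov[fun ω => ψhat ω a, fun ω => ψhat ω b; μ] := by
    simp only [Pi.sub_apply]
    rw [covariance_sub_const_left (hint a), covariance_sub_const_right (hint b)]
  rwa [e] at hcov

end RandomEquations

theorem norm_sq_le_dotProduct {k : ℕ} (t : Fin k → ℝ) : ‖t‖ ^ 2 ≤ t ⬝ᵥ t := by
  have h : ‖t‖ ≤ √(t ⬝ᵥ t) := (pi_norm_le_iff_of_nonneg (Real.sqrt_nonneg _)).2 fun a => by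
    rw [Real.norm_eq_abs]
    refine Real.abs_le_sqrt ?_
    rw [pow_two]
    exact Finset.single_le_sum (f := fun a => t a * t a) (fun b _ => mul_self_nonneg _)
      (Finset.mem_univ a)
  calc ‖t‖ ^ 2 ≤ √(t ⬝ᵥ t) ^ 2 := by gcongr
    _ = t ⬝ᵥ t := Real.sq_sqrt (dotProduct_self_nonneg' t)

/-! ### Expectations of the leading and quadratic terms -/

section Terms

variable {k : ℕ}

/-- The expectation of the quadratic term, for centered Gaussian-like data with covariances `B`
of `f` and `P` of the derivatives of `f` with `f`. -/
def meanTerm (β B : Matrix (Fin k) (Fin k) ℝ) (P R : Fin k → Fin k → Fin k → ℝ) : Fin k → ℝ :=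
  β *ᵥ fun e => (∑ b, ∑ c, β b c * P e b c) - ∑ b, ∑ c, (β * B * βᵀ) b c * R e b c

variable {Ω : Type*} [MeasurableSpace Ω] {μ : Measure Ω}

theorem integral_leadingTerm_mul {β B : Matrix (Fin k) (Fin k) ℝ} {f : Ω → Fin k → ℝ}
    (hi : ∀ a b, Integrable (fun ω => f ω a * f ω b) μ)
    (hB : ∀ a b, ∫ ω, f ω a * f ω b ∂μ = B a b) (a b : Fin k) :
    Integrable (fun ω => leadingTerm β (f ω) a * leadingTerm β (f ω) b) μ ∧
    ∫ ω, leadingTerm β (f ω) a * leadingTerm β (f ω) b ∂μ = (β * B * βᵀ) a b := by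
  have e : ∀ ω, leadingTerm β (f ω) a * leadingTerm β (f ω) b
      = ∑ d, ∑ c, β a c * β b d * (f ω c * f ω d) := fun ω => by
    simp only [leadingTerm, Matrix.mulVec, dotProduct]
    rw [Finset.sum_mul_sum, Finset.sum_comm]
    exact Finset.sum_congr rfl fun d _ => Finset.sum_congr rfl fun c _ => by ring
  have i2 : ∀ d, Integrable (fun ω => ∑ c, β a c * β b d * (f ω c * f ω d)) μ := fun d =>
    integrable_finsetSum _ fun c _ => (hi c d).const_mul _
  simp only [e]
  refine ⟨integrable_finsetSum _ fun d _ => i2 d, ?_⟩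
  rw [integral_finsetSum _ fun d _ => i2 d, Matrix.mul_apply]
  refine Finset.sum_congr rfl fun d _ => ?_
  rw [integral_finsetSum _ fun c _ => (hi c d).const_mul _, Matrix.mul_apply, Finset.sum_mul]
  refine Finset.sum_congr rfl fun c _ => ?_
  rw [integral_const_mul, hB, Matrix.transpose_apply]
  ring

theorem integral_quadraticTerm {β B : Matrix (Fin k) (Fin k) ℝ} {α1 P : Fin k → Fin k → Fin k → ℝ}
    {f : Ω → Fin k → ℝ} {f1 : Ω → Fin k → Fin k → ℝ}
    (hi : ∀ a b, Integrable (fun ω => f ω a * f ω b) μ)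
    (hB : ∀ a b, ∫ ω, f ω a * f ω b ∂μ = B a b)
    (hi1 : ∀ e b c, Integrable (fun ω => f1 ω e b * f ω c) μ)
    (hP : ∀ e b c, ∫ ω, f1 ω e b * f ω c ∂μ = P e b c) (a : Fin k) :
    ∫ ω, quadraticTerm β α1 (f ω) (f1 ω) a ∂μ = meanTerm β B P α1 a := by
  have hl := integral_leadingTerm_mul (β := β) hi hB
  have e : ∀ ω, quadraticTerm β α1 (f ω) (f1 ω) a
      = ∑ e, β a e * ((∑ b, ∑ c, β b c * (f1 ω e b * f ω c))
        - ∑ b, ∑ c, leadingTerm β (f ω) b * leadingTerm β (f ω) c * α1 e b c) := fun ω => by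
    rw [quadraticTerm, Matrix.mulVec, dotProduct]
    refine Finset.sum_congr rfl fun e _ => ?_
    congr 2
    · simp only [dir, Matrix.mulVec, dotProduct, smul_eq_mul, Finset.sum_mul]
      exact Finset.sum_congr rfl fun b _ => Finset.sum_congr rfl fun c _ => by ring
    · simp only [dir, leadingTerm, smul_eq_mul, Finset.mul_sum]
      exact Finset.sum_congr rfl fun b _ => Finset.sum_congr rfl fun c _ => by ring
  have j1 : ∀ e b, Integrable (fun ω => ∑ c, β b c * (f1 ω e b * f ω c)) μ := fun e b =>
    integrable_finsetSum _ fun c _ => (hi1 e b c).const_mul _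
  have j2 : ∀ e b, Integrable
      (fun ω => ∑ c, leadingTerm β (f ω) b * leadingTerm β (f ω) c * α1 e b c) μ := fun e b =>
    integrable_finsetSum _ fun c _ => (hl b c).1.mul_const _
  have i1 : ∀ e, Integrable (fun ω => ∑ b, ∑ c, β b c * (f1 ω e b * f ω c)) μ := fun e =>
    integrable_finsetSum _ fun b _ => j1 e b
  have i2 : ∀ e, Integrable
      (fun ω => ∑ b, ∑ c, leadingTerm β (f ω) b * leadingTerm β (f ω) c * α1 e b c) μ := fun e =>
    integrable_finsetSum _ fun b _ => j2 e b
  have i3 : ∀ e, Integrable (fun ω => (∑ b, ∑ c, β b c * (f1 ω e b * f ω c))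
      - ∑ b, ∑ c, leadingTerm β (f ω) b * leadingTerm β (f ω) c * α1 e b c) μ := fun e =>
    (i1 e).sub (i2 e)
  simp only [e]
  rw [integral_finsetSum _ fun e _ => (i3 e).const_mul _, meanTerm, Matrix.mulVec,
    dotProduct]
  refine Finset.sum_congr rfl fun e _ => ?_
  rw [integral_const_mul, integral_sub (i1 e) (i2 e), integral_finsetSum _ fun b _ => j1 e b,
    integral_finsetSum _ fun b _ => j2 e b]
  congr 2
  · refine Finset.sum_congr rfl fun b _ => ?_
    rw [integral_finsetSum _ fun c _ => (hi1 e b c).const_mul _]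
    exact Finset.sum_congr rfl fun c _ => by rw [integral_const_mul, hP]
  · refine Finset.sum_congr rfl fun b _ => ?_
    rw [integral_finsetSum _ fun c _ => (hl b c).1.mul_const _]
    exact Finset.sum_congr rfl fun c _ => by rw [integral_mul_const, (hl b c).2]

end Terms

/-! ### Application to the estimating equations -/

namespace Model

open scoped Matrix.Norms.L2Operator

variable {k p : ℕ} {Ω : Type*} [MeasurableSpace Ω] {μ : Measure Ω} {M : Model k p μ}

/-- The linear map `G ↦ (uᵀ G u - tr (G Σ)) / N`. -/
def qfLin (M : Model k p μ) (n : ℕ) (ω : Ω) : Matrix (Fin (M.N n)) (Fin (M.N n)) ℝ →ₗ[ℝ] ℝ where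
  toFun G := M.qf n G ω / M.N n
  map_add' G H := by rw [qf_add, add_div]
  map_smul' r G := by rw [qf_smul, RingHom.id_apply, smul_eq_mul, mul_div_assoc]

/-- The linear map `G ↦ tr (G H) / N`. -/
def trLin {N : ℕ} (H : Matrix (Fin N) (Fin N) ℝ) : Matrix (Fin N) (Fin N) ℝ →ₗ[ℝ] ℝ where
  toFun G := (G * H).trace / N
  map_add' G G' := by rw [add_mul, Matrix.trace_add, add_div]
  map_smul' r G := by
    rw [smul_mul_assoc, Matrix.trace_smul, RingHom.id_apply, smul_eq_mul, smul_eq_mul,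
      mul_div_assoc]

theorem norm_one_le (N : ℕ) : ‖(1 : Matrix (Fin N) (Fin N) ℝ)‖ ≤ 1 :=
  norm_le_of_mulVec zero_le_one fun x => by simp

theorem norm_trLin_le {N : ℕ} (hN : 0 < N) {H : Matrix (Fin N) (Fin N) ℝ} {C : ℝ} (hH : ‖H‖ ≤ C)
    (G : Matrix (Fin N) (Fin N) ℝ) : ‖trLin H G‖ ≤ C * ‖G‖ := by
  have hN' : (0 : ℝ) < N := by exact_mod_cast hN
  have : trLin H G = (G * H).trace / N := rfl
  rw [this, Real.norm_eq_abs, abs_div, abs_of_pos hN', div_le_iff₀ hN']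
  refine (abs_trace_le _).trans ?_
  rw [Fintype.card_fin, mul_comm]
  refine mul_le_mul_of_nonneg_right ((norm_mul_le _ _).trans ?_) hN'.le
  rw [mul_comm]
  gcongr

/-- Off the exceptional event |u|² ≤ N + tr Σ ≤ (1 + C)N; the centering trace contributes another C.
-/
theorem norm_qfLin_le [IsProbabilityMeasure μ] {n : ℕ} {c C : ℝ} (hb : Bounds M n c C) {ω : Ω}
    (hω : ¬ 1 < M.qf n 1 ω / M.N n) (G : Matrix (Fin (M.N n)) (Fin (M.N n)) ℝ) :
    ‖M.qfLin n ω G‖ ≤ (1 + 2 * C) * ‖G‖ := by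
  have hN' : (0 : ℝ) < M.N n := by exact_mod_cast hb.pos
  have hS := hb.norm _ M.true_mem
  have h1 : M.qf n 1 ω ≤ M.N n := by rwa [not_lt, div_le_one hN'] at hω
  have htr : (M.S n).trace ≤ M.N n * C := by
    refine (le_abs_self _).trans ((abs_trace_le _).trans ?_)
    rw [Fintype.card_fin]
    exact mul_le_mul_of_nonneg_left hS hN'.le
  rw [qf, Matrix.one_mulVec, Matrix.one_mul] at h1
  have : M.qfLin n ω G = M.qf n G ω / M.N n := rfl
  rw [this, Real.norm_eq_abs, abs_div, abs_of_pos hN', div_le_iff₀ hN']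
  refine (abs_qf_le M G ω).trans ?_
  have : M.dev n ω ⬝ᵥ M.dev n ω + M.N n * ‖M.S n‖ ≤ (1 + 2 * C) * M.N n := by
    have := mul_le_mul_of_nonneg_left hS hN'.le
    rw [← S] at this
    linarith
  calc _ ≤ (1 + 2 * C) * M.N n * ‖G‖ := by gcongr
    _ = _ := by ring

/-- The normalized matrix `tr (G_a Σ_(b)) / N`. -/
def normA (M : Model k p μ) (n : ℕ) (G : Fin k → Matrix (Fin (M.N n)) (Fin (M.N n)) ℝ) :
    Matrix (Fin k) (Fin k) ℝ := Matrix.of fun a b => (G a * M.D n b).trace / M.N n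

/-- The normalized matrix `2 tr (G_a Σ G_b Σ) / N`. -/
def normB (M : Model k p μ) (n : ℕ) (G : Fin k → Matrix (Fin (M.N n)) (Fin (M.N n)) ℝ) :
    Matrix (Fin k) (Fin k) ℝ :=
  Matrix.of fun a b => 2 * (G a * M.S n * G b * M.S n).trace / M.N n

/-- The normalized covariances `2 tr (G_ab Σ G_c Σ) / N`. -/
def normP (M : Model k p μ) (n : ℕ) (G1 : Fin k → Fin k → Matrix (Fin (M.N n)) (Fin (M.N n)) ℝ)
    (G : Fin k → Matrix (Fin (M.N n)) (Fin (M.N n)) ℝ) (a b c : Fin k) : ℝ :=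
  2 * (G1 a b * M.S n * G c * M.S n).trace / M.N n

/-- The normalized derivatives `tr (G_ac Σ_(b)) / N`. -/
def normR (M : Model k p μ) (n : ℕ) (G1 : Fin k → Fin k → Matrix (Fin (M.N n)) (Fin (M.N n)) ℝ)
    (a b c : Fin k) : ℝ := (G1 a c * M.D n b).trace / M.N n

/-- Passing from W_a to G_a changes the traces by O(1), whereas coercivity grows like N. For large
N, as quantified by `hN`, half of the constant survives. -/
theorem coercive_normA {L : LinEst M} {W : Weights M}
    {W1 : ∀ n, Fin k → Fin k → Matrix (Fin (M.N n)) (Fin (M.N n)) ℝ} {n : ℕ} {c c' C CL Cw : ℝ}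
    (hb : Bounds M n c C) (hl : Leverage M L n CL) (hCL : 0 ≤ CL) (ho : IsOpen M.Ψ)
    (hcv : Convex ℝ M.Ψ) (hL : M.Unbiased L) (hw : WeightBounds M W W1 n c' Cw) (hc' : 0 ≤ c')
    (hN : k * (k * (2 * (CL ^ 2 * (Cw * (1 + CL))) * C)) ≤ c' / 2 * M.N n) :
    Coercive M.Ψ (c' / 2) (fun a b ψ => (M.eeMat L W n a ψ * M.D n b).trace / M.N n) := by
  intro ψ hψ t
  have hN' : (0 : ℝ) < M.N n := by exact_mod_cast hb.pos
  set E : ℝ := 2 * (CL ^ 2 * (Cw * (1 + CL))) * C with hE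
  have h1 := hw.coercive ψ hψ t
  have h2 : ∀ a, |dir t (fun b => ((M.eeMat L W n a ψ - W n a ψ) * M.D n b).trace)|
      ≤ k * E * ‖t‖ := fun a => abs_dir_le fun b => by
    refine (nuc_eeMat_sub hl hCL ho hcv hL hw a hψ _).trans ?_
    have hCw := (hw.jet a).nonneg M.true_mem
    have := hb.norm_D b
    rw [hE]
    gcongr
  have h3 : |∑ a, t a * dir t (fun b => ((M.eeMat L W n a ψ - W n a ψ) * M.D n b).trace)|
      ≤ k * (k * E) * ‖t‖ ^ 2 := by
    refine (Finset.abs_sum_le_sum_abs _ _).trans ?_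
    calc _ ≤ ∑ _a : Fin k, ‖t‖ * (k * E * ‖t‖) := Finset.sum_le_sum fun a _ => by
          rw [abs_mul]
          exact mul_le_mul (norm_le_pi_norm t a) (h2 a) (abs_nonneg _) (norm_nonneg _)
      _ = _ := by simp; ring
  have e : ∑ a, t a * dir t (fun b => (M.eeMat L W n a ψ * M.D n b).trace / M.N n)
      = (∑ a, t a * dir t (fun b => (W n a ψ * M.D n b).trace)
        + ∑ a, t a * dir t (fun b => ((M.eeMat L W n a ψ - W n a ψ) * M.D n b).trace))
          / M.N n := by
    rw [← Finset.sum_add_distrib, Finset.sum_div]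
    refine Finset.sum_congr rfl fun a _ => ?_
    rw [← mul_add, mul_div_assoc]
    congr 1
    simp only [dir, smul_eq_mul]
    rw [← Finset.sum_add_distrib, Finset.sum_div]
    refine Finset.sum_congr rfl fun b _ => ?_
    rw [sub_mul, Matrix.trace_sub]
    ring
  rw [e, le_div_iff₀ hN']
  have h4 := neg_le_of_abs_le h3
  have h5 := mul_le_mul_of_nonneg_right hN (sq_nonneg ‖t‖)
  have h6 := mul_le_mul_of_nonneg_left (norm_sq_le_dotProduct t) (mul_nonneg hc' hN'.le)
  nlinarith

/-- `mean_cov_of_isRoot` with τ = N^{-1/2}. The jets of f and α are images of the jet of G_a under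
two linear functionals, the centered quadratic form and the trace against Σ_(b), both divided by N.
-/
theorem exists_mean_cov_le [IsProbabilityMeasure μ] (hreg : M.Regular) (hlin : M.SigLinear)
    (he : M.Ke = 0) (hv : M.Kv = 0) {L : LinEst M} (hL : M.Unbiased L) {W : Weights M}
    (hlev : ∃ C : ℝ, 0 ≤ C ∧ ∀ᶠ n in atTop, Leverage M L n C)
    {W1 : ∀ n, Fin k → Fin k → Matrix (Fin (M.N n)) (Fin (M.N n)) ℝ}
    (hw : ∃ c C : ℝ, 0 < c ∧ ∀ᶠ n in atTop, WeightBounds M W W1 n c C)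
    {ψhat : ∀ _ : ℕ, Ω → Fin k → ℝ} (hest : M.IsEstimator L W ψhat) :
    ∃ K : ℝ, ∀ᶠ n in atTop,
      (∀ a, |∫ ω, (ψhat n ω a - M.ψ₀ a) ∂μ
        - meanTerm (M.normA n fun a => M.eeMat L W n a M.ψ₀)⁻¹
          (M.normB n fun a => M.eeMat L W n a M.ψ₀)
          (M.normP n (M.eeMat1 L W W1 n) fun a => M.eeMat L W n a M.ψ₀)
          (M.normR n (M.eeMat1 L W W1 n)) a / M.N n| ≤ K * (M.N n : ℝ) ^ (-(3 / 2) : ℝ)) ∧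
      ∀ a b, |cov[fun ω => ψhat n ω a, fun ω => ψhat n ω b; μ]
        - ((M.normA n fun a => M.eeMat L W n a M.ψ₀)⁻¹ * (M.normB n fun a => M.eeMat L W n a M.ψ₀)
          * (M.normA n fun a => M.eeMat L W n a M.ψ₀)⁻¹ᵀ) a b / M.N n|
          ≤ K * (M.N n : ℝ) ^ (-(3 / 2) : ℝ) := by
  obtain ⟨c, C, hc, hC1, hbd⟩ := exists_bounds hreg hlin
  obtain ⟨CL, hCL, hlev⟩ := hlev
  obtain ⟨c', Cw, hc', hw⟩ := hw
  obtain ⟨Kξ, hξ⟩ := stdIndep_xi hreg he hv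
  have hC0 : 0 ≤ C := zero_le_one.trans hC1
  set G₀ : ℝ := (k + 2) ^ 2 * ((k + 2) ^ 2 * ((1 + CL) * |Cw|) * (1 + CL)) with hG₀
  have hG₀0 : 0 ≤ G₀ := by positivity
  set C' : ℝ := (1 + 2 * C) * G₀ with hC'
  have hC'0 : 0 ≤ C' := by positivity
  -- The bound G₀ + 1 covers the equation matrices and their coefficients, of norm at most G₀, as
  -- well as the identity, whose quadratic form defines the exceptional event.
  set K : ℝ := (320 * (|Kξ| + 2) * (G₀ + 1) ^ 2 * C ^ 2) ^ 2 with hK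
  obtain ⟨K', hmain⟩ := mean_cov_of_isRoot (μ := μ) hreg.isOpen hreg.bounded M.true_mem hC'0
    (half_pos hc') (K := K) (by positivity)
  refine ⟨K', ?_⟩
  filter_upwards [hbd, hlev, hw,
    (tendsto_natCast_atTop_atTop (R := ℝ)).comp hreg.tendsto_N |>.eventually_ge_atTop
      (k * (k * (2 * (CL ^ 2 * (Cw * (1 + CL))) * C)) / (c' / 2))] with n hb hl hw hN
  have hN' : (0 : ℝ) < M.N n := by exact_mod_cast hb.pos
  have hN1 : (1 : ℝ) ≤ M.N n := by exact_mod_cast hb.pos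
  rw [Function.comp_apply, div_le_iff₀ (half_pos hc'), mul_comm (M.N n : ℝ)] at hN
  have hco := coercive_normA hb hl hCL hreg.isOpen hreg.convex hL hw hc'.le hN
  have hξn : StdIndep (M.xi n) |Kξ| μ := by
    have := hξ n
    exact ⟨this.meas, this.indep, this.memLp, this.mean, this.var, this.fourth,
      fun i => (this.eighth i).trans (le_abs_self _)⟩
  have hjet : ∀ a, Jet M.Ψ M.ψ₀ G₀ (M.eeMat L W n a) (M.eeMat1 L W W1 n a) := fun a =>
    (jet_eeMat hl hCL hreg.isOpen hreg.convex hw a).mono (by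
      rw [hG₀]; gcongr; exact le_abs_self _)
  have hsec : ∀ a, ∃ G2 : Fin k → Fin k → Matrix (Fin (M.N n)) (Fin (M.N n)) ℝ,
      (∀ b c, ‖G2 b c‖ ≤ G₀) ∧ ∀ ψ ∈ M.Ψ, ‖M.eeMat L W n a ψ - M.eeMat L W n a M.ψ₀
        - dir (ψ - M.ψ₀) (M.eeMat1 L W W1 n a) - dir₂ (ψ - M.ψ₀) G2‖ ≤ G₀ * ‖ψ - M.ψ₀‖ ^ 3 :=
    fun a => (hjet a).second
  choose G2 hG2 hG2' using hsec
  set τ : ℝ := (M.N n : ℝ) ^ (-(1 / 2) : ℝ) with hτ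
  have hτ0 : 0 < τ := Real.rpow_pos_of_pos hN' _
  have hτ1 : τ ≤ 1 := Real.rpow_le_one_of_one_le_of_nonpos hN1 (by norm_num)
  have hτ3 : τ ^ 3 = (M.N n : ℝ) ^ (-(3 / 2) : ℝ) := by
    rw [hτ, ← Real.rpow_natCast, ← Real.rpow_mul hN'.le]; norm_num
  have hτ4 : τ ^ 4 = ((M.N n : ℝ) ^ 2)⁻¹ := by
    rw [hτ, ← Real.rpow_natCast, ← Real.rpow_mul hN'.le, ← Real.rpow_natCast,
      ← Real.rpow_neg hN'.le]
    norm_num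
  have hS : ‖M.S n‖ ≤ C := hb.norm _ M.true_mem
  have hqf : ∀ G : Matrix (Fin (M.N n)) (Fin (M.N n)) ℝ, ‖G‖ ≤ G₀ + 1 →
      Measurable (fun ω => M.qf n G ω / M.N n) ∧ MemLp (fun ω => M.qf n G ω / M.N n) 4 μ ∧
        ∫ ω, (M.qf n G ω / M.N n) ^ 4 ∂μ ≤ K * τ ^ 4 := by
    intro G hG
    refine ⟨(measurable_qf M G).div_const _, ?_, ?_⟩
    · simp only [div_eq_mul_inv]
      exact (memLp_qf hξn G).mul_const _
    · simp only [div_pow]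
      rw [integral_div, div_le_iff₀ (by positivity), hτ4]
      refine (integral_qf_fourth_le hξn (abs_nonneg _) G).trans ?_
      calc _ ≤ (320 * (|Kξ| + 2) * (G₀ + 1) ^ 2 * C ^ 2 * M.N n) ^ 2 := by gcongr
        _ = _ := by rw [hK]; field_simp
  have hle : G₀ ≤ G₀ + 1 := by linarith
  have h0 := M.true_mem
  have hsymm : ∀ a, (M.eeMat L W n a M.ψ₀)ᵀ = M.eeMat L W n a M.ψ₀ := fun a => by
    rw [eeMat, Matrix.transpose_mul, Matrix.transpose_mul, Matrix.transpose_transpose, hw.symm,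
      Matrix.mul_assoc]
  have hroot : ∀ ω, ∀ ψ ∈ M.Ψ, (∀ a, M.ee L W n a ψ ω = 0) ↔
      IsRoot M.ψ₀ (fun a ψ => M.qf n (M.eeMat L W n a ψ) ω / M.N n)
        (fun a b ψ => (M.eeMat L W n a ψ * M.D n b).trace / M.N n) ψ := by
    intro ω ψ hψ
    refine forall_congr' fun a => ?_
    rw [ee_eq hreg.isOpen hlin hL W n a hψ ω, sub_eq_zero]
    have : dir (ψ - M.ψ₀) (fun b => (M.eeMat L W n a ψ * M.D n b).trace / M.N n)
        = dir (ψ - M.ψ₀) (fun b => (M.eeMat L W n a ψ * M.D n b).trace) / M.N n := by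
      simp only [dir, smul_eq_mul, Finset.sum_div, mul_div_assoc]
    rw [this]
    exact (div_left_inj' hN'.ne').symm
  have hres := hmain (fun ω a ψ => M.qf n (M.eeMat L W n a ψ) ω / M.N n)
    (fun ω a b => M.qf n (M.eeMat1 L W W1 n a b) ω / M.N n)
    (fun ω a b c => M.qf n (G2 a b c) ω / M.N n)
    (fun a b ψ => (M.eeMat L W n a ψ * M.D n b).trace / M.N n)
    (M.normR n (M.eeMat1 L W W1 n)) (ψhat n) {ω | 1 < M.qf n 1 ω / M.N n} τ hτ0 hτ1 hco
    (fun a b => ((hjet a).map (trLin (M.D n b)) hC0 (norm_trLin_le hb.pos (hb.norm_D b))).mono (by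
      rw [hC']; gcongr; linarith))
    (measurableSet_lt measurable_const (hqf 1 ((norm_one_le _).trans (by linarith))).1)
    (by
      have h1 := hqf 1 ((norm_one_le _).trans (by linarith))
      have := measureReal_lt_le one_pos h1.2.1 h1.2.2
      rwa [one_pow, div_one] at this)
    (fun ω hω a => (hjet a).map (M.qfLin n ω) (by positivity) (norm_qfLin_le hb hω))
    (fun ω hω a ψ hψ => by
      have h1 := (norm_qfLin_le hb hω (M.eeMat L W n a ψ - M.eeMat L W n a M.ψ₀
        - dir (ψ - M.ψ₀) (M.eeMat1 L W W1 n a) - dir₂ (ψ - M.ψ₀) (G2 a))).trans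
        (mul_le_mul_of_nonneg_left (hG2' a ψ hψ) (by positivity))
      rw [← mul_assoc] at h1
      refine le_trans (le_of_eq ?_) h1
      rw [← Real.norm_eq_abs]
      congr 1
      simp only [map_sub, dir, dir₂, map_sum, map_smul]
      rfl)
    (fun ψ hψ a => hqf _ (((hjet a).bound ψ hψ).trans hle))
    (fun a b => hqf _ (((hjet a).bound_one b).trans hle))
    (fun a b c => hqf _ ((hG2 a b c).trans hle))
    (fun a => by rw [integral_div, integral_qf hξn, zero_div])
    (hest.measurable n) (hest.mem n)
    (fun ω hω => by
      obtain ⟨ψ, hψ, hr⟩ := hω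
      exact (hroot ω _ (hest.mem n ω)).1 (hest.solves n ω ⟨ψ, hψ, (hroot ω ψ hψ).2 hr⟩))
  have hmul : ∀ G H : Matrix (Fin (M.N n)) (Fin (M.N n)) ℝ, Hᵀ = H →
      Integrable (fun ω => M.qf n G ω / M.N n * (M.qf n H ω / M.N n)) μ ∧
      ∫ ω, M.qf n G ω / M.N n * (M.qf n H ω / M.N n) ∂μ
        = 2 * (G * M.S n * H * M.S n).trace / M.N n / M.N n := by
    intro G H hH
    have e : ∀ ω, M.qf n G ω / M.N n * (M.qf n H ω / M.N n)
        = M.qf n G ω * M.qf n H ω / M.N n / M.N n := fun ω => by field_simp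
    simp only [e]
    refine ⟨(Integrable.div_const (Integrable.div_const ?_ _) _), ?_⟩
    · exact ((memLp_qf hξn G).mono_exponent (p := 2) (by norm_num)).integrable_mul
        ((memLp_qf hξn H).mono_exponent (p := 2) (by norm_num))
    · rw [integral_div, integral_div, integral_qf_mul hξn G H hH]
  have hB := fun a b => hmul (M.eeMat L W n a M.ψ₀) (M.eeMat L W n b M.ψ₀) (hsymm b)
  have hP := fun a b c => hmul (M.eeMat1 L W W1 n a b) (M.eeMat L W n c M.ψ₀) (hsymm c)
  set β := (M.normA n fun a => M.eeMat L W n a M.ψ₀)⁻¹ with hβ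
  rw [hτ3] at hres
  refine ⟨fun a => ?_, fun a b => ?_⟩
  · have h1 := hres.1 a
    have h2 := integral_quadraticTerm (μ := μ) (β := β)
      (B := (1 / M.N n : ℝ) • M.normB n fun a => M.eeMat L W n a M.ψ₀)
      (P := fun a b c => M.normP n (M.eeMat1 L W W1 n) (fun a => M.eeMat L W n a M.ψ₀) a b c / M.N n)
      (α1 := M.normR n (M.eeMat1 L W W1 n))
      (fun a b => (hB a b).1) (fun a b => (hB a b).2.trans (by simp [normB]; ring))
      (fun a b c => (hP a b c).1) (fun a b c => (hP a b c).2) a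
    -- The mean term is homogeneous of degree one in the pair of second moments (B, P), so the
    -- factor 1/N comes out.
    have h3 : meanTerm β ((1 / M.N n : ℝ) • M.normB n fun a => M.eeMat L W n a M.ψ₀)
        (fun a b c => M.normP n (M.eeMat1 L W W1 n) (fun a => M.eeMat L W n a M.ψ₀) a b c / M.N n)
        (M.normR n (M.eeMat1 L W W1 n)) a = meanTerm β (M.normB n fun a => M.eeMat L W n a M.ψ₀)
        (M.normP n (M.eeMat1 L W W1 n) fun a => M.eeMat L W n a M.ψ₀)
          (M.normR n (M.eeMat1 L W W1 n)) a / M.N n := by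
      simp only [meanTerm, Matrix.mulVec, dotProduct, Finset.sum_div, mul_smul_comm, smul_mul_assoc,
        Matrix.smul_apply, smul_eq_mul]
      refine Finset.sum_congr rfl fun e _ => ?_
      rw [mul_div_assoc, sub_div, Finset.sum_div, Finset.sum_div]
      congr 2
      · refine Finset.sum_congr rfl fun b _ => ?_
        rw [Finset.sum_div]
        exact Finset.sum_congr rfl fun c _ => by ring
      · refine Finset.sum_congr rfl fun b _ => ?_
        rw [Finset.sum_div]
        exact Finset.sum_congr rfl fun c _ => by ring
    rw [h3] at h2
    rw [← h2]
    exact h1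
  · have h1 := hres.2 a b
    have h2 := (integral_leadingTerm_mul (μ := μ) (β := β)
      (B := (1 / M.N n : ℝ) • M.normB n fun a => M.eeMat L W n a M.ψ₀)
      (fun a b => (hB a b).1) (fun a b => (hB a b).2.trans (by simp [normB]; ring)) a b).2
    rw [mul_smul_comm, smul_mul_assoc, Matrix.smul_apply, smul_eq_mul, one_div_mul_eq_div] at h2
    rw [← h2]
    exact h1

end Model

/-! ### Calculus of bounded sequences that agree up to a given rate -/

section Near

/-- `x` is bounded and differs from `y` by `O(r)`. -/
def Near (r x y : ℕ → ℝ) : Prop :=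
  x =O[atTop] (fun _ => (1 : ℝ)) ∧ y =O[atTop] (fun _ => (1 : ℝ)) ∧ (fun n => x n - y n) =O[atTop] r

variable {r x y x' y' : ℕ → ℝ}

theorem Near.sub (h : Near r x y) (h' : Near r x' y') :
    Near r (fun n => x n - x' n) (fun n => y n - y' n) := by
  refine ⟨h.1.sub h'.1, h.2.1.sub h'.2.1, (h.2.2.sub h'.2.2).congr_left fun n => ?_⟩
  ring

theorem Near.mul (h : Near r x y) (h' : Near r x' y') :
    Near r (fun n => x n * x' n) (fun n => y n * y' n) := by
  have e1 := h.1.mul h'.1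
  have e2 := h.2.1.mul h'.2.1
  have e3 := h.2.2.mul h'.1
  have e4 := h.2.1.mul h'.2.2
  simp only [mul_one, one_mul] at e1 e2 e3 e4
  refine ⟨e1, e2, (e3.add e4).congr_left fun n => ?_⟩
  ring

theorem Near.sum {ι : Type*} {s : Finset ι} {x y : ι → ℕ → ℝ} (h : ∀ i ∈ s, Near r (x i) (y i)) :
    Near r (fun n => ∑ i ∈ s, x i n) (fun n => ∑ i ∈ s, y i n) := by
  refine ⟨IsBigO.fun_sum fun i hi => (h i hi).1, IsBigO.fun_sum fun i hi => (h i hi).2.1,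
    (IsBigO.fun_sum fun i hi => (h i hi).2.2).congr_left fun n => ?_⟩
  rw [Finset.sum_sub_distrib]

variable {k : ℕ}

theorem Near.matrix_mul {A B A' B' : ℕ → Matrix (Fin k) (Fin k) ℝ}
    (h : ∀ i j, Near r (fun n => A n i j) (fun n => B n i j))
    (h' : ∀ i j, Near r (fun n => A' n i j) (fun n => B' n i j)) (i j : Fin k) :
    Near r (fun n => (A n * A' n) i j) (fun n => (B n * B' n) i j) := by
  simp only [Matrix.mul_apply]
  exact Near.sum fun l _ => (h i l).mul (h' l j)

/-- A⁻¹ - B⁻¹ = A⁻¹(B - A)B⁻¹, with both inverses bounded through coercivity. -/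
theorem Near.matrix_inv {A B : ℕ → Matrix (Fin k) (Fin k) ℝ}
    (h : ∀ i j, Near r (fun n => A n i j) (fun n => B n i j)) {c : ℝ} (hc : 0 < c)
    (hA : ∀ᶠ n in atTop, ∀ t : Fin k → ℝ, c * ‖t‖ ^ 2 ≤ ∑ a, t a * dir t (A n a))
    (hB : ∀ᶠ n in atTop, ∀ t : Fin k → ℝ, c * ‖t‖ ^ 2 ≤ ∑ a, t a * dir t (B n a)) (i j : Fin k) :
    Near r (fun n => (A n)⁻¹ i j) (fun n => (B n)⁻¹ i j) := by
  have bd : ∀ {A : ℕ → Matrix (Fin k) (Fin k) ℝ},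
      (∀ᶠ n in atTop, ∀ t : Fin k → ℝ, c * ‖t‖ ^ 2 ≤ ∑ a, t a * dir t (A n a)) →
      ∀ i j, (fun n => (A n)⁻¹ i j) =O[atTop] (fun _ => (1 : ℝ)) := fun hA i j => by
    refine IsBigO.of_bound ((k + 1) / c) ?_
    filter_upwards [hA] with n hn
    simpa using abs_inv_le_of_coercive hc hn i j
  refine ⟨bd hA i j, bd hB i j, ?_⟩
  have h1 : (fun n => ∑ a, ∑ b, (A n)⁻¹ i b * -(A n b a - B n b a) * (B n)⁻¹ a j) =O[atTop] r := by
    refine IsBigO.fun_sum fun a _ => IsBigO.fun_sum fun b _ => ?_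
    have := ((bd hA i b).mul (h b a).2.2.neg_left).mul (bd hB a j)
    simpa using this
  refine h1.congr' ?_ EventuallyEq.rfl
  filter_upwards [hA, hB] with n hAn hBn
  have uA := Matrix.nonsing_inv_mul _ (isUnit_det_of_coercive hc hAn)
  have uB := Matrix.mul_nonsing_inv _ (isUnit_det_of_coercive hc hBn)
  have e : (A n)⁻¹ - (B n)⁻¹ = (A n)⁻¹ * (B n - A n) * (B n)⁻¹ := by
    rw [mul_sub, sub_mul, uA, mul_assoc, uB, mul_one, one_mul]
  have e' := congrFun (congrFun e i) j
  rw [Matrix.sub_apply] at e'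
  rw [e', Matrix.mul_apply]
  refine Finset.sum_congr rfl fun a _ => ?_
  rw [Matrix.mul_apply, Finset.sum_mul]
  refine Finset.sum_congr rfl fun b _ => ?_
  rw [Matrix.sub_apply]
  ring

theorem Near.meanTerm {β B β' B' : ℕ → Matrix (Fin k) (Fin k) ℝ}
    {P R P' R' : ℕ → Fin k → Fin k → Fin k → ℝ}
    (hβ : ∀ i j, Near r (fun n => β n i j) (fun n => β' n i j))
    (hB : ∀ i j, Near r (fun n => B n i j) (fun n => B' n i j))
    (hP : ∀ a b c, Near r (fun n => P n a b c) (fun n => P' n a b c))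
    (hR : ∀ a b c, Near r (fun n => R n a b c) (fun n => R' n a b c)) (a : Fin k) :
    Near r (fun n => VarComp.meanTerm (β n) (B n) (P n) (R n) a)
      (fun n => VarComp.meanTerm (β' n) (B' n) (P' n) (R' n) a) := by
  simp only [VarComp.meanTerm, Matrix.mulVec, dotProduct]
  refine Near.sum fun e _ => (hβ a e).mul (Near.sub ?_ ?_)
  · exact Near.sum fun b _ => Near.sum fun c _ => (hβ b c).mul (hP e b c)
  · exact Near.sum fun b _ => Near.sum fun c _ => (Near.matrix_mul (A' := fun n => (β n)ᵀ)
      (B' := fun n => (β' n)ᵀ) (Near.matrix_mul hβ hB) (fun i j => hβ j i) b c).mul (hR e b c)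

end Near

/-! ### Replacing the equation matrices by the weights -/

namespace Model

open scoped Matrix.Norms.L2Operator

variable {k p : ℕ} {Ω : Type*} [MeasurableSpace Ω] {μ : Measure Ω} {M : Model k p μ}

/-- `1 / N` -/
def rate (M : Model k p μ) (n : ℕ) : ℝ := 1 / M.N n

theorem near_of_bounds {x y : ℕ → ℝ} {C₁ C₂ C₃ : ℝ} (h : ∀ᶠ n in atTop, |x n| ≤ C₁ ∧ |y n| ≤ C₂ ∧
    |x n - y n| ≤ C₃ / M.N n) : Near M.rate x y := by
  refine ⟨IsBigO.of_bound C₁ ?_, IsBigO.of_bound C₂ ?_, IsBigO.of_bound C₃ ?_⟩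
  · filter_upwards [h] with n hn
    simpa using hn.1
  · filter_upwards [h] with n hn
    simpa using hn.2.1
  · filter_upwards [h] with n hn
    rw [rate, Real.norm_eq_abs, Real.norm_of_nonneg (by positivity), mul_one_div]
    exact hn.2.2

theorem abs_trace_div_le {N : ℕ} (hN : 0 < N) {G : Matrix (Fin N) (Fin N) ℝ} {C : ℝ}
    (hG : ‖G‖ ≤ C) : |G.trace / N| ≤ C := by
  have h := norm_trLin_le hN (norm_one_le N) G
  have : trLin (1 : Matrix (Fin N) (Fin N) ℝ) G = G.trace / N := by
    change (G * 1).trace / (N : ℝ) = _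
    rw [mul_one]
  rw [this, one_mul] at h
  exact h.trans hG

/-- Replacing a bounded matrix by one which differs from it by a bounded nuclear norm changes the
normalized trace by `O(1 / N)`. -/
theorem near_trace {G G' H : ∀ n, Matrix (Fin (M.N n)) (Fin (M.N n)) ℝ} {C E D : ℝ} (hE : 0 ≤ E)
    (h : ∀ᶠ n in atTop, 0 < M.N n ∧ ‖G n‖ ≤ C ∧ ‖G' n‖ ≤ C ∧ Nuc E (G n - G' n) ∧ ‖H n‖ ≤ D) :
    Near M.rate (fun n => (G n * H n).trace / M.N n) (fun n => (G' n * H n).trace / M.N n) := by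
  refine near_of_bounds (C₁ := C * D) (C₂ := C * D) (C₃ := E * D) ?_
  filter_upwards [h] with n ⟨hN, h1, h2, h3, h4⟩
  have hN' : (0 : ℝ) < M.N n := by exact_mod_cast hN
  refine ⟨abs_trace_div_le hN (norm_mul_le_of_le h1 h4),
    abs_trace_div_le hN (norm_mul_le_of_le h2 h4), ?_⟩
  rw [← sub_div, ← Matrix.trace_sub, ← sub_mul, abs_div, abs_of_pos hN']
  gcongr
  exact (h3 _).trans (by gcongr)

/-- Two-sided version of `near_trace`. -/
theorem near_trace₂ {G G' H H' S : ∀ n, Matrix (Fin (M.N n)) (Fin (M.N n)) ℝ} {C E D : ℝ}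
    (hE : 0 ≤ E)
    (h : ∀ᶠ n in atTop, 0 < M.N n ∧ ‖G n‖ ≤ C ∧ ‖G' n‖ ≤ C ∧ Nuc E (G n - G' n) ∧ ‖H n‖ ≤ C ∧
      ‖H' n‖ ≤ C ∧ Nuc E (H n - H' n) ∧ ‖S n‖ ≤ D) :
    Near M.rate (fun n => 2 * (G n * S n * H n * S n).trace / M.N n)
      (fun n => 2 * (G' n * S n * H' n * S n).trace / M.N n) := by
  -- One factor at a time: G is replaced while H is kept, then H while G' is kept; cyclicity of the
  -- trace joins the two estimates.
  have h1 := near_trace (M := M) (G := G) (G' := G') (H := fun n => S n * H n * S n)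
    (D := D * C * D) hE (by
      filter_upwards [h] with n ⟨a1, a2, a3, a4, a5, a6, a7, a8⟩
      exact ⟨a1, a2, a3, a4, norm_mul_le_of_le (norm_mul_le_of_le a8 a5) a8⟩)
  have h2 := near_trace (M := M) (G := H) (G' := H') (H := fun n => S n * G' n * S n)
    (D := D * C * D) hE (by
      filter_upwards [h] with n ⟨a1, a2, a3, a4, a5, a6, a7, a8⟩
      exact ⟨a1, a5, a6, a7, norm_mul_le_of_le (norm_mul_le_of_le a8 a3) a8⟩)
  have e1 : ∀ n, (H n * (S n * G' n * S n)).trace = (G' n * (S n * H n * S n)).trace := fun n => by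
    rw [← Matrix.mul_assoc, Matrix.trace_mul_comm (G' n), ← Matrix.mul_assoc, Matrix.trace_mul_comm]
    simp only [Matrix.mul_assoc]
  have e2 : ∀ n, (H' n * (S n * G' n * S n)).trace = (G' n * (S n * H' n * S n)).trace := fun n => by
    rw [← Matrix.mul_assoc, Matrix.trace_mul_comm (G' n), ← Matrix.mul_assoc, Matrix.trace_mul_comm]
    simp only [Matrix.mul_assoc]
  simp only [e1, e2] at h2
  have e3 : ∀ n (A B : Matrix (Fin (M.N n)) (Fin (M.N n)) ℝ),
      2 * (A * S n * B * S n).trace / M.N n = 2 * ((A * (S n * B * S n)).trace / M.N n) :=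
    fun n A B => by rw [mul_div_assoc]; simp only [Matrix.mul_assoc]
  simp only [e3]
  refine ⟨h1.1.const_mul_left 2, h2.2.1.const_mul_left 2,
    ((h1.2.2.add h2.2.2).const_mul_left 2).congr_left fun n => ?_⟩
  ring

theorem coercive_weights {W : Weights M}
    {W1 : ∀ n, Fin k → Fin k → Matrix (Fin (M.N n)) (Fin (M.N n)) ℝ} {n : ℕ} {c C : ℝ}
    (hw : WeightBounds M W W1 n c C) (hc : 0 ≤ c) (hN : 0 < M.N n) (t : Fin k → ℝ) :
    c * ‖t‖ ^ 2 ≤ ∑ a, t a * dir t (M.normA n (fun a => W n a M.ψ₀) a) := by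
  have hN' : (0 : ℝ) < M.N n := by exact_mod_cast hN
  have h1 := hw.coercive _ M.true_mem t
  have h2 := mul_le_mul_of_nonneg_left (norm_sq_le_dotProduct t) (mul_nonneg hc hN'.le)
  have e : ∑ a, t a * dir t (M.normA n (fun a => W n a M.ψ₀) a)
      = (∑ a, t a * dir t (fun b => (W n a M.ψ₀ * M.D n b).trace)) / M.N n := by
    simp only [normA, Matrix.of_apply, dir, smul_eq_mul, Finset.sum_div, Finset.mul_sum,
      mul_div_assoc]
  rw [e, le_div_iff₀ hN']
  linarith

theorem rate_sq_isBigO (hreg : M.Regular) :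
    (fun n => M.rate n * M.rate n) =O[atTop] fun n => (M.N n : ℝ) ^ (-(3 / 2) : ℝ) := by
  refine IsBigO.of_bound 1 ?_
  filter_upwards [hreg.tendsto_N.eventually_ge_atTop 1] with n hn
  have hN1 : (1 : ℝ) ≤ M.N n := by exact_mod_cast hn
  have e : M.rate n * M.rate n = (M.N n : ℝ) ^ (-2 : ℝ) := by
    rw [rate, Real.rpow_neg (by positivity), Real.rpow_ofNat]
    field_simp
  rw [e, one_mul, Real.norm_of_nonneg (by positivity), Real.norm_of_nonneg (by positivity)]
  exact Real.rpow_le_rpow_of_exponent_le hN1 (by norm_num)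

/-- Asymptotic covariance and second-order bias of the estimator based on general weights. -/
theorem asympCov_and_bias [IsProbabilityMeasure μ] (hreg : M.Regular) (hlin : M.SigLinear)
    (he : M.Ke = 0) (hv : M.Kv = 0) {L : LinEst M} (hL : M.Unbiased L) {W : Weights M}
    (hord : M.OrderConditions L W)
    {W1 : ∀ n, Fin k → Fin k → Matrix (Fin (M.N n)) (Fin (M.N n)) ℝ}
    (hw : ∃ c C : ℝ, 0 < c ∧ ∀ᶠ n in atTop, WeightBounds M W W1 n c C)
    {ψhat : ∀ _ : ℕ, Ω → Fin k → ℝ} (hest : M.IsEstimator L W ψhat) :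
    (∀ᶠ n in atTop, IsUnit (M.normA n fun a => W n a M.ψ₀).det) ∧
    M.HasAsympCov ψhat (fun n => (1 / M.N n : ℝ) • ((M.normA n fun a => W n a M.ψ₀)⁻¹
      * (M.normB n fun a => W n a M.ψ₀) * (M.normA n fun a => W n a M.ψ₀)⁻¹ᵀ)) ∧
    M.HasSecondOrderBias ψhat (fun n a => meanTerm (M.normA n fun a => W n a M.ψ₀)⁻¹
      (M.normB n fun a => W n a M.ψ₀) (M.normP n (W1 n) fun a => W n a M.ψ₀)
      (M.normR n (W1 n)) a / M.N n) := by
  obtain ⟨K, hK⟩ := exists_mean_cov_le hreg hlin he hv hL hord.leverage' hw hest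
  obtain ⟨c, C, hc, hC1, hbd⟩ := exists_bounds hreg hlin
  obtain ⟨CL, hCL, hlev⟩ := hord.leverage'
  obtain ⟨c', Cw, hc', hw⟩ := hw
  have hC0 : 0 ≤ C := zero_le_one.trans hC1
  set G₀ : ℝ := (k + 2) ^ 2 * ((k + 2) ^ 2 * ((1 + CL) * |Cw|) * (1 + CL)) + |Cw| with hG₀
  have hG₀0 : 0 ≤ G₀ := by positivity
  set E₀ : ℝ := 4 * (CL ^ 2 * (|Cw| * (1 + CL))) with hE₀
  have hE₀0 : 0 ≤ E₀ := by positivity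
  have hGev : ∀ᶠ n in atTop, 0 < M.N n ∧ (∀ a, ‖M.eeMat L W n a M.ψ₀‖ ≤ G₀ ∧
      ‖W n a M.ψ₀‖ ≤ G₀ ∧ Nuc E₀ (M.eeMat L W n a M.ψ₀ - W n a M.ψ₀)) ∧
      (∀ a b, ‖M.eeMat1 L W W1 n a b‖ ≤ G₀ ∧
      ‖W1 n a b‖ ≤ G₀ ∧ Nuc E₀ (M.eeMat1 L W W1 n a b - W1 n a b)) ∧ (∀ a, ‖M.D n a‖ ≤ C) ∧
      ‖M.S n‖ ≤ C := by
    filter_upwards [hbd, hlev, hw] with n hb hl hw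
    have hj := jet_eeMat hl hCL hreg.isOpen hreg.convex hw
    have h1 : (k + 2) ^ 2 * ((k + 2) ^ 2 * ((1 + CL) * Cw) * (1 + CL)) ≤ G₀ := by
      have : ((k : ℝ) + 2) ^ 2 * ((k + 2) ^ 2 * ((1 + CL) * Cw) * (1 + CL))
          ≤ (k + 2) ^ 2 * ((k + 2) ^ 2 * ((1 + CL) * |Cw|) * (1 + CL)) := by
        gcongr; exact le_abs_self _
      have := abs_nonneg Cw
      linarith
    have h2 : Cw ≤ G₀ := (le_abs_self Cw).trans (by
      rw [hG₀]; refine le_add_of_nonneg_left (by positivity))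
    have h3 : CL ^ 2 * (Cw * (1 + CL)) ≤ CL ^ 2 * (|Cw| * (1 + CL)) := by
      gcongr; exact le_abs_self _
    have h4 : 0 ≤ CL ^ 2 * (|Cw| * (1 + CL)) := by positivity
    exact ⟨hb.pos, fun a => ⟨((hj a).bound _ M.true_mem).trans h1,
        ((hw.jet a).bound _ M.true_mem).trans h2,
        (nuc_eeMat_sub hl hCL hreg.isOpen hreg.convex hL hw a M.true_mem).mono (by linarith)⟩,
      fun a b => ⟨((hj a).bound_one b).trans h1, ((hw.jet a).bound_one b).trans h2,
        (nuc_eeMat1_sub hl hCL hreg.isOpen hreg.convex hL hw a b).mono (by linarith)⟩,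
      hb.norm_D, hb.norm _ M.true_mem⟩
  have nA : ∀ a b, Near M.rate (fun n => M.normA n (fun a => M.eeMat L W n a M.ψ₀) a b)
      (fun n => M.normA n (fun a => W n a M.ψ₀) a b) := fun a b =>
    near_trace hE₀0 (by
      filter_upwards [hGev] with n ⟨h1, h2, h3, h4, h5⟩
      exact ⟨h1, (h2 a).1, (h2 a).2.1, (h2 a).2.2, h4 b⟩)
  have nB : ∀ a b, Near M.rate (fun n => M.normB n (fun a => M.eeMat L W n a M.ψ₀) a b)
      (fun n => M.normB n (fun a => W n a M.ψ₀) a b) := fun a b =>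
    near_trace₂ (S := M.S) hE₀0 (by
      filter_upwards [hGev] with n ⟨h1, h2, h3, h4, h5⟩
      exact ⟨h1, (h2 a).1, (h2 a).2.1, (h2 a).2.2, (h2 b).1, (h2 b).2.1, (h2 b).2.2, h5⟩)
  have nP : ∀ a b c, Near M.rate
      (fun n => M.normP n (M.eeMat1 L W W1 n) (fun a => M.eeMat L W n a M.ψ₀) a b c)
      (fun n => M.normP n (W1 n) (fun a => W n a M.ψ₀) a b c) := fun a b c =>
    near_trace₂ (S := M.S) hE₀0 (by
      filter_upwards [hGev] with n ⟨h1, h2, h3, h4, h5⟩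
      exact ⟨h1, (h3 a b).1, (h3 a b).2.1, (h3 a b).2.2, (h2 c).1, (h2 c).2.1, (h2 c).2.2, h5⟩)
  have nR : ∀ a b c, Near M.rate (fun n => M.normR n (M.eeMat1 L W W1 n) a b c)
      (fun n => M.normR n (W1 n) a b c) := fun a b c =>
    near_trace hE₀0 (by
      filter_upwards [hGev] with n ⟨h1, h2, h3, h4, h5⟩
      exact ⟨h1, (h3 a c).1, (h3 a c).2.1, (h3 a c).2.2, h4 b⟩)
  -- The coercivity constant is halved here too, because `Near.matrix_inv` asks for a common
  -- constant for both matrices.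
  have cW : ∀ᶠ n in atTop, ∀ t : Fin k → ℝ,
      c' / 2 * ‖t‖ ^ 2 ≤ ∑ a, t a * dir t (M.normA n (fun a => W n a M.ψ₀) a) := by
    filter_upwards [hw, hbd] with n hw hb t
    refine le_trans ?_ (coercive_weights hw hc'.le hb.pos t)
    have := sq_nonneg ‖t‖
    nlinarith
  have cG : ∀ᶠ n in atTop, ∀ t : Fin k → ℝ,
      c' / 2 * ‖t‖ ^ 2 ≤ ∑ a, t a * dir t (M.normA n (fun a => M.eeMat L W n a M.ψ₀) a) := by
    filter_upwards [hbd, hlev, hw,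
      (tendsto_natCast_atTop_atTop (R := ℝ)).comp hreg.tendsto_N |>.eventually_ge_atTop
        (k * (k * (2 * (CL ^ 2 * (Cw * (1 + CL))) * C)) / (c' / 2))] with n hb hl hw hN t
    rw [Function.comp_apply, div_le_iff₀ (half_pos hc'), mul_comm (M.N n : ℝ)] at hN
    exact coercive_normA hb hl hCL hreg.isOpen hreg.convex hL hw hc'.le hN _ M.true_mem t
  have nI := Near.matrix_inv nA (half_pos hc') cG cW
  refine ⟨?_, fun a b => ?_, fun a => ?_⟩
  · filter_upwards [cW] with n hn
    exact isUnit_det_of_coercive (half_pos hc') hn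
  · have h1 := (Near.matrix_mul (A' := fun n => ((M.normA n fun a => M.eeMat L W n a M.ψ₀)⁻¹)ᵀ)
      (B' := fun n => ((M.normA n fun a => W n a M.ψ₀)⁻¹)ᵀ) (Near.matrix_mul nI nB)
      (fun i j => nI j i) a b).2.2
    -- The normalized quantities differ by O(1/N) and carry a further factor 1/N, so the replacement
    -- costs O(N⁻²), which is within O(N^{-3/2}).
    have h2 := ((isBigO_refl M.rate atTop).mul h1).trans (rate_sq_isBigO hreg)
    have h3 : (fun n => cov[fun ω => ψhat n ω a, fun ω => ψhat n ω b; μ]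
        - ((M.normA n fun a => M.eeMat L W n a M.ψ₀)⁻¹
          * (M.normB n fun a => M.eeMat L W n a M.ψ₀)
          * (M.normA n fun a => M.eeMat L W n a M.ψ₀)⁻¹ᵀ) a b / M.N n)
        =O[atTop] fun n => (M.N n : ℝ) ^ (-(3 / 2) : ℝ) := by
      refine IsBigO.of_bound K ?_
      filter_upwards [hK] with n hn
      rw [Real.norm_eq_abs, Real.norm_of_nonneg (by positivity)]
      exact hn.2 a b
    refine (h3.add h2).congr_left fun n => ?_
    simp only [Matrix.smul_apply, rate, smul_eq_mul]
    ring
  · have h1 := (Near.meanTerm nI nB nP nR a).2.2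
    have h2 := ((isBigO_refl M.rate atTop).mul h1).trans (rate_sq_isBigO hreg)
    have h3 : (fun n => (∫ ω, (ψhat n ω a - M.ψ₀ a) ∂μ)
        - meanTerm (M.normA n fun a => M.eeMat L W n a M.ψ₀)⁻¹
          (M.normB n fun a => M.eeMat L W n a M.ψ₀)
          (M.normP n (M.eeMat1 L W W1 n) fun a => M.eeMat L W n a M.ψ₀)
          (M.normR n (M.eeMat1 L W W1 n)) a / M.N n)
        =O[atTop] fun n => (M.N n : ℝ) ^ (-(3 / 2) : ℝ) := by
      refine IsBigO.of_bound K ?_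
      filter_upwards [hK] with n hn
      rw [Real.norm_eq_abs, Real.norm_of_nonneg (by positivity)]
      exact hn.1 a
    refine (h3.add h2).congr_left fun n => ?_
    rw [rate]
    ring

end Model

theorem Jet.congr {k : ℕ} {F : Type*} [NormedAddCommGroup F] [NormedSpace ℝ F]
    {Ψ : Set (Fin k → ℝ)} {ψ₀ : Fin k → ℝ} {C : ℝ} {G H : (Fin k → ℝ) → F} {G1 H1 : Fin k → F}
    (h : Jet Ψ ψ₀ C G G1) (h0 : ψ₀ ∈ Ψ) (hG : ∀ ψ ∈ Ψ, H ψ = G ψ) (hG1 : ∀ b, H1 b = G1 b) :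
    Jet Ψ ψ₀ C H H1 := by
  obtain rfl : H1 = G1 := funext hG1
  refine ⟨fun ψ hψ => ?_, fun ψ hψ ψ' hψ' => ?_, h.bound_one, fun ψ hψ ψ' hψ' => ?_, ?_⟩
  · rw [hG ψ hψ]; exact h.bound ψ hψ
  · rw [hG ψ hψ, hG ψ' hψ']; exact h.lip ψ hψ ψ' hψ'
  · rw [hG ψ hψ, hG ψ' hψ']; exact h.strict ψ hψ ψ' hψ'
  · obtain ⟨G2, h1, h2⟩ := h.second
    exact ⟨G2, h1, fun ψ hψ => by rw [hG ψ hψ, hG _ h0]; exact h2 ψ hψ⟩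

/-! ### Reversing products of symmetric matrices under the trace -/

section Traces

variable {n : Type*} [Fintype n]

theorem trace_mul_rev_three {A B C : Matrix n n ℝ} (hA : Aᵀ = A) (hB : Bᵀ = B) (hC : Cᵀ = C) :
    (A * B * C).trace = (C * B * A).trace := by
  rw [← Matrix.trace_transpose, Matrix.transpose_mul, Matrix.transpose_mul, hA, hB, hC,
    Matrix.mul_assoc]

theorem trace_mul_rev_four {A B C D : Matrix n n ℝ} (hA : Aᵀ = A) (hB : Bᵀ = B) (hC : Cᵀ = C)
    (hD : Dᵀ = D) : (A * B * C * D).trace = (D * C * B * A).trace := by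
  rw [← Matrix.trace_transpose]
  simp only [Matrix.transpose_mul, hA, hB, hC, hD, Matrix.mul_assoc]

theorem trace_mul_rev_five {A B C D E : Matrix n n ℝ} (hA : Aᵀ = A) (hB : Bᵀ = B) (hC : Cᵀ = C)
    (hD : Dᵀ = D) (hE : Eᵀ = E) : (A * B * C * D * E).trace = (E * D * C * B * A).trace := by
  rw [← Matrix.trace_transpose]
  simp only [Matrix.transpose_mul, hA, hB, hC, hD, hE, Matrix.mul_assoc]

theorem trace_mul_rev_six {A B C D E F : Matrix n n ℝ} (hA : Aᵀ = A) (hB : Bᵀ = B) (hC : Cᵀ = C)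
    (hD : Dᵀ = D) (hE : Eᵀ = E) (hF : Fᵀ = F) :
    (A * B * C * D * E * F).trace = (F * E * D * C * B * A).trace := by
  rw [← Matrix.trace_transpose]
  simp only [Matrix.transpose_mul, hA, hB, hC, hD, hE, hF, Matrix.mul_assoc]

end Traces

/-! ### The general covariance and bias formulas, and coercivity for the three weights -/

namespace Model

open scoped Matrix.Norms.L2Operator

variable {k p : ℕ} {Ω : Type*} [MeasurableSpace Ω] {μ : Measure Ω} {M : Model k p μ}

/-- Asymptotic covariance and second-order bias of the estimator based on general weights `W`,
whose partial derivatives at the true parameter are `W1`. -/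
theorem estimator_asymptotics [IsProbabilityMeasure μ] (hreg : M.Regular) (hlin : M.SigLinear)
    (he : M.Ke = 0) (hv : M.Kv = 0) {L : LinEst M} (hL : M.Unbiased L) {W : Weights M}
    (hord : M.OrderConditions L W)
    {W1 : ∀ n, Fin k → Fin k → Matrix (Fin (M.N n)) (Fin (M.N n)) ℝ}
    (hw : ∃ c C : ℝ, 0 < c ∧ ∀ᶠ n in atTop, WeightBounds M W W1 n c C)
    {ψhat : ∀ _ : ℕ, Ω → Fin k → ℝ} (hest : M.IsEstimator L W ψhat)
    {A B : ℕ → Matrix (Fin k) (Fin k) ℝ} {K H : ℕ → Fin k → Matrix (Fin k) (Fin k) ℝ}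
    (hAt : ∀ᶠ n in atTop, (A n)ᵀ = A n) (hBt : ∀ᶠ n in atTop, (B n)ᵀ = B n)
    (hA : ∀ᶠ n in atTop, ∀ a b, (W n a M.ψ₀ * M.D n b).trace = A n a b)
    (hB : ∀ᶠ n in atTop, ∀ a b, (W n a M.ψ₀ * M.S n * W n b M.ψ₀ * M.S n).trace = B n a b)
    (hK : ∀ᶠ n in atTop, ∀ a b c, (W1 n a b * M.S n * W n c M.ψ₀ * M.S n).trace = K n a c b)
    (hH : ∀ᶠ n in atTop, ∀ a b c, (W1 n a c * M.D n b).trace = H n a b c) :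
    (∀ᶠ n in atTop, IsUnit (A n).det) ∧
    M.HasAsympCov ψhat (fun n => (2 : ℝ) • ((A n)⁻¹ * B n * (A n)⁻¹)) ∧
    M.HasSecondOrderBias ψhat (fun n => (2 : ℝ) • ((A n)⁻¹ *ᵥ fun a =>
      (K n a * (A n)⁻¹ - H n a * (A n)⁻¹ * B n * (A n)⁻¹).trace)) := by
  obtain ⟨hU, hC, hM⟩ := asympCov_and_bias hreg hlin he hv hL hord hw hest
  have hN := hreg.tendsto_N.eventually_ge_atTop 1
  have key : ∀ᶠ n in atTop, IsUnit (A n).det ∧ (A n)⁻¹ᵀ = (A n)⁻¹ ∧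
      (M.normA n fun a => W n a M.ψ₀)⁻¹ = (M.N n : ℝ) • (A n)⁻¹ ∧
      (M.normB n fun a => W n a M.ψ₀) = (2 / M.N n : ℝ) • B n := by
    filter_upwards [hU, hA, hB, hN, hAt] with n hU hA hB hN hAt
    have hN' : (0 : ℝ) < M.N n := by exact_mod_cast hN
    have eA : (M.normA n fun a => W n a M.ψ₀) = (1 / M.N n : ℝ) • A n := by
      ext a b
      simp only [normA, Matrix.of_apply, Matrix.smul_apply, smul_eq_mul, hA]
      ring
    have hu : IsUnit (A n).det := by
      rw [eA, Matrix.det_smul] at hU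
      exact isUnit_of_mul_isUnit_right hU
    refine ⟨hu, by rw [Matrix.transpose_nonsing_inv, hAt], ?_, ?_⟩
    · rw [eA]
      refine Matrix.inv_eq_left_inv ?_
      rw [smul_mul_smul_comm, Matrix.nonsing_inv_mul _ hu, mul_one_div_cancel hN'.ne', one_smul]
    · ext a b
      simp only [normB, Matrix.of_apply, Matrix.smul_apply, smul_eq_mul, ← hB]
      ring
  have eV : ∀ {n : ℕ}, 1 ≤ M.N n → ∀ X Y : Matrix (Fin k) (Fin k) ℝ,
      (M.N n : ℝ) • X * (2 / M.N n : ℝ) • Y * (M.N n : ℝ) • X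
        = (M.N n : ℝ) • (2 : ℝ) • (X * Y * X) := fun hN X Y => by
    rename_i n
    have hN' : (0 : ℝ) < M.N n := by exact_mod_cast hN
    simp only [smul_mul_assoc, mul_smul_comm, smul_smul]
    congr 1
    field_simp
  refine ⟨key.mono fun n hn => hn.1, fun a b => ?_, fun a => ?_⟩
  · refine (hC a b).congr' ?_ EventuallyEq.rfl
    filter_upwards [key, hN] with n ⟨hu, ht, h1, h2⟩ hN
    have hN' : (0 : ℝ) < M.N n := by exact_mod_cast hN
    rw [h1, h2, Matrix.transpose_smul, ht, eV hN, smul_smul, one_div_mul_cancel hN'.ne', one_smul]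
  · refine (hM a).congr' ?_ EventuallyEq.rfl
    filter_upwards [key, hN, hK, hH, hBt] with n ⟨hu, ht, h1, h2⟩ hN hK hH hBt
    have hN' : (0 : ℝ) < M.N n := by exact_mod_cast hN
    congr 1
    set β := (A n)⁻¹ with hβ
    set V := β * B n * β with hV
    have hVt : Vᵀ = V := by
      rw [hV, Matrix.transpose_mul, Matrix.transpose_mul, ht, hBt, Matrix.mul_assoc]
    rw [h1, h2, meanTerm, Matrix.transpose_smul, ht, eV hN, ← hV]
    simp only [Pi.smul_apply, Matrix.mulVec, dotProduct, Matrix.smul_apply, smul_eq_mul,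
      Finset.sum_div, Finset.mul_sum]
    refine Finset.sum_congr rfl fun e _ => ?_
    -- The last two indices of K are interchanged relative to the derivative of the weights, so this
    -- double sum is a trace without further transposition.
    have t1 : ∑ b, ∑ c, M.N n * β b c * M.normP n (W1 n) (fun a => W n a M.ψ₀) e b c
        = 2 * (K n e * β).trace := by
      rw [Matrix.trace, Finset.sum_comm, Finset.mul_sum]
      refine Finset.sum_congr rfl fun c _ => ?_
      rw [Matrix.diag_apply, Matrix.mul_apply, Finset.mul_sum]
      refine Finset.sum_congr rfl fun b _ => ?_
      rw [normP, hK]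
      field_simp
    -- Here the trace form needs the symmetry of V = A⁻¹BA⁻¹.
    have t2 : ∑ b, ∑ c, M.N n * (2 * V b c) * M.normR n (W1 n) e b c
        = 2 * (H n e * V).trace := by
      rw [Matrix.trace, Finset.mul_sum]
      refine Finset.sum_congr rfl fun b _ => ?_
      rw [Matrix.diag_apply, Matrix.mul_apply, Finset.mul_sum]
      refine Finset.sum_congr rfl fun c _ => ?_
      have : V c b = V b c := congrFun (congrFun hVt b) c
      rw [normR, hH, this]
      field_simp
    rw [t1, t2, Matrix.trace_sub, hV]
    simp only [Matrix.mul_assoc]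
    field_simp

theorem S_inv_transpose (n : ℕ) {ψ : Fin k → ℝ} (hψ : ψ ∈ M.Ψ) :
    ((M.Sig n ψ)⁻¹)ᵀ = (M.Sig n ψ)⁻¹ := by
  rw [Matrix.transpose_nonsing_inv, Sig_transpose n hψ]

theorem Sig_posDef (n : ℕ) {ψ : Fin k → ℝ} (hψ : ψ ∈ M.Ψ) : (M.Sig n ψ).PosDef := by
  have h := (M.Rv_posDef n ψ hψ).posSemidef.mul_mul_conjTranspose_same (M.Z n)
  rw [Matrix.conjTranspose_eq_transpose_of_trivial] at h
  exact (M.Re_posDef n ψ hψ).add_posSemidef h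

theorem isUnit_det_Sig (n : ℕ) {ψ : Fin k → ℝ} (hψ : ψ ∈ M.Ψ) : IsUnit (M.Sig n ψ).det :=
  (Sig_posDef n hψ).det_pos.ne'.isUnit

theorem inv_mul_Sig (n : ℕ) {ψ : Fin k → ℝ} (hψ : ψ ∈ M.Ψ) : (M.Sig n ψ)⁻¹ * M.Sig n ψ = 1 :=
  Matrix.nonsing_inv_mul _ (isUnit_det_Sig n hψ)

theorem Sig_mul_inv (n : ℕ) {ψ : Fin k → ℝ} (hψ : ψ ∈ M.Ψ) : M.Sig n ψ * (M.Sig n ψ)⁻¹ = 1 :=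
  Matrix.mul_nonsing_inv _ (isUnit_det_Sig n hψ)

theorem dir_D_transpose (ho : IsOpen M.Ψ) (hlin : M.SigLinear) (n : ℕ) (t : Fin k → ℝ) :
    (dir t (M.D n))ᵀ = dir t (M.D n) := by
  rw [dir, Matrix.transpose_sum]
  exact Finset.sum_congr rfl fun a _ => by rw [Matrix.transpose_smul, D_transpose ho hlin]

theorem sum_dir_trace {n : ℕ} (t : Fin k → ℝ) (P Q : Matrix (Fin (M.N n)) (Fin (M.N n)) ℝ) :
    ∑ a, t a * dir t (fun b => (P * M.D n a * Q * M.D n b).trace)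
      = (P * dir t (M.D n) * Q * dir t (M.D n)).trace := by
  simp only [dir, Finset.mul_sum, Finset.sum_mul, Matrix.trace_sum, Matrix.mul_smul,
    Matrix.smul_mul, Matrix.trace_smul, smul_eq_mul]
  rw [Finset.sum_comm]
  exact Finset.sum_congr rfl fun a _ => Finset.sum_congr rfl fun b _ => by ring

section Comparison

variable {n : ℕ} {c C : ℝ}

theorem Bounds.trace_sq_ge (hb : Bounds M n c C) (t : Fin k → ℝ) :
    c * M.N n * (t ⬝ᵥ t) ≤ (dir t (M.D n) * dir t (M.D n)).trace := by
  refine (hb.ident t).trans (le_of_eq ?_)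
  have := sum_dir_trace (M := M) (n := n) t 1 1
  simp only [one_mul, mul_one] at this
  rw [← this]
  refine Finset.sum_congr rfl fun a _ => ?_
  simp only [dir, smul_eq_mul, Finset.mul_sum]
  exact Finset.sum_congr rfl fun b _ => by ring

/-- The inequality x·x ≤ C x·Σ(ψ)⁻¹x, applied to the columns of ∑ t_a Σ_(a), reduces the claim to
the identifiability condition. -/
theorem Bounds.trace_inv_sq_ge (hb : Bounds M n c C) (hc : 0 < c) (ho : IsOpen M.Ψ)
    (hlin : M.SigLinear) {ψ : Fin k → ℝ} (hψ : ψ ∈ M.Ψ) (t : Fin k → ℝ) :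
    c * M.N n * (t ⬝ᵥ t)
      ≤ C * (dir t (M.D n) * (M.Sig n ψ)⁻¹ * dir t (M.D n)).trace := by
  have h := trace_transpose_mul_le (hb.dotProduct_le_inv hc hψ) (dir t (M.D n))
  rw [dir_D_transpose ho hlin] at h
  exact (hb.trace_sq_ge t).trans h

/-- The second inverse is inserted by writing Σ(ψ)⁻¹ = R² with R symmetric and applying the same
comparison to the columns of (∑ t_a Σ_(a))R. -/
theorem Bounds.trace_inv_inv_ge (hb : Bounds M n c C) (hc : 0 < c) (hC : 0 ≤ C) (ho : IsOpen M.Ψ)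
    (hlin : M.SigLinear) {ψ : Fin k → ℝ} (hψ : ψ ∈ M.Ψ) (t : Fin k → ℝ) :
    c * M.N n * (t ⬝ᵥ t)
      ≤ C * (C * ((M.Sig n ψ)⁻¹ * dir t (M.D n) * (M.Sig n ψ)⁻¹ * dir t (M.D n)).trace) := by
  set T := (M.Sig n ψ)⁻¹ with hT
  set R := CFC.sqrt T
  have hRR : R * R = T := sqrt_mul_sqrt (Sig_posDef n hψ).inv
  have hRt : Rᵀ = R := transpose_sqrt
  have h := trace_transpose_mul_le (hb.dotProduct_le_inv hc hψ) (dir t (M.D n) * R)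
  rw [← hT, Matrix.transpose_mul, hRt, dir_D_transpose ho hlin] at h
  have e1 : (R * dir t (M.D n) * (dir t (M.D n) * R)).trace
      = (dir t (M.D n) * T * dir t (M.D n)).trace := by
    rw [← Matrix.mul_assoc, Matrix.trace_mul_comm _ R]
    simp only [← Matrix.mul_assoc]
    rw [hRR, Matrix.trace_mul_comm, ← Matrix.mul_assoc]
  have e2 : (R * dir t (M.D n) * T * (dir t (M.D n) * R)).trace
      = (T * dir t (M.D n) * T * dir t (M.D n)).trace := by
    rw [← Matrix.mul_assoc, Matrix.trace_mul_comm _ R]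
    simp only [← Matrix.mul_assoc]
    rw [hRR]
  rw [e1, e2] at h
  exact (hb.trace_inv_sq_ge hc ho hlin hψ t).trans (mul_le_mul_of_nonneg_left h hC)

end Comparison

end Model

/-! ### The REML, FH and PR weights -/

namespace Model

open scoped Matrix.Norms.L2Operator

variable {k p : ℕ} {Ω : Type*} [MeasurableSpace Ω] {μ : Measure Ω} {M : Model k p μ}

/-- The partial derivatives of the REML weights at the true parameter. -/
def WRE1 (M : Model k p μ) (n : ℕ) (a b : Fin k) : Matrix (Fin (M.N n)) (Fin (M.N n)) ℝ :=
  -((M.S n)⁻¹ * M.D n b * (M.S n)⁻¹) * M.D n a * (M.S n)⁻¹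
    + (M.S n)⁻¹ * M.D n a * -((M.S n)⁻¹ * M.D n b * (M.S n)⁻¹)

/-- The partial derivatives of the FH weights at the true parameter. -/
def WFH1 (M : Model k p μ) (n : ℕ) (a b : Fin k) : Matrix (Fin (M.N n)) (Fin (M.N n)) ℝ :=
  (1 / 2 : ℝ) • (-((M.S n)⁻¹ * M.D n b * (M.S n)⁻¹) * M.D n a
    + M.D n a * -((M.S n)⁻¹ * M.D n b * (M.S n)⁻¹))

theorem weightBounds_WRE (hreg : M.Regular) (hlin : M.SigLinear) :
    ∃ c C : ℝ, 0 < c ∧ ∀ᶠ n in atTop, WeightBounds M M.WRE M.WRE1 n c C := by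
  obtain ⟨c, C, hc, hC1, hbd⟩ := exists_bounds hreg hlin
  have hC : 0 < C := zero_lt_one.trans_le hC1
  refine ⟨c / (C * C), (k + 2) ^ 2 * ((k + 2) ^ 2 * ((k + 1) ^ 3 * (C + 1) ^ 7 * C)
    * ((k + 1) ^ 3 * (C + 1) ^ 7)), by positivity, hbd.mono fun n hb => ⟨fun a => ?_, fun a => ?_, ?_⟩⟩
  · have h1 := S_inv_transpose (M := M) n M.true_mem
    have h2 : (M.dSig n a M.ψ₀)ᵀ = M.dSig n a M.ψ₀ := D_transpose hreg.isOpen hlin n a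
    simp only [WRE, Matrix.transpose_mul, h1, h2, Matrix.mul_assoc]
  · have hT := hb.jet_inv hc hreg.isOpen hlin
    have hD := (Jet.const (Ψ := M.Ψ) (ψ₀ := M.ψ₀) (M.D n a)).mono (hb.norm_D a)
    refine ((hT.mul hD M.true_mem).mul hT M.true_mem).congr M.true_mem (fun ψ hψ => ?_) fun b => ?_
    · rw [WRE, dSig_eq hreg.isOpen hlin n a hψ]
    · rw [WRE1, mul_zero, add_zero, S]
  · intro ψ hψ t
    have h := hb.trace_inv_inv_ge hc hC.le hreg.isOpen hlin hψ t
    rw [← sum_dir_trace] at h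
    rw [div_mul_eq_mul_div, div_mul_eq_mul_div, div_le_iff₀ (by positivity)]
    refine h.trans (le_of_eq ?_)
    simp only [WRE, dSig_eq hreg.isOpen hlin n _ hψ]
    ring

theorem weightBounds_WFH (hreg : M.Regular) (hlin : M.SigLinear) :
    ∃ c C : ℝ, 0 < c ∧ ∀ᶠ n in atTop, WeightBounds M M.WFH M.WFH1 n c C := by
  obtain ⟨c, C, hc, hC1, hbd⟩ := exists_bounds hreg hlin
  have hC : 0 < C := zero_lt_one.trans_le hC1
  refine ⟨c / C, 1 / 2 * ((k + 2) ^ 2 * ((k + 1) ^ 3 * (C + 1) ^ 7 * C)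
    + (k + 2) ^ 2 * (C * ((k + 1) ^ 3 * (C + 1) ^ 7))), by positivity, hbd.mono fun n hb => ⟨fun a => ?_, fun a => ?_, ?_⟩⟩
  · have h1 := S_inv_transpose (M := M) n M.true_mem
    have h2 : (M.dSig n a M.ψ₀)ᵀ = M.dSig n a M.ψ₀ := D_transpose hreg.isOpen hlin n a
    simp only [WFH, Matrix.transpose_smul, Matrix.transpose_add, Matrix.transpose_mul, h1, h2,
      add_comm]
  · have hT := hb.jet_inv hc hreg.isOpen hlin
    have hD := (Jet.const (Ψ := M.Ψ) (ψ₀ := M.ψ₀) (M.D n a)).mono (hb.norm_D a)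
    refine (((hT.mul hD M.true_mem).add (hD.mul hT M.true_mem)).map
      ((1 / 2 : ℝ) • LinearMap.id) (c := 1 / 2) (by norm_num) fun x => ?_).congr M.true_mem
      (fun ψ hψ => ?_) fun b => ?_
    · simp [norm_smul]
    · rw [WFH, dSig_eq hreg.isOpen hlin n a hψ]
      rfl
    · rw [WFH1, mul_zero, add_zero, zero_mul, zero_add, S]
      rfl
  · intro ψ hψ t
    have h := hb.trace_inv_sq_ge hc hreg.isOpen hlin hψ t
    have e1 := sum_dir_trace (M := M) (n := n) t (M.Sig n ψ)⁻¹ 1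
    have e2 := sum_dir_trace (M := M) (n := n) t 1 (M.Sig n ψ)⁻¹
    simp only [one_mul, mul_one] at e1 e2
    rw [div_mul_eq_mul_div, div_mul_eq_mul_div, div_le_iff₀ (by positivity)]
    refine h.trans (le_of_eq ?_)
    rw [mul_comm C]
    congr 1
    have e3 : ((M.Sig n ψ)⁻¹ * dir t (M.D n) * dir t (M.D n)).trace
        = (dir t (M.D n) * (M.Sig n ψ)⁻¹ * dir t (M.D n)).trace := by
      rw [Matrix.trace_mul_comm, ← Matrix.mul_assoc]
    have e4 : ∑ a, t a * dir t (fun b => (M.WFH n a ψ * M.D n b).trace)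
        = 1 / 2 * (∑ a, t a * dir t (fun b => ((M.Sig n ψ)⁻¹ * M.D n a * M.D n b).trace)
          + ∑ a, t a * dir t (fun b => (M.D n a * (M.Sig n ψ)⁻¹ * M.D n b).trace)) := by
      rw [← Finset.sum_add_distrib, Finset.mul_sum]
      refine Finset.sum_congr rfl fun a _ => ?_
      rw [← mul_add, mul_left_comm]
      congr 1
      simp only [dir, smul_eq_mul]
      rw [← Finset.sum_add_distrib, Finset.mul_sum]
      refine Finset.sum_congr rfl fun b _ => ?_
      rw [WFH, dSig_eq hreg.isOpen hlin n _ hψ, Matrix.smul_mul, Matrix.trace_smul, Matrix.add_mul,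
        Matrix.trace_add, smul_eq_mul]
      ring
    rw [e4, e1, e2, e3]
    ring

theorem weightBounds_WQ (hreg : M.Regular) (hlin : M.SigLinear) :
    ∃ c C : ℝ, 0 < c ∧ ∀ᶠ n in atTop, WeightBounds M M.WQ (fun _ _ _ => 0) n c C := by
  obtain ⟨c, C, hc, hC1, hbd⟩ := exists_bounds hreg hlin
  refine ⟨c, C, hc, hbd.mono fun n hb => ⟨fun a => D_transpose hreg.isOpen hlin n a,
    fun a => ?_, ?_⟩⟩
  · exact ((Jet.const (Ψ := M.Ψ) (ψ₀ := M.ψ₀) (M.D n a)).mono (hb.norm_D a)).congr M.true_mem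
      (fun ψ hψ => dSig_eq hreg.isOpen hlin n a hψ) fun b => rfl
  · intro ψ hψ t
    have e := sum_dir_trace (M := M) (n := n) t 1 1
    simp only [one_mul, mul_one] at e
    simp only [WQ, dSig_eq hreg.isOpen hlin n _ hψ]
    rw [e]
    exact hb.trace_sq_ge t

section Formulas

variable [IsProbabilityMeasure μ] {L : LinEst M} {ψhat : ∀ _ : ℕ, Ω → Fin k → ℝ}

/-- For these weights XΣW_bΣ = XΣ_(b) for every X. Hence B = A and K = H, the covariance 2A⁻¹BA⁻¹
collapses to 2A⁻¹, and KA⁻¹ - HA⁻¹BA⁻¹ vanishes identically. -/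
theorem asymptotics_WRE (hreg : M.Regular) (hlin : M.SigLinear) (he : M.Ke = 0) (hv : M.Kv = 0)
    (hL : M.Unbiased L) (hord : M.OrderConditions L M.WRE) (hest : M.IsEstimator L M.WRE ψhat) :
    (∀ᶠ n in atTop, IsUnit (M.ARE n).det) ∧ M.SecondOrderUnbiased ψhat ∧
      M.HasAsympCov ψhat (fun n => (2 : ℝ) • (M.ARE n)⁻¹) := by
  have hTS : ∀ n, (M.S n)⁻¹ * M.S n = 1 := fun n => inv_mul_Sig n M.true_mem
  have hAt : ∀ n, (M.ARE n)ᵀ = M.ARE n := fun n => by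
    ext i j
    simp only [ARE, Matrix.transpose_apply, Matrix.of_apply]
    rw [Matrix.mul_assoc, Matrix.trace_mul_comm, ← Matrix.mul_assoc]
  have e1 : ∀ n (b : Fin k) (X : Matrix (Fin (M.N n)) (Fin (M.N n)) ℝ),
      X * M.S n * M.WRE n b M.ψ₀ * M.S n = X * M.D n b := fun n b X => by
    have h := hTS n
    have h' : M.S n * (M.S n)⁻¹ = 1 := Sig_mul_inv n M.true_mem
    change X * M.S n * ((M.S n)⁻¹ * M.D n b * (M.S n)⁻¹) * M.S n = _
    calc _ = X * (M.S n * (M.S n)⁻¹) * M.D n b * ((M.S n)⁻¹ * M.S n) := by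
          simp only [Matrix.mul_assoc]
      _ = _ := by rw [h, h', Matrix.mul_one, Matrix.mul_one]
  obtain ⟨hU, hC, hM⟩ := estimator_asymptotics hreg hlin he hv hL hord
    (weightBounds_WRE hreg hlin) hest (A := M.ARE) (B := M.ARE)
    (K := fun n a => Matrix.of fun b c => (M.WRE1 n a c * M.D n b).trace)
    (H := fun n a => Matrix.of fun b c => (M.WRE1 n a c * M.D n b).trace)
    (.of_forall hAt) (.of_forall hAt) (.of_forall fun n a b => rfl)
    (.of_forall fun n a b => by rw [e1]; rfl)
    (.of_forall fun n a b c => by rw [e1]; rfl) (.of_forall fun n a b c => rfl)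
  refine ⟨hU, fun a => (hM a).congr' ?_ EventuallyEq.rfl, fun a b =>
    (hC a b).congr' ?_ EventuallyEq.rfl⟩
  · filter_upwards [hU] with n hn
    have : ∀ Y : Matrix (Fin k) (Fin k) ℝ, Y * (M.ARE n)⁻¹ * M.ARE n * (M.ARE n)⁻¹
        = Y * (M.ARE n)⁻¹ := fun Y => by
      rw [Matrix.mul_assoc Y, Matrix.nonsing_inv_mul _ hn, Matrix.mul_one]
    simp only [this, sub_self, Matrix.trace_zero]
    rw [show (fun _ : Fin k => (0 : ℝ)) = 0 from rfl, Matrix.mulVec_zero, smul_zero, Pi.zero_apply,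
      sub_zero]
  · filter_upwards [hU] with n hn
    rw [Matrix.nonsing_inv_mul _ hn, Matrix.one_mul]

theorem S_transpose (n : ℕ) : (M.S n)ᵀ = M.S n := Sig_transpose n M.true_mem

theorem inv_S_transpose (n : ℕ) : ((M.S n)⁻¹)ᵀ = (M.S n)⁻¹ := S_inv_transpose n M.true_mem

theorem AFH_transpose (ho : IsOpen M.Ψ) (hlin : M.SigLinear) (n : ℕ) : (M.AFH n)ᵀ = M.AFH n := by
  ext i j
  simp only [AFH, Matrix.transpose_apply, Matrix.of_apply]
  rw [trace_mul_rev_three (inv_S_transpose n) (D_transpose ho hlin n j)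
    (D_transpose ho hlin n i), Matrix.trace_mul_comm, Matrix.mul_assoc]

theorem BFH_transpose (ho : IsOpen M.Ψ) (hlin : M.SigLinear) (n : ℕ) : (M.BFH n)ᵀ = M.BFH n := by
  ext i j
  simp only [BFH, Matrix.transpose_apply, Matrix.of_apply]
  rw [trace_mul_rev_four (inv_S_transpose n) (D_transpose ho hlin n j)
    (S_transpose n) (D_transpose ho hlin n i), Matrix.trace_mul_comm _ (M.S n)⁻¹,
    Matrix.trace_mul_comm (M.D n j)]
  simp only [Matrix.mul_assoc]

/-- After the general formula only trace identities are left: XΣW_aΣ = (XΣ_(a)Σ + XΣΣ_(a))/2, and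
the words in Σ, Σ⁻¹ and Σ_(a) are matched by cyclicity and by reversal of products of symmetric
matrices. -/
theorem asymptotics_WFH (hreg : M.Regular) (hlin : M.SigLinear) (he : M.Ke = 0) (hv : M.Kv = 0)
    (hL : M.Unbiased L) (hord : M.OrderConditions L M.WFH) (hest : M.IsEstimator L M.WFH ψhat) :
    (∀ᶠ n in atTop, IsUnit (M.AFH n).det) ∧
      M.HasAsympCov ψhat (fun n => (2 : ℝ) • ((M.AFH n)⁻¹ * M.BFH n * (M.AFH n)⁻¹)) ∧
      M.HasSecondOrderBias ψhat M.biasFH := by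
  have ho := hreg.isOpen
  have hT : ∀ n, ((M.S n)⁻¹)ᵀ = (M.S n)⁻¹ := fun n => S_inv_transpose n M.true_mem
  have hS : ∀ n, (M.S n)ᵀ = M.S n := fun n => Sig_transpose n M.true_mem
  have hD := D_transpose ho hlin
  have hTS : ∀ n, (M.S n)⁻¹ * M.S n = 1 := fun n => inv_mul_Sig n M.true_mem
  have hST : ∀ n, M.S n * (M.S n)⁻¹ = 1 := fun n => Sig_mul_inv n M.true_mem
  have eW : ∀ n a, M.WFH n a M.ψ₀
      = (1 / 2 : ℝ) • ((M.S n)⁻¹ * M.D n a + M.D n a * (M.S n)⁻¹) := fun n a => rfl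
  have eS : ∀ n a (X : Matrix (Fin (M.N n)) (Fin (M.N n)) ℝ),
      X * M.S n * M.WFH n a M.ψ₀ * M.S n
        = (1 / 2 : ℝ) • (X * M.D n a * M.S n + X * M.S n * M.D n a) := fun n a X => by
    rw [eW, Matrix.mul_smul, Matrix.smul_mul]
    congr 1
    calc X * M.S n * ((M.S n)⁻¹ * M.D n a + M.D n a * (M.S n)⁻¹) * M.S n
        = X * (M.S n * (M.S n)⁻¹) * M.D n a * M.S n
          + X * M.S n * M.D n a * ((M.S n)⁻¹ * M.S n) := by noncomm_ring
      _ = _ := by rw [hTS, hST, Matrix.mul_one, Matrix.mul_one]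
  refine estimator_asymptotics hreg hlin he hv hL hord (weightBounds_WFH hreg hlin) hest
    (.of_forall (AFH_transpose ho hlin)) (.of_forall (BFH_transpose ho hlin))
    (K := M.KFH) (H := M.HFH)
    (.of_forall fun n a b => ?_) (.of_forall fun n a b => ?_) (.of_forall fun n a b c => ?_)
    (.of_forall fun n a b c => ?_)
  · have h1 : (M.D n a * (M.S n)⁻¹ * M.D n b).trace = ((M.S n)⁻¹ * M.D n a * M.D n b).trace := by
      rw [trace_mul_rev_three (hD n a) (hT n) (hD n b)]
      rw [Matrix.mul_assoc, Matrix.trace_mul_comm]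
    rw [eW, Matrix.smul_mul, Matrix.trace_smul, Matrix.add_mul, Matrix.trace_add, h1, smul_eq_mul,
      AFH, Matrix.of_apply]
    ring
  · have u1 : ((M.S n)⁻¹ * M.D n a * M.D n b * M.S n).trace = (M.D n a * M.D n b).trace := by
      rw [Matrix.trace_mul_comm, ← Matrix.mul_assoc, ← Matrix.mul_assoc, hST, Matrix.one_mul]
    have u2 : (M.D n a * (M.S n)⁻¹ * M.D n b * M.S n).trace
        = ((M.S n)⁻¹ * M.D n a * M.S n * M.D n b).trace := by
      rw [trace_mul_rev_four (hD n a) (hT n) (hD n b) (hS n), Matrix.mul_assoc,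
        Matrix.trace_mul_comm, ← Matrix.mul_assoc]
    have u3 : (M.D n a * (M.S n)⁻¹ * M.S n * M.D n b).trace = (M.D n a * M.D n b).trace := by
      rw [Matrix.mul_assoc (M.D n a), hTS, Matrix.mul_one]
    rw [eS, eW]
    simp only [Matrix.smul_mul, Matrix.add_mul, Matrix.trace_add, Matrix.trace_smul, smul_eq_mul,
      BFH, Matrix.of_apply, u1, u2, u3]
    ring
  · have u1 : ((M.S n)⁻¹ * M.D n b * (M.S n)⁻¹ * M.D n a * M.D n c * M.S n).trace
        = (M.D n a * M.D n c * M.D n b * (M.S n)⁻¹).trace := by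
      rw [Matrix.trace_mul_comm]
      simp only [← Matrix.mul_assoc]
      rw [hST, Matrix.one_mul, Matrix.mul_assoc, Matrix.trace_mul_comm, ← Matrix.mul_assoc]
    have u2 : ((M.S n)⁻¹ * M.D n b * (M.S n)⁻¹ * M.D n a * M.S n * M.D n c).trace
        = (M.D n a * M.S n * M.D n c * (M.S n)⁻¹ * M.D n b * (M.S n)⁻¹).trace := by
      rw [Matrix.mul_assoc, Matrix.mul_assoc, Matrix.trace_mul_comm]
      simp only [← Matrix.mul_assoc]
    have u3 : (M.D n a * (M.S n)⁻¹ * M.D n b * (M.S n)⁻¹ * M.D n c * M.S n).trace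
        = (M.D n a * M.S n * M.D n c * (M.S n)⁻¹ * M.D n b * (M.S n)⁻¹).trace := by
      rw [trace_mul_rev_six (hD n a) (hT n) (hD n b) (hT n) (hD n c) (hS n),
        Matrix.trace_mul_comm]
      simp only [← Matrix.mul_assoc]
    have u4 : (M.D n a * (M.S n)⁻¹ * M.D n b * (M.S n)⁻¹ * M.S n * M.D n c).trace
        = (M.D n a * M.D n c * M.D n b * (M.S n)⁻¹).trace := by
      rw [Matrix.mul_assoc _ _ (M.S n), hTS, Matrix.mul_one,
        trace_mul_rev_four (hD n a) (hT n) (hD n b) (hD n c), Matrix.trace_mul_comm]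
      simp only [← Matrix.mul_assoc]
    rw [eS, WFH1]
    simp only [← Matrix.mul_assoc, Matrix.neg_mul, Matrix.mul_neg, Matrix.smul_mul, Matrix.add_mul,
      Matrix.mul_add, Matrix.trace_add, Matrix.trace_neg, Matrix.trace_smul, smul_eq_mul, KFH,
      Matrix.of_apply, u1, u2, u3, u4]
    ring
  · have u1 : ((M.S n)⁻¹ * M.D n c * (M.S n)⁻¹ * M.D n a * M.D n b).trace
        = (M.D n a * M.D n b * (M.S n)⁻¹ * M.D n c * (M.S n)⁻¹).trace := by
      rw [Matrix.mul_assoc, Matrix.trace_mul_comm]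
      simp only [← Matrix.mul_assoc]
    have u2 : (M.D n a * (M.S n)⁻¹ * M.D n c * (M.S n)⁻¹ * M.D n b).trace
        = (M.D n a * M.D n b * (M.S n)⁻¹ * M.D n c * (M.S n)⁻¹).trace := by
      rw [trace_mul_rev_five (hD n a) (hT n) (hD n c) (hT n) (hD n b), Matrix.trace_mul_comm]
      simp only [← Matrix.mul_assoc]
    rw [WFH1]
    simp only [← Matrix.mul_assoc, Matrix.neg_mul, Matrix.mul_neg, Matrix.smul_mul, Matrix.add_mul,
      Matrix.trace_add, Matrix.trace_neg, Matrix.trace_smul, smul_eq_mul, HFH, Matrix.of_apply,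
      u1, u2]
    ring

/-- Σ is affine, so the weights Σ_(a) do not depend on ψ; their derivatives vanish, and with them K
and H. -/
theorem asymptotics_WQ (hreg : M.Regular) (hlin : M.SigLinear) (he : M.Ke = 0) (hv : M.Kv = 0)
    (hL : M.Unbiased L) (hord : M.OrderConditions L M.WQ) (hest : M.IsEstimator L M.WQ ψhat) :
    (∀ᶠ n in atTop, IsUnit (M.AQ n).det) ∧ M.SecondOrderUnbiased ψhat ∧
      M.HasAsympCov ψhat (fun n => (2 : ℝ) • ((M.AQ n)⁻¹ * M.BQ n * (M.AQ n)⁻¹)) := by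
  obtain ⟨hU, hC, hM⟩ := estimator_asymptotics hreg hlin he hv hL hord
    (weightBounds_WQ hreg hlin) hest (A := M.AQ) (B := M.BQ) (K := fun _ _ => 0)
    (H := fun _ _ => 0)
    (.of_forall fun n => by
      ext i j
      simp only [AQ, Matrix.transpose_apply, Matrix.of_apply]
      rw [Matrix.trace_mul_comm])
    (.of_forall fun n => by
      ext i j
      simp only [BQ, Matrix.transpose_apply, Matrix.of_apply]
      rw [Matrix.mul_assoc, Matrix.trace_mul_comm, ← Matrix.mul_assoc])
    (.of_forall fun n a b => rfl) (.of_forall fun n a b => rfl)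
    (.of_forall fun n a b c => by simp) (.of_forall fun n a b c => by simp)
  refine ⟨hU, fun a => (hM a).congr_left fun n => ?_, hC⟩
  simp only [Matrix.zero_mul, sub_self, Matrix.trace_zero]
  rw [show (fun _ : Fin k => (0 : ℝ)) = 0 from rfl, Matrix.mulVec_zero, smul_zero, Pi.zero_apply,
    sub_zero]

end Formulas

end Model

/-! ### A model in which the FH-type estimator is biased -/

namespace TwoGroups

/-- Six equally likely values with the first four moments of the standard normal distribution. -/
def value : Fin 6 → ℝ := ![√3, -√3, 0, 0, 0, 0]

/-- The law of a sequence of independent variables, uniformly distributed on six points. -/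
def law : Measure (ℕ → Fin 6) :=
  Measure.infinitePi fun _ => (PMF.uniformOfFintype (Fin 6)).toMeasure

instance : IsProbabilityMeasure law := by unfold law; infer_instance

/-- The standardized errors. -/
def noise (i : ℕ) (ω : ℕ → Fin 6) : ℝ := value (ω i)

theorem measurable_noise (i : ℕ) : Measurable (noise i) :=
  (measurable_of_countable value).comp (measurable_pi_apply i)

theorem integral_comp_noise (g : ℝ → ℝ) (i : ℕ) :
    ∫ ω, g (noise i ω) ∂law = (g √3 + g (-√3) + 4 * g 0) / 6 := by
  have h := measurePreserving_eval_infinitePi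
    (fun _ : ℕ => (PMF.uniformOfFintype (Fin 6)).toMeasure) i
  have h1 := h.map_eq
  have h2 : ∫ ω, g (noise i ω) ∂law
      = ∫ x, g (value x) ∂(PMF.uniformOfFintype (Fin 6)).toMeasure := by
    rw [← h1, integral_map h.measurable.aemeasurable
      (measurable_of_countable fun x => g (value x)).aestronglyMeasurable]
    rfl
  rw [h2, PMF.integral_eq_sum]
  simp [Fin.sum_univ_succ, value]
  ring

theorem abs_noise_le (i : ℕ) (ω : ℕ → Fin 6) : ‖noise i ω‖ ≤ √3 := by
  have : ∀ x : Fin 6, ‖value x‖ ≤ √3 := fun x => by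
    fin_cases x <;> simp [value, abs_of_nonneg (Real.sqrt_nonneg 3)]
  exact this _

theorem memLp_noise (i : ℕ) (q : ENNReal) : MemLp (noise i) q law :=
  MemLp.of_bound (measurable_noise i).aestronglyMeasurable √3 (ae_of_all _ (abs_noise_le i))

theorem iIndepFun_noise : iIndepFun noise law :=
  iIndepFun_infinitePi (P := fun _ : ℕ => (PMF.uniformOfFintype (Fin 6)).toMeasure)
    (X := fun _ => value) fun _ => measurable_of_countable value

theorem integral_noise (i : ℕ) : ∫ ω, noise i ω ∂law = 0 := by
  rw [integral_comp_noise (fun x => x) i]; ring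

theorem integral_noise_sq (i : ℕ) : ∫ ω, noise i ω * noise i ω ∂law = 1 := by
  rw [integral_comp_noise (fun x => x * x) i]
  have : √3 * √3 = (3 : ℝ) := Real.mul_self_sqrt (by norm_num)
  linarith

theorem integral_noise_fourth (i : ℕ) : ∫ ω, noise i ω ^ 4 ∂law = 3 := by
  rw [integral_comp_noise (fun x => x ^ 4) i]
  have : √3 ^ 4 = (9 : ℝ) := by
    rw [show 4 = 2 * 2 by norm_num, pow_mul, Real.sq_sqrt (by norm_num)]; norm_num
  rw [neg_pow, this]
  norm_num

theorem integral_noise_eighth_le (i : ℕ) : ∫ ω, noise i ω ^ 8 ∂law ≤ √3 ^ 8 := by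
  rw [integral_comp_noise (fun x => x ^ 8) i]
  have : 0 ≤ √3 ^ 8 := by positivity
  rw [(by decide : Even 8).neg_pow]
  linarith

theorem integral_noise_mul (i j : ℕ) : ∫ ω, noise i ω * noise j ω ∂law = if i = j then 1 else 0 := by
  split_ifs with h
  · subst h; exact integral_noise_sq i
  · rw [(iIndepFun_noise.indepFun h).integral_fun_mul_eq_mul_integral
      (measurable_noise i).aestronglyMeasurable (measurable_noise j).aestronglyMeasurable,
      integral_noise, zero_mul]

/-- The number of observations. -/
abbrev size (n : ℕ) : ℕ := (n + 1) + (n + 1)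

/-- The indicator of the second group. -/
def ind (n : ℕ) (i : Fin (size n)) : ℝ := if i.val < n + 1 then 0 else 1

theorem ind_cases (n : ℕ) (i : Fin (size n)) : ind n i = 0 ∨ ind n i = 1 := by
  unfold ind; split_ifs <;> simp

theorem sum_ind (n : ℕ) (g : ℝ → ℝ) : ∑ i, g (ind n i) = (n + 1) * (g 0 + g 1) := by
  have h : ∀ x : Fin (n + 1), ind n (Fin.natAdd (n + 1) x) = 1 := fun x => by
    rw [ind, Fin.val_natAdd, if_neg (by omega)]
  have h' : ∀ x : Fin (n + 1), ind n (Fin.castAdd (n + 1) x) = 0 := fun x => by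
    simp only [ind, Fin.val_castAdd, x.isLt, if_true]
  rw [Fin.sum_univ_add]
  simp only [h, h', Finset.sum_const, Finset.card_univ, Fintype.card_fin, nsmul_eq_mul]
  push_cast
  ring

/-- The variances of the observations. -/
def var (n : ℕ) (ψ : Fin 1 → ℝ) (i : Fin (size n)) : ℝ := 1 + ind n i + ψ 0

theorem abs_lt_of_mem {ψ : Fin 1 → ℝ} (hψ : ψ ∈ Metric.ball (0 : Fin 1 → ℝ) (1 / 2)) :
    |ψ 0| < 1 / 2 := by
  rw [mem_ball_zero_iff] at hψ
  exact (norm_le_pi_norm ψ 0).trans_lt hψ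

theorem var_bounds {n : ℕ} {ψ : Fin 1 → ℝ} (hψ : ψ ∈ Metric.ball (0 : Fin 1 → ℝ) (1 / 2))
    (i : Fin (size n)) : 1 / 2 < var n ψ i ∧ var n ψ i < 3 := by
  have := abs_lt.1 (abs_lt_of_mem hψ)
  unfold var
  rcases ind_cases n i with h | h <;> rw [h] <;> constructor <;> linarith

theorem var_pos {n : ℕ} {ψ : Fin 1 → ℝ} (hψ : ψ ∈ Metric.ball (0 : Fin 1 → ℝ) (1 / 2))
    (i : Fin (size n)) : 0 < var n ψ i := by linarith [(var_bounds hψ i).1]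

theorem zero_mem : (0 : Fin 1 → ℝ) ∈ Metric.ball (0 : Fin 1 → ℝ) (1 / 2) :=
  Metric.mem_ball_self (by norm_num)

theorem sqrt_diagonal {d : ℕ} {x : Fin d → ℝ} (hx : ∀ i, 0 ≤ x i) :
    CFC.sqrt (Matrix.diagonal x) = Matrix.diagonal fun i => √(x i) := by
  refine CFC.sqrt_unique ?_ ?_
  · rw [Matrix.diagonal_mul_diagonal]
    congr 1
    exact funext fun i => Real.mul_self_sqrt (hx i)
  · exact Matrix.nonneg_iff_posSemidef.2 (Matrix.PosSemidef.diagonal fun i => Real.sqrt_nonneg _)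

theorem whiten_diagonal {d : ℕ} {x : Fin d → ℝ} (hx : ∀ i, 0 < x i) (z : Fin d → ℝ) :
    whiten (Matrix.diagonal x) (fun i => √(x i) * z i) = z := by
  have h : (fun i => √(x i) * z i) = CFC.sqrt (Matrix.diagonal x) *ᵥ z := by
    rw [sqrt_diagonal fun i => (hx i).le]
    exact funext fun i => (Matrix.mulVec_diagonal (fun i => √(x i)) z i).symm
  have hu : IsUnit (CFC.sqrt (Matrix.diagonal x)).det :=
    isUnit_det_sqrt (Matrix.PosDef.diagonal hx)
  rw [whiten, h, Matrix.mulVec_mulVec, Matrix.nonsing_inv_mul _ hu, Matrix.one_mulVec]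

/-- The errors. -/
def err (n : ℕ) (ω : ℕ → Fin 6) (i : Fin (size n)) : ℝ := √(var n 0 i) * noise i ω

theorem whiten_err (n : ℕ) (ω : ℕ → Fin 6) :
    whiten (Matrix.diagonal (var n 0)) (err n ω) = fun i : Fin (size n) => noise i ω :=
  whiten_diagonal (fun i => var_pos zero_mem i) _

/-- The design matrix. -/
def design (n : ℕ) : Matrix (Fin (size n)) (Fin 1) ℝ := Matrix.of fun i _ => ind n i

/-- A model with two groups of observations for which the FH-type estimator is biased. -/
abbrev model : Model 1 1 law where
  N := size
  m _ := 0
  X := design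
  Z _ := 0
  Re n ψ := Matrix.diagonal (var n ψ)
  Rv _ _ := 1
  Ψ := Metric.ball 0 (1 / 2)
  ψ₀ := 0
  β := 0
  Ke := 0
  Kv := 0
  ε := err
  v _ _ := 0
  true_mem := zero_mem
  Re_posDef n ψ hψ := Matrix.PosDef.diagonal fun i => var_pos hψ i
  Rv_posDef _ _ _ := Matrix.PosDef.one
  measurable_ε n := measurable_pi_lambda _ fun i => (measurable_noise i).const_mul _
  measurable_v _ := measurable_const
  memLp_ε n i := (memLp_noise i 4).const_mul _
  memLp_v _ i := i.elim0
  indep n := indepFun_const_left _ _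
  mean_ε n i := by simp only [err]; rw [integral_const_mul, integral_noise, mul_zero]
  mean_v _ i := i.elim0
  cov_ε n i j := by
    have e : ∀ ω, err n ω i * err n ω j
        = √(var n 0 i) * √(var n 0 j) * (noise i ω * noise j ω) := fun ω => by
      simp only [err]; ring
    simp only [e]
    rw [integral_const_mul, integral_noise_mul]
    by_cases h : i = j
    · subst h
      rw [if_pos rfl, mul_one, Matrix.diagonal_apply_eq, Real.mul_self_sqrt (var_pos zero_mem i).le]
    · rw [if_neg fun h' => h (Fin.ext h'), mul_zero, Matrix.diagonal_apply_ne _ h]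
  cov_v _ i := i.elim0
  fourth_ε n i := by simp only [whiten_err]; rw [integral_noise_fourth]; norm_num
  fourth_v _ i := i.elim0

/-- The ordinary least squares estimator. -/
def ols : LinEst model := fun n _ => Matrix.of fun _ j => ind n j / (n + 1)

theorem Sig_eq (n : ℕ) (ψ : Fin 1 → ℝ) : model.Sig n ψ = Matrix.diagonal (var n ψ) := by
  simp [Model.Sig]

theorem Sig_affine (n : ℕ) (ψ : Fin 1 → ℝ) : model.Sig n ψ
    = Matrix.diagonal (var n 0) + ∑ a, ψ a • (1 : Matrix (Fin (size n)) (Fin (size n)) ℝ) := by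
  rw [Sig_eq, Fin.sum_univ_one, ← Matrix.diagonal_one, ← Matrix.diagonal_smul,
    Matrix.diagonal_add]
  congr 1
  funext i
  simp [var]

theorem sigLinear : model.SigLinear := fun n => ⟨_, _, fun ψ _ => Sig_affine n ψ⟩

theorem dSig_eq {n : ℕ} {ψ : Fin 1 → ℝ} (hψ : ψ ∈ model.Ψ) (a : Fin 1) : model.dSig n a ψ = 1 :=
  Model.dSig_eq_of_affine Metric.isOpen_ball (S := fun _ => 1) (fun ψ _ => Sig_affine n ψ) hψ a

theorem D_eq (n : ℕ) (a : Fin 1) : model.D n a = 1 := dSig_eq model.true_mem a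

theorem inv_Sig {n : ℕ} {ψ : Fin 1 → ℝ} (hψ : ψ ∈ model.Ψ) :
    (model.Sig n ψ)⁻¹ = Matrix.diagonal fun i => (var n ψ i)⁻¹ := by
  refine Matrix.inv_eq_left_inv ?_
  rw [Sig_eq, Matrix.diagonal_mul_diagonal, ← Matrix.diagonal_one]
  congr 1
  exact funext fun i => inv_mul_cancel₀ (var_pos hψ i).ne'

theorem WFH_eq {n : ℕ} {ψ : Fin 1 → ℝ} (hψ : ψ ∈ model.Ψ) (a : Fin 1) :
    model.WFH n a ψ = (model.Sig n ψ)⁻¹ := by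
  rw [Model.WFH, dSig_eq hψ, Matrix.mul_one, Matrix.one_mul, ← two_smul ℝ, smul_smul]
  norm_num

theorem regular : model.Regular where
  tendsto_N := tendsto_atTop_mono (fun n => show n ≤ size n by unfold size; omega) tendsto_id
  isOpen := Metric.isOpen_ball
  convex := convex_ball 0 _
  bounded := Metric.isBounded_ball
  eigen := by
    refine ⟨1 / 2, 3, by norm_num, .of_forall fun n ψ hψ x => ?_⟩
    rw [Sig_eq]
    simp only [dotProduct, Matrix.mulVec_diagonal, Finset.mul_sum]
    constructor <;> refine Finset.sum_le_sum fun i _ => ?_ <;>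
      nlinarith [var_bounds hψ i, mul_self_nonneg (x i)]
  ident := by
    refine ⟨1, one_pos, .of_forall fun n t => le_of_eq ?_⟩
    rw [Fin.sum_univ_one, Fin.sum_univ_one, dSig_eq model.true_mem]
    simp [dotProduct, Matrix.trace_one]
    ring
  indep_ε n := by
    have h : (fun i ω => whiten (model.Re n model.ψ₀) (model.ε n ω) i)
        = fun (i : Fin (size n)) => noise i.val := by
      funext i ω
      exact congrFun (whiten_err n ω) i
    rw [h]
    exact iIndepFun_noise.precomp Fin.val_injective
  indep_v n := by
    have : Subsingleton (Fin (model.m n)) := inferInstanceAs (Subsingleton (Fin 0))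
    exact iIndepFun.of_subsingleton
  eighth_ε := by
    refine ⟨√3 ^ 8, fun n i => ?_⟩
    have h : (fun ω => whiten (model.Re n model.ψ₀) (model.ε n ω) i) = noise i.val := by
      funext ω
      exact congrFun (whiten_err n ω) i
    have h' : ∀ ω, whiten (model.Re n model.ψ₀) (model.ε n ω) i = noise i.val ω := congrFun h
    rw [h]
    simp only [h']
    exact ⟨memLp_noise _ _, integral_noise_eighth_le _⟩
  eighth_v := ⟨0, fun _ i => i.elim0⟩

theorem ols_mul_design (n : ℕ) (ψ : Fin 1 → ℝ) : ols n ψ * model.X n = 1 := by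
  ext i j
  rw [Subsingleton.elim j i, Matrix.one_apply_eq, Matrix.mul_apply]
  change ∑ l, ind n l / (n + 1) * ind n l = 1
  rw [sum_ind n fun x => x / (n + 1) * x]
  have : (n : ℝ) + 1 ≠ 0 := by positivity
  field_simp
  norm_num

theorem unbiased : model.Unbiased ols := fun n ψ _ => ols_mul_design n ψ

/-- The orthogonal projection onto the column space of the design matrix. -/
def prj (n : ℕ) : Matrix (Fin (size n)) (Fin (size n)) ℝ :=
  Matrix.of fun i j => ind n i * ind n j / (n + 1)

theorem design_mul_ols (n : ℕ) (ψ : Fin 1 → ℝ) : model.X n * ols n ψ = prj n := by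
  ext i j
  rw [Matrix.mul_apply, Fin.sum_univ_one]
  change ind n i * (ind n j / (n + 1)) = ind n i * ind n j / (n + 1)
  ring

theorem prj_mul_prj (n : ℕ) : prj n * prj n = prj n := by
  rw [← design_mul_ols n 0, Matrix.mul_assoc, ← Matrix.mul_assoc (ols n 0), ols_mul_design,
    Matrix.one_mul]

theorem prj_transpose (n : ℕ) : (prj n)ᵀ = prj n := by
  ext i j
  simp only [prj, Matrix.transpose_apply, Matrix.of_apply]
  ring

theorem trace_prj (n : ℕ) : (prj n).trace = 1 := by
  rw [← design_mul_ols n 0, Matrix.trace_mul_comm, ols_mul_design]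
  simp

theorem abs_ind_mul_le (n : ℕ) (i j : Fin (size n)) : |ind n i * ind n j| ≤ 1 := by
  rcases ind_cases n i with h | h <;> rcases ind_cases n j with h' | h' <;> simp [h, h']

theorem two_div_size (n : ℕ) : (2 : ℝ) / (model.N n : ℕ) = 1 / (n + 1) := by
  have : (model.N n : ℝ) = (n + 1) + (n + 1) := by
    change ((size n : ℕ) : ℝ) = _
    push_cast [size]; ring
  rw [this, ← two_mul, ← div_div, div_self two_ne_zero]

theorem abs_prj_le (n : ℕ) (i j : Fin (size n)) : |prj n i j| ≤ 2 / (model.N n : ℕ) := by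
  have hn : (0 : ℝ) < n + 1 := by positivity
  rw [two_div_size, prj, Matrix.of_apply, abs_div, abs_of_pos hn]
  gcongr
  exact abs_ind_mul_le n i j

/-- Sandwiching a matrix which is constant on the second group between projections. -/
theorem ols_mul_diagonal (n : ℕ) (ψ : Fin 1 → ℝ) (g : ℝ → ℝ) :
    ols n ψ * Matrix.diagonal (fun i => g (ind n i)) = g 1 • ols n ψ := by
  ext i j
  rw [Matrix.mul_diagonal, Matrix.smul_apply, smul_eq_mul]
  change ind n j / (n + 1) * g (ind n j) = g 1 * (ind n j / (n + 1))
  rcases ind_cases n j with h | h <;> rw [h] <;> simp [mul_comm]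

theorem prj_mul_diagonal (n : ℕ) (g : ℝ → ℝ) :
    prj n * Matrix.diagonal (fun i => g (ind n i)) = g 1 • prj n := by
  rw [← design_mul_ols n 0, Matrix.mul_assoc, ols_mul_diagonal, Matrix.mul_smul]

theorem diagonal_mul_prj (n : ℕ) (g : ℝ → ℝ) :
    Matrix.diagonal (fun i => g (ind n i)) * prj n = g 1 • prj n := by
  have h := congrArg Matrix.transpose (prj_mul_diagonal n g)
  rwa [Matrix.transpose_mul, Matrix.diagonal_transpose, prj_transpose, Matrix.transpose_smul,
    prj_transpose] at h

theorem entry_const (n : ℕ) (i j : Fin (size n)) :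
    (fun φ => (model.X n * ols n φ) i j) = fun _ => prj n i j :=
  funext fun φ => congrFun (congrFun (design_mul_ols n φ) i) j

theorem orderConditions : model.OrderConditions ols model.WFH where
  smooth n i j := by
    rw [entry_const]
    exact contDiffOn_const
  quad := by
    refine ⟨2, .of_forall fun n a i j => ?_⟩
    have h0 : model.WFH n a model.ψ₀ = Matrix.diagonal fun i => (1 + ind n i + 0)⁻¹ := by
      rw [WFH_eq model.true_mem, inv_Sig model.true_mem]; rfl
    -- The weight equals 1/2 on the second group, the only one that the projection sees.
    have e : (ols n model.ψ₀)ᵀ * (model.X n)ᵀ * model.WFH n a model.ψ₀ * model.X n * ols n model.ψ₀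
        = (1 / 2 : ℝ) • prj n := by
      rw [← Matrix.transpose_mul, Matrix.mul_assoc _ (model.X n), design_mul_ols, h0, prj_transpose,
        prj_mul_diagonal n fun x => (1 + x + 0)⁻¹, Matrix.smul_mul, prj_mul_prj]
      norm_num
    rw [e, Matrix.smul_apply, smul_eq_mul, abs_mul]
    have := abs_prj_le n i j
    have := abs_nonneg (prj n i j)
    rw [abs_of_pos (by norm_num : (0 : ℝ) < 1 / 2)]
    linarith
  covL := by
    refine ⟨4, .of_forall fun n i j => ?_⟩
    have h0 : model.Sig n model.ψ₀ = Matrix.diagonal fun i => 1 + ind n i + 0 := by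
      rw [Sig_eq]; rfl
    have e : ols n model.ψ₀ * (ols n model.ψ₀)ᵀ = (1 / (n + 1) : ℝ) • 1 := by
      have : (ols n model.ψ₀)ᵀ = (1 / (n + 1) : ℝ) • model.X n := by
        ext i j
        change ind n i / (n + 1) = 1 / (n + 1) * ind n i
        ring
      rw [this, Matrix.mul_smul, ols_mul_design]
    rw [h0, ols_mul_diagonal n _ fun x => 1 + x + 0, Matrix.smul_mul, e, Subsingleton.elim j i,
      show (4 : ℝ) = 2 * 2 by norm_num, mul_div_assoc, two_div_size, Matrix.smul_apply,
      Matrix.smul_apply, Matrix.one_apply_eq, abs_of_nonneg (by positivity)]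
    simp only [smul_eq_mul]
    refine le_of_eq ?_
    ring
  leverage := by
    refine ⟨2, .of_forall fun n r _ ψ _ i j => ?_⟩
    rw [entry_const]
    rcases Nat.eq_zero_or_pos r with h | h
    · subst h
      rw [norm_iteratedFDeriv_zero]
      exact abs_prj_le n i j
    · rw [iteratedFDeriv_const_of_ne h.ne']
      simp
      positivity

end TwoGroups

/-! ### The estimator of the counterexample and its bias -/

namespace TwoGroups

/-- The residuals. -/
def res (n : ℕ) (ω : ℕ → Fin 6) : Fin (size n) → ℝ := (1 - prj n) *ᵥ model.y n ω

/-- The residual sum of squares of the first group. -/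
def rssOne (n : ℕ) (ω : ℕ → Fin 6) : ℝ := ∑ i, (1 - ind n i) * res n ω i ^ 2

/-- The residual sum of squares of the second group. -/
def rssTwo (n : ℕ) (ω : ℕ → Fin 6) : ℝ := ∑ i, ind n i * res n ω i ^ 2

theorem measurable_res (n : ℕ) (i : Fin (size n)) : Measurable fun ω => res n ω i := by
  have hy : ∀ j, Measurable fun ω => model.y n ω j := fun j => by
    have e : (fun ω => model.y n ω j) = fun ω => (model.X n *ᵥ model.β) j + model.dev n ω j :=
      funext fun ω => by rw [Model.y_eq, Pi.add_apply]
    rw [e]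
    exact ((measurable_pi_apply j).comp (model.measurable_dev n)).const_add _
  simp only [res, Matrix.mulVec, dotProduct]
  exact Finset.measurable_fun_sum _ fun j _ => (hy j).const_mul _

theorem measurable_rssOne (n : ℕ) : Measurable (rssOne n) :=
  Finset.measurable_fun_sum _ fun i _ => ((measurable_res n i).pow_const 2).const_mul _

theorem measurable_rssTwo (n : ℕ) : Measurable (rssTwo n) :=
  Finset.measurable_fun_sum _ fun i _ => ((measurable_res n i).pow_const 2).const_mul _

theorem rssOne_nonneg (n : ℕ) (ω : ℕ → Fin 6) : 0 ≤ rssOne n ω :=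
  Finset.sum_nonneg fun i _ => mul_nonneg
    (by rcases ind_cases n i with h | h <;> simp [h]) (sq_nonneg _)

/-- Σ(ψ) and the weights are constant on each group and commute with the projection. The equation
becomes scalar, with trace N - 1 = 2n + 1 because the projection has rank one. -/
theorem ee_eq (n : ℕ) (a : Fin 1) {ψ : Fin 1 → ℝ} (hψ : ψ ∈ model.Ψ) (ω : ℕ → Fin 6) :
    model.ee ols model.WFH n a ψ ω
      = rssOne n ω / (1 + ψ 0) + rssTwo n ω / (2 + ψ 0) - (2 * n + 1) := by
  have hQ : model.Q ols n ψ = 1 - prj n := by rw [Model.Q, design_mul_ols]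
  have hQt : (1 - prj n)ᵀ = 1 - prj n := by
    rw [Matrix.transpose_sub, Matrix.transpose_one, prj_transpose]
  have hQS : (1 - prj n) * model.Sig n ψ = model.Sig n ψ * (1 - prj n) := by
    have e : model.Sig n ψ = Matrix.diagonal fun i => 1 + ind n i + ψ 0 := Sig_eq n ψ
    rw [e, mul_sub, sub_mul, mul_one, one_mul, prj_mul_diagonal n fun x => 1 + x + ψ 0,
      diagonal_mul_prj n fun x => 1 + x + ψ 0]
  have hQQ : (1 - prj n) * (1 - prj n) = 1 - prj n := by
    rw [mul_sub, mul_one, sub_mul, one_mul, prj_mul_prj, sub_self, sub_zero]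
  have htr : ((1 - prj n) * model.WFH n a ψ * (1 - prj n) * model.Sig n ψ).trace = 2 * n + 1 := by
    rw [Matrix.mul_assoc, hQS, Matrix.mul_assoc, ← Matrix.mul_assoc (model.WFH n a ψ), WFH_eq hψ,
      Model.inv_mul_Sig n hψ, Matrix.one_mul, hQQ, Matrix.trace_sub, Matrix.trace_one, trace_prj,
      Fintype.card_fin]
    push_cast
    ring
  have hq : model.y n ω ⬝ᵥ (((1 - prj n) * model.WFH n a ψ * (1 - prj n)) *ᵥ model.y n ω)
      = ∑ i, res n ω i ^ 2 / var n ψ i := by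
    rw [Matrix.mul_assoc, ← Matrix.mulVec_mulVec, ← Matrix.mulVec_mulVec, Matrix.dotProduct_mulVec,
      ← Matrix.mulVec_transpose, hQt, WFH_eq hψ, inv_Sig hψ, dotProduct]
    refine Finset.sum_congr rfl fun i _ => ?_
    rw [Matrix.mulVec_diagonal, ← res]
    ring
  rw [Model.ee, hQ, hQt, htr, hq, rssOne, rssTwo, Finset.sum_div, Finset.sum_div,
    ← Finset.sum_add_distrib]
  congr 1
  refine Finset.sum_congr rfl fun i _ => ?_
  rw [var]
  rcases ind_cases n i with h | h <;> rw [h] <;> norm_num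

/-- The coefficients of the quadratic equation `a ψ² + b ψ + c = 0` for the estimator. -/
def lead (n : ℕ) : ℝ := 2 * n + 1

/-- The linear coefficient. -/
def lin (n : ℕ) (ω : ℕ → Fin 6) : ℝ := 3 * lead n - rssOne n ω - rssTwo n ω

/-- The constant coefficient. -/
def cst (n : ℕ) (ω : ℕ → Fin 6) : ℝ := 2 * lead n - 2 * rssOne n ω - rssTwo n ω

/-- The larger root of the quadratic equation. -/
def root (n : ℕ) (ω : ℕ → Fin 6) : ℝ :=
  (-lin n ω + √(lin n ω ^ 2 - 4 * lead n * cst n ω)) / (2 * lead n)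

/-- The estimator. -/
def est (n : ℕ) (ω : ℕ → Fin 6) : Fin 1 → ℝ := fun _ => if |root n ω| < 1 / 2 then root n ω else 0

theorem measurable_root (n : ℕ) : Measurable (root n) := by
  have h1 := measurable_rssOne n
  have h2 := measurable_rssTwo n
  have h3 : Measurable (lin n) := (h1.const_sub _).sub h2
  have h4 : Measurable (cst n) := ((h1.const_mul 2).const_sub _).sub h2
  exact (h3.neg.add (((h3.pow_const 2).sub (h4.const_mul _)).sqrt)).div_const _

/-- Clearing denominators gives a quadratic with leading coefficient N - 1 > 0 whose value at -1 is
minus the residual sum of squares of the first group, hence at most 0. So -1 lies between the roots,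
and a solution in Ψ, being larger than -1, must be the larger root. This gives uniqueness and a
measurable formula. -/
theorem eq_root {n : ℕ} {ψ : Fin 1 → ℝ} (hψ : ψ ∈ model.Ψ) {ω : ℕ → Fin 6}
    (h : model.ee ols model.WFH n 0 ψ ω = 0) : ψ 0 = root n ω := by
  have hb := abs_lt.1 (abs_lt_of_mem hψ)
  have h1 : 0 < 1 + ψ 0 := by linarith
  have h2 : 0 < 2 + ψ 0 := by linarith
  have ha : 0 < lead n := by unfold lead; positivity
  rw [ee_eq n 0 hψ, ← lead] at h
  have hq : lead n * ψ 0 ^ 2 + lin n ω * ψ 0 + cst n ω = 0 := by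
    field_simp at h
    rw [lin, cst]
    linear_combination -h
  -- By Vieta's formula this quantity is -(N - 1)(1 + ψ'), where ψ' is the other root: the claim is
  -- that ψ' ≤ -1.
  have hr : 0 ≤ lead n * (ψ 0 - 1) + lin n ω := by
    have h3 : lead n - lin n ω + cst n ω ≤ 0 := by
      rw [lin, cst]
      linarith [rssOne_nonneg n ω]
    have h4 : 0 ≤ (1 + ψ 0) * (lead n * (ψ 0 - 1) + lin n ω) := by nlinarith
    exact nonneg_of_mul_nonneg_right h4 h1
  have hs : √(lin n ω ^ 2 - 4 * lead n * cst n ω) = 2 * lead n * ψ 0 + lin n ω := by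
    rw [show lin n ω ^ 2 - 4 * lead n * cst n ω = (2 * lead n * ψ 0 + lin n ω) ^ 2 by
      linear_combination (-4 * lead n) * hq]
    refine Real.sqrt_sq ?_
    have := mul_pos ha h1
    linarith
  rw [root, hs]
  field_simp
  ring

/-- If the equation has a solution in Ψ, it is the root in the formula. Otherwise any point of Ψ is
allowed, so the default value 0 is harmless. -/
theorem isEstimator : model.IsEstimator ols model.WFH est where
  measurable n := measurable_pi_lambda _ fun _ =>
    Measurable.ite (measurableSet_lt (measurable_root n).abs measurable_const) (measurable_root n)
      measurable_const
  mem n ω := by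
    rw [mem_ball_zero_iff]
    refine (pi_norm_lt_iff (by norm_num)).2 fun a => ?_
    simp only [est]
    split_ifs with h
    · exact h
    · norm_num
  solves n ω := by
    rintro ⟨ψ, hψ, h⟩
    have e := eq_root hψ (h 0)
    have : est n ω = ψ := by
      funext a
      rw [Subsingleton.elim a 0, est, ← e, if_pos (abs_lt_of_mem hψ)]
    rw [this]
    exact h

theorem trace_inv_pow (n : ℕ) : ((model.S n)⁻¹).trace = 3 * (n + 1) / 2 ∧
    ((model.S n)⁻¹ * (model.S n)⁻¹).trace = 5 * (n + 1) / 4 := by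
  have h : (model.S n)⁻¹ = Matrix.diagonal fun i => (1 + ind n i + 0)⁻¹ := inv_Sig model.true_mem
  rw [h, Matrix.diagonal_mul_diagonal, Matrix.trace_diagonal, Matrix.trace_diagonal,
    sum_ind n fun x => (1 + x + 0)⁻¹, sum_ind n fun x => (1 + x + 0)⁻¹ * (1 + x + 0)⁻¹]
  constructor <;> ring

theorem eq_smul_one {A : Matrix (Fin 1) (Fin 1) ℝ} {x : ℝ} (h : A 0 0 = x) : A = x • 1 := by
  ext i j
  rw [Subsingleton.elim i 0, Subsingleton.elim j 0, h]
  simp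

/-- With k = 1 and Σ_(1) = I, the traces are A = tr Σ⁻¹, B = N, K = -tr Σ⁻¹ and H = -tr Σ⁻². The
bias is (2/A)(N tr Σ⁻² / (tr Σ⁻¹)² - 1) = (2/A)(10/9 - 1), where the strict Cauchy-Schwarz
inequality reflects the unequal variances. -/
theorem biasFH_eq (n : ℕ) : model.biasFH n 0 = 4 / (27 * (n + 1)) := by
  obtain ⟨t1, t2⟩ := trace_inv_pow n
  have hST : model.S n * (model.S n)⁻¹ = 1 := Model.Sig_mul_inv n model.true_mem
  have hTS : (model.S n)⁻¹ * model.S n = 1 := Model.inv_mul_Sig n model.true_mem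
  have hn : (n : ℝ) + 1 ≠ 0 := by positivity
  have hA : model.AFH n = (3 * (n + 1) / 2 : ℝ) • 1 := eq_smul_one (by
    simp only [Model.AFH, Matrix.of_apply, D_eq, Matrix.mul_one, t1])
  have hB : model.BFH n = (2 * (n + 1) : ℝ) • 1 := eq_smul_one (by
    simp only [Model.BFH, Matrix.of_apply, D_eq, Matrix.mul_one, hTS, Matrix.trace_one,
      Fintype.card_fin]
    push_cast
    ring)
  have hK : ∀ a, model.KFH n a = (-(3 * (n + 1) / 2) : ℝ) • 1 := fun a => eq_smul_one (by
    simp only [Model.KFH, Matrix.of_apply, D_eq, Matrix.mul_one, Matrix.one_mul, hST,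
      Matrix.add_mul, Matrix.trace_add, t1]
    ring)
  have hH : ∀ a, model.HFH n a = (-(5 * (n + 1) / 4) : ℝ) • 1 := fun a => eq_smul_one (by
    simp only [Model.HFH, Matrix.of_apply, D_eq, Matrix.mul_one, Matrix.one_mul, t2])
  have hI : (model.AFH n)⁻¹ = (2 / (3 * (n + 1)) : ℝ) • 1 := by
    refine Matrix.inv_eq_left_inv ?_
    rw [hA, smul_mul_smul_comm, Matrix.mul_one, show (2 / (3 * (n + 1)) : ℝ) * (3 * (n + 1) / 2) = 1
      by field_simp, one_smul]
  rw [Model.biasFH, hI]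
  simp only [hK, hH, hB, smul_mul_smul_comm, Matrix.mul_one, ← sub_smul, Matrix.trace_smul,
    Matrix.trace_one, Matrix.smul_mulVec, Matrix.one_mulVec, Pi.smul_apply, smul_eq_mul,
    Fintype.card_fin]
  field_simp
  ring

/-- N times the second-order bias is the constant 8/27, whereas second-order unbiasedness would make
it O(N^{-1/2}). -/
theorem not_secondOrderUnbiased : ¬ model.SecondOrderUnbiased est := by
  intro h
  have hb := (Model.asymptotics_WFH regular sigLinear rfl rfl unbiased orderConditions
    isEstimator).2.2
  have h1 : (fun n => model.biasFH n 0) =O[atTop] fun n => (model.N n : ℝ) ^ (-(3 / 2) : ℝ) :=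
    ((h 0).sub (hb 0)).congr_left fun n => by ring
  have h2 := (isBigO_refl (fun n => (model.N n : ℝ)) atTop).mul h1
  have h3 : (fun n => (model.N n : ℝ) * model.biasFH n 0) = fun _ => (8 / 27 : ℝ) := by
    funext n
    rw [biasFH_eq]
    have : (model.N n : ℝ) = (n + 1) + (n + 1) := by
      change ((size n : ℕ) : ℝ) = _
      push_cast [size]; ring
    rw [this]
    have hn : (n : ℝ) + 1 ≠ 0 := by positivity
    field_simp
    ring
  have hN : Tendsto (fun n => (model.N n : ℝ)) atTop atTop :=
    tendsto_natCast_atTop_atTop.comp regular.tendsto_N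
  have h4 : Tendsto (fun n => (model.N n : ℝ) * (model.N n : ℝ) ^ (-(3 / 2) : ℝ)) atTop (𝓝 0) := by
    have h5 := (tendsto_rpow_neg_atTop (by norm_num : (0 : ℝ) < 1 / 2)).comp hN
    refine h5.congr fun n => ?_
    have hp : (0 : ℝ) < model.N n := by
      change (0 : ℝ) < (size n : ℕ)
      exact_mod_cast (by unfold size; omega : 0 < size n)
    rw [Function.comp_apply]
    nth_rewrite 2 [← Real.rpow_one (model.N n : ℝ)]
    rw [← Real.rpow_add hp]
    norm_num
  rw [h3] at h2
  have h6 := tendsto_nhds_unique (h2.trans_tendsto h4) tendsto_const_nhds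
  norm_num at h6

end TwoGroups

end VarComp

end

theorem proposition2 :
    -- the asymptotic covariances and second-order biases of the three estimators
    (∀ {k p : ℕ} {Ω : Type*} [MeasurableSpace Ω] (μ : Measure Ω) [IsProbabilityMeasure μ]
      (M : VarComp.Model k p μ) (L : VarComp.LinEst M),
      M.Regular → M.SigLinear → M.Ke = 0 → M.Kv = 0 → M.Unbiased L →
      -- (a) REML-type
      (∀ ψhat : ∀ _ : ℕ, Ω → Fin k → ℝ, M.OrderConditions L M.WRE → M.IsEstimator L M.WRE ψhat →
        (∀ᶠ n in atTop, IsUnit (M.ARE n).det) ∧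
        M.SecondOrderUnbiased ψhat ∧
        M.HasAsympCov ψhat (fun n => (2 : ℝ) • (M.ARE n)⁻¹)) ∧
      -- (b) FH-type
      (∀ ψhat : ∀ _ : ℕ, Ω → Fin k → ℝ, M.OrderConditions L M.WFH → M.IsEstimator L M.WFH ψhat →
        (∀ᶠ n in atTop, IsUnit (M.AFH n).det) ∧
        M.HasAsympCov ψhat (fun n => (2 : ℝ) • ((M.AFH n)⁻¹ * M.BFH n * (M.AFH n)⁻¹)) ∧
        M.HasSecondOrderBias ψhat M.biasFH) ∧
      -- (c) PR-type
      (∀ ψhat : ∀ _ : ℕ, Ω → Fin k → ℝ, M.OrderConditions L M.WQ → M.IsEstimator L M.WQ ψhat →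
        (∀ᶠ n in atTop, IsUnit (M.AQ n).det) ∧
        M.SecondOrderUnbiased ψhat ∧
        M.HasAsympCov ψhat (fun n => (2 : ℝ) • ((M.AQ n)⁻¹ * M.BQ n * (M.AQ n)⁻¹)))) ∧
    -- (b), continued: the FH-type estimator is not second-order unbiased in general
    (∃ (k p : ℕ) (Ω : Type) (_ : MeasurableSpace Ω) (μ : Measure Ω) (_ : IsProbabilityMeasure μ)
      (M : VarComp.Model k p μ) (L : VarComp.LinEst M) (ψhat : ∀ _ : ℕ, Ω → Fin k → ℝ),
      1 ≤ p ∧ M.Regular ∧ M.SigLinear ∧ M.Ke = 0 ∧ M.Kv = 0 ∧ M.Unbiased L ∧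
      M.OrderConditions L M.WFH ∧ M.IsEstimator L M.WFH ψhat ∧
      ¬ M.SecondOrderUnbiased ψhat) := by
  refine ⟨fun μ _ M L hreg hlin he hv hL => ⟨fun ψhat hord hest => ?_, fun ψhat hord hest => ?_,
    fun ψhat hord hest => ?_⟩, ?_⟩
  · exact VarComp.Model.asymptotics_WRE hreg hlin he hv hL hord hest
  · exact VarComp.Model.asymptotics_WFH hreg hlin he hv hL hord hest
  · exact VarComp.Model.asymptotics_WQ hreg hlin he hv hL hord hest
  · exact ⟨1, 1, ℕ → Fin 6, inferInstance, VarComp.TwoGroups.law, inferInstance,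
      VarComp.TwoGroups.model, VarComp.TwoGroups.ols, VarComp.TwoGroups.est, le_rfl,
      VarComp.TwoGroups.regular, VarComp.TwoGroups.sigLinear, rfl, rfl, VarComp.TwoGroups.unbiased,
      VarComp.TwoGroups.orderConditions, VarComp.TwoGroups.isEstimator,
      VarComp.TwoGroups.not_secondOrderUnbiased⟩
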